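/- **Setting.** Let $m$ be the number of miners, $\mathsf{ID}$ a finite set of user identities, $\mathbb F$ a finite field with distinct nonzero points $x_1,\dots,x_m$ (all fixed independently of the security parameter $\lambda$), and let $t=\lceil m/2\rceil$. Efficient algorithms and adversaries are non-uniform probabilistic polynomial time (PPT: families of polynomial-size Boolean circuits with uniformly random input bits), $\equiv_c$ is indistinguishability by non-uniform PPT distinguishers, and "negligible" means $O(\lambda^{-c})$ for every $c$. The network is synchronous with authenticated private channels and a broadcast channel. *Secret sharing.* A $t$-out-of-$m$ Shamir sharing of $s\in\mathbb F$ consists of the values at $x_1,\dots,x_m$ of $s+\sum_{k=1}^{t-1}a_kx^k$ with uniform $a_k\in\mathbb F$; reconstruction from shares with index set $I$ returns the value at $0$ of the polynomial of degree $<t$ through them, and fails if $|I|<t$ or there is no such polynomial. *Commitments.* $\mathsf{comm}(X,r)$ is computable in polynomial time, with $X\in\{0,1\}^{\ell(\lambda)}$, $r\in\{0,1\}^\lambda$; elements of $\mathbb F$ are injectively encoded as messages. It is perfectly binding if $\mathsf{comm}(X,r)\ne\mathsf{comm}(X',r')$ whenever $X\neq X'$, and computationally hiding if for all sequences $X,X'$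 of messages, $\mathsf{comm}(X,r)\equiv_c\mathsf{comm}(X',r)$ for uniform $r$. *NIZK.* A multi-CRS NIZK for a relation $\mathcal R$ with $m$ contributors consists of PPT algorithms $\mathsf K(1^\lambda)$ (CRS generation), $\mathsf P(\mathrm{CRS},\mathsf{stmt},w)$, a deterministic polynomial-time verifier $\mathsf V(\mathrm{CRS},\mathsf{stmt},\pi)\in\{0,1\}$, and PPT simulators $\widetilde{\mathsf K}(1^\lambda)$ (outputs a CRS and a trapdoor) and $\widetilde{\mathsf P}(\mathrm{CRS},\vec\tau,\mathsf{stmt})$, where $\mathrm{CRS}=(\mathsf{crs}_j)_{j\in[m]}$. In the games below the adversary makes polynomially many calls to a generation oracle and then fixes a CRS vector; it is *minority-constrained* if at least $\lfloor m/2\rfloor+1$ entries of this vector are always among the oracle's CRSes; $\vec\tau$ (resp. $\overrightarrow{\mathsf{ek}}$) consists of the trapdoors (resp. extraction keys) of those entries that the oracle generated. - *Completeness (honest majority):* if at least $\lfloor m/2\rfloor+1$ entries of $\mathrm{CRS}$ lie in the support of $\mathsf K(1^\lambda)$ and $\mathcal R(\mathsf{stmt},w)=1$, then $\mathsf V(\mathrm{CRS},\mathsf{stmt},\mathsf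 P(\mathrm{CRS},\mathsf{stmt},w))=1$ with probability $1$. - *Zero-knowledge:* the CRSes output by $\mathsf K$ and $\widetilde{\mathsf K}$ are computationally indistinguishable; and for every minority-constrained non-uniform PPT $\mathcal A$, which calls $\widetilde{\mathsf K}$ (receiving CRSes and trapdoors), outputs $\mathrm{CRS},\mathsf{stmt},w$, and receives $\pi$, the probabilities that $\mathcal R(\mathsf{stmt},w)=1$ and $\mathcal A$ outputs $1$ differ negligibly between $\pi\leftarrow\mathsf P(\mathrm{CRS},\mathsf{stmt},w)$ and $\pi\leftarrow\widetilde{\mathsf P}(\mathrm{CRS},\vec\tau,\mathsf{stmt})$. - *Simulation sound extractability:* there are PPT $\widetilde{\mathsf K}_0$, which outputs triples $(\mathsf{crs},\tau,\mathsf{ek})$ whose first two components are distributed as $\widetilde{\mathsf K}(1^\lambda)$, and $\mathcal E$ such that every minority-constrained non-uniform PPT $\mathcal A$ that calls $\widetilde{\mathsf K}_0$ (receiving $\mathsf{crs},\mathsf{ek}$), fixes $\mathrm{CRS}$, adaptively obtains polynomially many proofs $\widetilde{\mathsf P}(\mathrm{CRS},\vec\tau,\cdot)$ of statements of its choice, and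 outputs $(\mathsf{stmt},\pi)$, has only negligible probability that $(\mathsf{stmt},\pi)$ is not one of the pairs obtained, $\mathsf V(\mathrm{CRS},\mathsf{stmt},\pi)=1$, and $\mathcal R(\mathsf{stmt},w)=0$ for $w\leftarrow\mathcal E(\mathrm{CRS},\overrightarrow{\mathsf{ek}},\mathsf{stmt},\pi)$. *Mechanism and $\mathcal F_{\rm MPC}$.* A transaction fee mechanism is a randomized polynomial-time map from bid vectors $\mathbf b\in\mathbb F^{\mathsf{ID}}$ to outcomes (which bids are confirmed, the payments, with payment $0$ for unconfirmed bids, and the total miner revenue). $\mathcal F_{\rm MPC}$ receives one bid from each identity, runs the mechanism and sends the outcome to everyone. *Protocol $\Pi_{\rm MPC}$.* Identity $i$ has bid $b_i\in\mathbb F$; $\mathcal C$ is initially empty. (1) Each miner $j$ broadcasts $\mathsf{crs}_j\leftarrow\mathsf K(1^\lambda)$ (replaced by $0$ if missing). (2) Each identity $i$ splits $b_i$ into Shamir shares $X_{i,j}$ and broadcasts $\widehat X_{i,j}=\mathsf{comm}(X_{i,j},r_{i,j})$, $j\in[m]$, with fresh $r_{i,j}$. (3) Identity $i$ broadcasts a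 NIZK proof, for the statement $(i,(\widehat X_{i,j})_j)$ with witness $(b_i,(X_{i,j},r_{i,j})_j)$, that every $(X_{i,j},r_{i,j})$ opens $\widehat X_{i,j}$ and $(X_{i,j})_j$ is a valid $t$-out-of-$m$ sharing of $b_i$. (4) Identities that did not broadcast their commitments or an accepted proof are put into $\mathcal C$. (5) Identity $i$ sends $(X_{i,j},r_{i,j})$ privately to each miner $j$. (6) Each miner $j$ broadcasts, for every $i\in\mathsf{ID}\setminus\mathcal C$, "ok" if it received a correct opening of $\widehat X_{i,j}$ (which it records), and a complaint otherwise. (7) Identity $i$ broadcasts the opening $(X_{i,j},r_{i,j})$ for every miner $j$ that complained about $i$; miners record correct openings. (8) Identities with a complaint not answered by a correct opening are put into $\mathcal C$. (9) The miners send their recorded openings to the ideal functionality $\mathcal F_{\rm TFM}$, which discards incorrect openings, reconstructs $b_i$ for $i\in\mathsf{ID}\setminus\mathcal C$ from the correct ones ($0$ if this fails), sets $b_i=0$ for $i\in\mathcal C$, runs the mechanism on $\mathbf b$ and sends the outcome to every miner. Miners output the outcome and announce it to the identities; an identity outputs the value announced by more than half of the miners. **Theorem.** Assume that $\mathsf{comm}$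 is perfectly binding and computationally hiding, and that the multi-CRS NIZK satisfies completeness, zero-knowledge and simulation sound extractability for the relation proved in step (3). Then $\Pi_{\rm MPC}$ securely realizes $\mathcal F_{\rm MPC}$ in the $\mathcal F_{\rm TFM}$-hybrid model against every coalition with fewer than $m/2$ miners. That is: for every set of corrupted miners of size less than $m/2$, every set of corrupted identities, and every non-uniform PPT adversary $\mathcal A$ that controls them in the protocol (malicious, static, rushing, with polynomially long auxiliary input), there is a non-uniform PPT simulator $\mathcal S$, which gets the same auxiliary input, chooses the corrupted identities' bids to $\mathcal F_{\rm MPC}$, receives the outcome and outputs a simulated view, such that for all sequences of honest bids and of auxiliary inputs, the joint distribution of the honest parties' outputs and $\mathcal A$'s view (auxiliary input, random coins, received messages) in the protocol is computationally indistinguishable from the joint distribution of the honest parties' outputs and $\mathcal S$'s output in the ideal world. -/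

import Mathlib

noncomputable section

namespace MPCAuction

open scoped Classical

/-! ## Bit strings, Boolean circuits, non-uniform probabilistic polynomial time -/

/-- Bit strings of length `k`. -/
abbrev Bits (k : ℕ) : Type := Fin k → Bool

/-- The all-zero bit string. -/
def zeroBits (k : ℕ) : Bits k := fun _ => false

/-- A fixed-length binary encoding of a type: every element is written injectively on a
finite set of wires. -/
class BitCode (α : Type) where
  Wire : Type
  [fin : Fintype Wire]
  bits : α → Wire → Bool
  bits_injective : Function.Injective bits

attribute [reducible, instance] BitCode.fin

instance : BitCode Bool where
  Wire := Unit
  bits b _ := b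
  bits_injective := fun _ _ h => congrFun h ()

/-- Elements of `Fin k` are encoded by their indicator vector. -/
instance (k : ℕ) : BitCode (Fin k) where
  Wire := Fin k
  bits a w := decide (a = w)
  bits_injective := fun a b h => by
    have := congrFun h b
    simpa using this

instance {α β : Type} [BitCode α] [BitCode β] : BitCode (α × β) where
  Wire := BitCode.Wire α ⊕ BitCode.Wire β
  bits x := Sum.elim (BitCode.bits x.1) (BitCode.bits x.2)
  bits_injective := fun x y h => by
    refine Prod.ext (BitCode.bits_injective ?_) (BitCode.bits_injective ?_)
    · funext w
      exact congrFun h (Sum.inl w)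
    · funext w
      exact congrFun h (Sum.inr w)

/-- A tuple is encoded entry by entry. -/
instance {k : ℕ} {α : Type} [BitCode α] : BitCode (Fin k → α) where
  Wire := Fin k × BitCode.Wire α
  bits x w := BitCode.bits (x w.1) w.2
  bits_injective := fun x y h => by
    funext i
    refine BitCode.bits_injective ?_
    funext w
    exact congrFun h (i, w)

/-- A possibly missing message: one presence bit, and the bits of the message. -/
instance {α : Type} [BitCode α] : BitCode (Option α) where
  Wire := Option (BitCode.Wire α)
  bits x w := match x, w with
    | none, _ => false
    | some _, none => true
    | some a, some w => BitCode.bits a w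
  bits_injective := fun x y h => by
    cases x with
    | none =>
      cases y with
      | none => rfl
      | some b => exact absurd (congrFun h none) (by simp)
    | some a =>
      cases y with
      | none => exact absurd (congrFun h none) (by simp)
      | some b =>
        refine congrArg some (BitCode.bits_injective ?_)
        funext w
        exact congrFun h (some w)

/-- Boolean circuits with output wires `W` over a set of input wires, as straight-line programs:
every gate (a constant or a NAND of two wires) adds one wire to the available ones. -/
inductive Circuit (W : Type) : Type → Type 1
  | out {V : Type} (o : W → V) : Circuit W V
  | const {V : Type} (b : Bool) (rest : Circuit W (Option V)) : Circuit W V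
  | nand {V : Type} (u v : V) (rest : Circuit W (Option V)) : Circuit W V

/-- The value of a circuit on an input. -/
def Circuit.eval {W : Type} : {V : Type} → Circuit W V → (V → Bool) → W → Bool
  | _, .out o, x => fun w => x (o w)
  | _, .const b rest, x => rest.eval (fun v => v.elim b x)
  | _, .nand u v rest, x => rest.eval (fun w => w.elim (!(x u && x v)) x)

/-- The number of gates. -/
def Circuit.size {W : Type} : {V : Type} → Circuit W V → ℕ
  | _, .out _ => 0
  | _, .const _ rest => rest.size + 1
  | _, .nand _ _ rest => rest.size + 1

/-- `f` is computed, on encodings, by a circuit with at most `s` gates. -/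
def ComputableInSize {α β : Type} [BitCode α] [BitCode β] (f : α → β) (s : ℕ) : Prop :=
  ∃ C : Circuit (BitCode.Wire β) (BitCode.Wire α),
    C.size ≤ s ∧ ∀ a, C.eval (BitCode.bits a) = BitCode.bits (f a)

/-- Bounded by a polynomial in the security parameter. -/
def PolyBounded (s : ℕ → ℕ) : Prop := ∃ p : Polynomial ℕ, ∀ n, s n ≤ p.eval n

/-- The elements of the types `α n` have encodings of polynomial length. -/
def PolyLength (α : ℕ → Type) [∀ n, BitCode (α n)] : Prop :=
  PolyBounded fun n => Fintype.card (BitCode.Wire (α n))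

/-- Non-uniform deterministic polynomial time: polynomial-size circuit families. -/
def PolyTime {α β : ℕ → Type} [∀ n, BitCode (α n)] [∀ n, BitCode (β n)]
    (f : ∀ n, α n → β n) : Prop :=
  ∃ p : Polynomial ℕ, ∀ n, ComputableInSize (f n) (p.eval n)

/-- Non-uniform probabilistic polynomial time: polynomial-size circuit families that receive
polynomially many uniformly random bits besides their input. -/
def PPT {α β : ℕ → Type} [∀ n, BitCode (α n)] [∀ n, BitCode (β n)]
    (f : ∀ n, α n → PMF (β n)) : Prop :=
  ∃ p : Polynomial ℕ, ∀ n, ∃ (r : ℕ) (g : α n × Bits r → β n),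
    r ≤ p.eval n ∧ ComputableInSize g (p.eval n) ∧
      ∀ a, f n a = (PMF.uniformOfFintype (Bits r)).map fun ω => g (a, ω)

/-- A probabilistic polynomial time algorithm with no input besides the security parameter. -/
def PPTSampler {β : ℕ → Type} [∀ n, BitCode (β n)] (f : ∀ n, PMF (β n)) : Prop :=
  PPT (α := fun _ => Fin 0 → Bool) fun n _ => f n

/-- Negligible functions of the security parameter. -/
def Negligible (f : ℕ → ℝ) : Prop :=
  Asymptotics.SuperpolynomialDecay Filter.atTop (fun n : ℕ => (n : ℝ)) f

/-- The probability that an experiment returns `true`. -/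
def prTrue (p : PMF Bool) : ℝ := (p true).toReal

/-- Computational indistinguishability of two ensembles, against non-uniform PPT
distinguishers. -/
def CompIndist {α : ℕ → Type} [∀ n, BitCode (α n)] (p q : ∀ n, PMF (α n)) : Prop :=
  ∀ D : ∀ n, α n → PMF Bool, PPT D →
    Negligible fun n => |prTrue ((p n).bind (D n)) - prTrue ((q n).bind (D n))|

/-- Independent samples, the `i`-th one from `p i`. -/
def indep {α : Type} : {k : ℕ} → (Fin k → PMF α) → PMF (Fin k → α)
  | 0, _ => PMF.pure Fin.elim0
  | _ + 1, p => (p 0).bind fun a => (indep fun i => p i.succ).map fun f => Fin.cons a f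

/-! ## Commitments -/

/-- A non-interactive commitment scheme with message space `{0,1}^ℓ(n)` and coins `{0,1}^n`,
where `n` is the security parameter. -/
structure CommitmentScheme where
  msgLen : ℕ → ℕ
  comLen : ℕ → ℕ
  msgLen_poly : PolyBounded msgLen
  comLen_poly : PolyBounded comLen
  commit : ∀ n, Bits (msgLen n) → Bits n → Bits (comLen n)
  commit_poly : PolyTime (α := fun n => Bits (msgLen n) × Bits n) (β := fun n => Bits (comLen n))
    fun n x => commit n x.1 x.2

def CommitmentScheme.PerfectlyBinding (cs : CommitmentScheme) : Prop :=
  ∀ n (X X' : Bits (cs.msgLen n)) (r r' : Bits n), X ≠ X' → cs.commit n X r ≠ cs.commit n X' r'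

def CommitmentScheme.ComputationallyHiding (cs : CommitmentScheme) : Prop :=
  ∀ X X' : ∀ n, Bits (cs.msgLen n),
    CompIndist (α := fun n => Bits (cs.comLen n))
      (fun n => (PMF.uniformOfFintype (Bits n)).map (cs.commit n (X n)))
      (fun n => (PMF.uniformOfFintype (Bits n)).map (cs.commit n (X' n)))

/-! ## Shamir secret sharing

`pt j` is the (nonzero) evaluation point of the `j`-th share. -/

section Shamir

variable {F : Type} [Field F] {m : ℕ}

/-- The `t`-out-of-`m` sharing of `s`: the values at the points `pt j` of the polynomial
`s + a 0 * x + ⋯ + a (t-2) * x ^ (t-1)` with uniformly random coefficients. -/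
def share [Fintype F] (t : ℕ) (pt : Fin m → F) (s : F) : PMF (Fin m → F) :=
  (PMF.uniformOfFintype (Fin (t - 1) → F)).map fun a j =>
    s + ∑ k : Fin (t - 1), a k * pt j ^ (k.val + 1)

/-- `X` is a valid `t`-out-of-`m` sharing of `s`. -/
def IsSharing (t : ℕ) (pt : Fin m → F) (s : F) (X : Fin m → F) : Prop :=
  ∃ p : Polynomial F, p.degree < t ∧ p.eval 0 = s ∧ ∀ j, p.eval (pt j) = X j

/-- Reconstruction from the shares with index in `I`, by interpolation; it fails if there are
fewer than `t` shares or if they lie on no polynomial of degree less than `t`. -/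
def reconstruct (t : ℕ) (pt : Fin m → F) (I : Finset (Fin m)) (X : Fin m → F) : Option F :=
  if t ≤ I.card ∧ (Lagrange.interpolate I pt X).degree < t then
    some ((Lagrange.interpolate I pt X).eval 0)
  else none

end Shamir

/-! ## Multi-CRS non-interactive zero-knowledge proofs -/

/-- The algorithms of a multi-CRS NIZK with `m` contributors: CRS generation `K`, prover `P`,
verifier `V`, simulated CRS generation `simK` (with trapdoor) and simulated prover `simP`, which
gets the trapdoors of those CRSes whose trapdoor is known. -/
structure NIZK (m : ℕ) (Stmt Wit : ℕ → Type) [∀ n, BitCode (Stmt n)] [∀ n, BitCode (Wit n)] where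
  crsLen : ℕ → ℕ
  proofLen : ℕ → ℕ
  trapLen : ℕ → ℕ
  crsLen_poly : PolyBounded crsLen
  proofLen_poly : PolyBounded proofLen
  trapLen_poly : PolyBounded trapLen
  K : ∀ n, PMF (Bits (crsLen n))
  P : ∀ n, (Fin m → Bits (crsLen n)) × Stmt n × Wit n → PMF (Bits (proofLen n))
  V : ∀ n, (Fin m → Bits (crsLen n)) × Stmt n × Bits (proofLen n) → Bool
  simK : ∀ n, PMF (Bits (crsLen n) × Bits (trapLen n))
  simP : ∀ n, (Fin m → Bits (crsLen n)) × (Fin m → Option (Bits (trapLen n))) × Stmt n →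
    PMF (Bits (proofLen n))
  K_ppt : PPTSampler K
  P_ppt : PPT P
  V_poly : PolyTime V
  simK_ppt : PPTSampler simK
  simP_ppt : PPT simP

/-- At least `⌊m/2⌋ + 1` of the entries of `crs` occur among the generated ones. -/
def MajorityGenerated {m q : ℕ} {C : Type} (gen : Fin q → C) (crs : Fin m → C) : Prop :=
  m / 2 + 1 ≤ (Finset.univ.filter fun j => ∃ k, gen k = crs j).card

/-- The vector of the keys that belong to those entries of `crs` that were generated. -/
def keysOf {m q : ℕ} {C T : Type} (gen : Fin q → C × T) (crs : Fin m → C) : Fin m → Option T :=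
  fun j => ((List.ofFn gen).find? fun g => decide (g.1 = crs j)).map Prod.snd

namespace NIZK

variable {m : ℕ} {Stmt Wit : ℕ → Type} [∀ n, BitCode (Stmt n)] [∀ n, BitCode (Wit n)]

abbrev CRS (Z : NIZK m Stmt Wit) (n : ℕ) : Type := Bits (Z.crsLen n)
abbrev Proof (Z : NIZK m Stmt Wit) (n : ℕ) : Type := Bits (Z.proofLen n)
abbrev Trap (Z : NIZK m Stmt Wit) (n : ℕ) : Type := Bits (Z.trapLen n)

/-- Perfect completeness with an honest majority: honest proofs are accepted as soon as at least
`⌊m/2⌋ + 1` of the CRSes lie in the support of `K`. -/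
def Complete (Z : NIZK m Stmt Wit) (R : ∀ n, Stmt n → Wit n → Prop) : Prop :=
  ∀ n (crs : Fin m → Z.CRS n),
    m / 2 + 1 ≤ (Finset.univ.filter fun j => crs j ∈ (Z.K n).support).card →
    ∀ x w, R n x w → ∀ π ∈ (Z.P n (crs, x, w)).support, Z.V n (crs, x, π) = true

/-- A non-uniform PPT adversary against zero knowledge. As the oracle for simulated CRSes takes no
input, the answers to its `queries n` calls, trapdoors included, are handed over at once. -/
structure ZKAdversary (Z : NIZK m Stmt Wit) where
  State : ℕ → Type
  [code : ∀ n, BitCode (State n)]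
  state_poly : PolyLength State
  queries : ℕ → ℕ
  queries_poly : PolyBounded queries
  choose : ∀ n, (Fin (queries n) → Z.CRS n × Z.Trap n) →
    PMF ((Fin m → Z.CRS n) × Stmt n × Wit n × State n)
  guess : ∀ n, State n × Z.Proof n → PMF Bool
  choose_ppt : PPT choose
  guess_ppt : PPT guess

/-- Whatever it receives, the adversary outputs a CRS vector the majority of which was generated
by the oracle. -/
def ZKAdversary.MinorityConstrained {Z : NIZK m Stmt Wit} (A : Z.ZKAdversary) : Prop :=
  ∀ n gen, ∀ o ∈ (A.choose n gen).support, MajorityGenerated (fun k => (gen k).1) o.1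

/-- The zero-knowledge experiment, with a real or a simulated proof. It returns `true` when the
adversary outputs 1 and its statement and witness are in the relation. -/
def zkGame (Z : NIZK m Stmt Wit) (R : ∀ n, Stmt n → Wit n → Prop) (A : Z.ZKAdversary)
    (simulated : Bool) (n : ℕ) : PMF Bool := do
  let gen ← indep fun _ : Fin (A.queries n) => Z.simK n
  let (crs, x, w, st) ← A.choose n gen
  let π ← if simulated then Z.simP n (crs, keysOf gen crs, x) else Z.P n (crs, x, w)
  let g ← A.guess n (st, π)
  return g && decide (R n x w)

def ZeroKnowledge (Z : NIZK m Stmt Wit) (R : ∀ n, Stmt n → Wit n → Prop) : Prop :=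
  CompIndist (α := Z.CRS) Z.K (fun n => (Z.simK n).map Prod.fst) ∧
  ∀ A : Z.ZKAdversary, A.MinorityConstrained →
    Negligible fun n => |prTrue (Z.zkGame R A false n) - prTrue (Z.zkGame R A true n)|

/-- A non-uniform PPT adversary against simulation sound extractability. It gets generated CRSes
with extraction keys, fixes a CRS vector, asks adaptively for `proofs n` simulated proofs, and
finally outputs a statement and a proof. -/
structure SSEAdversary (Z : NIZK m Stmt Wit) (ekLen : ℕ → ℕ) where
  State : ℕ → Type
  [code : ∀ n, BitCode (State n)]
  state_poly : PolyLength State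
  queries : ℕ → ℕ
  queries_poly : PolyBounded queries
  proofs : ℕ → ℕ
  proofs_poly : PolyBounded proofs
  choose : ∀ n, (Fin (queries n) → Z.CRS n × Bits (ekLen n)) → PMF ((Fin m → Z.CRS n) × State n)
  ask : ∀ n, State n → PMF (Stmt n × State n)
  receive : ∀ n, State n × Z.Proof n → PMF (State n)
  finish : ∀ n, State n → PMF (Stmt n × Z.Proof n)
  choose_ppt : PPT choose
  ask_ppt : PPT ask
  receive_ppt : PPT receive
  finish_ppt : PPT finish

def SSEAdversary.MinorityConstrained {Z : NIZK m Stmt Wit} {ekLen : ℕ → ℕ}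
    (A : Z.SSEAdversary ekLen) : Prop :=
  ∀ n gen, ∀ o ∈ (A.choose n gen).support, MajorityGenerated (fun k => (gen k).1) o.1

/-- `k` calls of the adversary to the simulated prover; the pairs of statements and proofs are
recorded. -/
def proveLoop (Z : NIZK m Stmt Wit) {ekLen : ℕ → ℕ} (A : Z.SSEAdversary ekLen) (n : ℕ)
    (crs : Fin m → Z.CRS n) (trap : Fin m → Option (Z.Trap n)) :
    ℕ → A.State n → List (Stmt n × Z.Proof n) → PMF (A.State n × List (Stmt n × Z.Proof n))
  | 0, st, log => PMF.pure (st, log)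
  | k + 1, st, log => do
    let (x, st) ← A.ask n st
    let π ← Z.simP n (crs, trap, x)
    let st ← A.receive n (st, π)
    proveLoop Z A n crs trap k st ((x, π) :: log)

/-- The extraction experiment; `true` means that the adversary wins: its fresh proof is accepted,
but the extractor fails to find a witness. -/
def sseGame (Z : NIZK m Stmt Wit) (R : ∀ n, Stmt n → Wit n → Prop) {ekLen : ℕ → ℕ}
    (K₀ : ∀ n, PMF (Z.CRS n × Z.Trap n × Bits (ekLen n)))
    (E : ∀ n, (Fin m → Z.CRS n) × (Fin m → Option (Bits (ekLen n))) × Stmt n × Z.Proof n →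
      PMF (Wit n))
    (A : Z.SSEAdversary ekLen) (n : ℕ) : PMF Bool := do
  let gen ← indep fun _ : Fin (A.queries n) => K₀ n
  let (crs, st) ← A.choose n fun k => ((gen k).1, (gen k).2.2)
  let trap := keysOf (fun k => ((gen k).1, (gen k).2.1)) crs
  let ek := keysOf (fun k => ((gen k).1, (gen k).2.2)) crs
  let (st, log) ← Z.proveLoop A n crs trap (A.proofs n) st []
  let (x, π) ← A.finish n st
  let w ← E n (crs, ek, x, π)
  return decide ((x, π) ∉ log ∧ ¬ R n x w ∧ Z.V n (crs, x, π) = true)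

def SimulationSoundExtractable (Z : NIZK m Stmt Wit) (R : ∀ n, Stmt n → Wit n → Prop) : Prop :=
  ∃ (ekLen : ℕ → ℕ) (K₀ : ∀ n, PMF (Z.CRS n × Z.Trap n × Bits (ekLen n)))
    (E : ∀ n, (Fin m → Z.CRS n) × (Fin m → Option (Bits (ekLen n))) × Stmt n × Z.Proof n →
      PMF (Wit n)),
    PolyBounded ekLen ∧ PPTSampler K₀ ∧ PPT E ∧
    (∀ n, (K₀ n).map (fun s => (s.1, s.2.1)) = Z.simK n) ∧
    ∀ A : Z.SSEAdversary ekLen, A.MinorityConstrained →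
      Negligible fun n => prTrue (Z.sseGame R K₀ E A n)

end NIZK

attribute [instance] NIZK.ZKAdversary.code NIZK.SSEAdversary.code

/-! ## Transaction fee mechanisms -/

/-- The result of an auction with `N` bids: which bids are confirmed, the payments, and the total
miner revenue; amounts are binary strings of length `v`. -/
abbrev Outcome (N v : ℕ) : Type := (Fin N → Bool) × (Fin N → Bits v) × Bits v

/-- A randomized polynomial-time transaction fee mechanism: the joint law of the outputs of the
allocation, payment and miner revenue rules; unconfirmed bids pay 0. -/
structure Mechanism (F : Type) [BitCode F] (N : ℕ) where
  amountLen : ℕ → ℕ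
  amountLen_poly : PolyBounded amountLen
  rule : ∀ n, (Fin N → F) → PMF (Outcome N (amountLen n))
  rule_ppt : PPT (α := fun _ => Fin N → F) rule
  unconfirmed_pay_zero : ∀ n b, ∀ o ∈ (rule n b).support, ∀ i, o.1 i = false →
    o.2.1 i = zeroBits (amountLen n)

/-! ## The protocol -/

/-- The reconstruction threshold `⌈m/2⌉`. -/
def threshold (m : ℕ) : ℕ := (m + 1) / 2

/-- An opening of a committed share: the share and the coins of the commitment. -/
abbrev Opening (F : Type) (n : ℕ) : Type := F × Bits n

/-- What an identity proves: its name and the commitments to its shares. -/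
abbrev ShareStmt (N m : ℕ) (cs : CommitmentScheme) (n : ℕ) : Type :=
  Fin N × (Fin m → Bits (cs.comLen n))

/-- The witness: the bid, and the openings of the commitments. -/
abbrev ShareWit (F : Type) (m n : ℕ) : Type := F × (Fin m → Opening F n)

/-- The building blocks of the protocol for `m` miners and `N` identities with bids in `F`. Shares
are written as bit strings by `enc` before they are committed to. -/
structure Protocol (F : Type) [Field F] [BitCode F] (m N : ℕ) where
  cs : CommitmentScheme
  enc : ∀ n, F → Bits (cs.msgLen n)
  enc_injective : ∀ n, Function.Injective (enc n)
  pt : Fin m → F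
  pt_injective : Function.Injective pt
  pt_ne_zero : ∀ j, pt j ≠ 0
  nizk : NIZK m (ShareStmt N m cs) (ShareWit F m)
  mech : Mechanism F N

/-- Only the entries with index in `S`. -/
def restrict {ι α : Type} (S : Finset ι) (f : ι → α) : ι → Option α :=
  fun i => if i ∈ S then some (f i) else none

/-- The value announced by more than half of the miners, if there is one. -/
def majorityValue {m : ℕ} {α : Type} (a : Fin m → Option α) : Option α :=
  if h : ∃ v, m < 2 * (Finset.univ.filter fun j => a j = some v).card then some h.choose else none

namespace Protocol

variable {F : Type} [Field F] [BitCode F] {m N : ℕ}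

abbrev CRS (T : Protocol F m N) (n : ℕ) : Type := T.nizk.CRS n
abbrev Com (T : Protocol F m N) (n : ℕ) : Type := Bits (T.cs.comLen n)
abbrev Proof (T : Protocol F m N) (n : ℕ) : Type := T.nizk.Proof n
abbrev Out (T : Protocol F m N) (n : ℕ) : Type := Outcome N (T.mech.amountLen n)

/-- The commitment with the given opening. -/
def commitTo (T : Protocol F m N) (n : ℕ) (o : Opening F n) : T.Com n :=
  T.cs.commit n (T.enc n o.1) o.2

/-- The relation of the proofs: the openings are correct, and the shares form a valid sharing of
the bid. -/
def Rel (T : Protocol F m N) (n : ℕ) (x : ShareStmt N m T.cs n) (w : ShareWit F m n) : Prop :=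
  (∀ j, T.commitTo n (w.2 j) = x.2 j) ∧
    IsSharing (threshold m) T.pt w.1 fun j => (w.2 j).1

/-- `o` is a correct opening of the `j`-th of the broadcast commitments `c`. -/
def Opens (T : Protocol F m N) {n : ℕ} (c : Option (Fin m → T.Com n)) (j : Fin m)
    (o : Option (Opening F n)) : Prop :=
  ∃ c' o', c = some c' ∧ o = some o' ∧ T.commitTo n o' = c' j

/-- The ideal functionality that the protocol realizes. -/
def FMPC (T : Protocol F m N) (n : ℕ) (b : Fin N → F) : PMF (T.Out n) := T.mech.rule n b

/-- The bid of one identity that the hybrid functionality reconstructs from the correct ones among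
the openings `inp j` sent by the miners `j`. -/
def reconstructBid (T : Protocol F m N) (n : ℕ) (c : Option (Fin m → T.Com n))
    (inp : Fin m → Option (Opening F n)) : F :=
  (reconstruct (threshold m) T.pt (Finset.univ.filter fun j => T.Opens c j (inp j))
    (fun j => (inp j).elim 0 Prod.fst)).getD 0

/-- The hybrid functionality with the set `bad` of excluded identities and the commitments `com`;
`inp j i` is the opening that miner `j` sends for identity `i`. -/
def FTFM (T : Protocol F m N) (n : ℕ) (bad : Finset (Fin N))
    (com : Fin N → Option (Fin m → T.Com n)) (inp : Fin m → Fin N → Option (Opening F n)) :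
    PMF (T.Out n) :=
  T.mech.rule n fun i => if i ∈ bad then 0 else T.reconstructBid n (com i) fun j => inp j i

/-! ### The adversary

The view grows round by round: auxiliary input and random coins, then the honest parties' messages
of each round that are broadcast or sent to corrupted parties. Because the adversary is rushing,
its messages of a round are computed from a view that contains the honest messages of that round. -/

abbrev View₀ (_T : Protocol F m N) (aux coins : ℕ → ℕ) (n : ℕ) : Type :=
  Bits (aux n) × Bits (coins n)

/-- adds the CRSes of the honest miners -/
abbrev View₁ (T : Protocol F m N) (aux coins : ℕ → ℕ) (n : ℕ) : Type :=
  T.View₀ aux coins n × (Fin m → Option (T.CRS n))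

/-- adds the commitments of the honest identities -/
abbrev View₂ (T : Protocol F m N) (aux coins : ℕ → ℕ) (n : ℕ) : Type :=
  T.View₁ aux coins n × (Fin N → Option (Fin m → T.Com n))

/-- adds the proofs of the honest identities -/
abbrev View₃ (T : Protocol F m N) (aux coins : ℕ → ℕ) (n : ℕ) : Type :=
  T.View₂ aux coins n × (Fin N → Option (T.Proof n))

/-- adds the openings sent by honest identities to corrupted miners -/
abbrev View₄ (T : Protocol F m N) (aux coins : ℕ → ℕ) (n : ℕ) : Type :=
  T.View₃ aux coins n × (Fin N → Fin m → Option (Opening F n))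

/-- adds the votes of the honest miners on the identities -/
abbrev View₅ (T : Protocol F m N) (aux coins : ℕ → ℕ) (n : ℕ) : Type :=
  T.View₄ aux coins n × (Fin m → Fin N → Option Bool)

/-- adds the openings broadcast by honest identities in reply to complaints -/
abbrev View₆ (T : Protocol F m N) (aux coins : ℕ → ℕ) (n : ℕ) : Type :=
  T.View₅ aux coins n × (Fin N → Fin m → Option (Opening F n))

/-- adds the outcome, which the hybrid functionality sends to the miners -/
abbrev View (T : Protocol F m N) (aux coins : ℕ → ℕ) (n : ℕ) : Type :=
  T.View₆ aux coins n × T.Out n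

/-- A non-uniform PPT adversary in the hybrid model, with auxiliary input of length `aux n`. In
each round it chooses the messages of all corrupted parties (entries that belong to honest parties
are ignored); `none` stands for a party that sends nothing valid. -/
structure Adversary (T : Protocol F m N) (aux : ℕ → ℕ) where
  coins : ℕ → ℕ
  coins_poly : PolyBounded coins
  crs : ∀ n, T.View₁ aux coins n → (Fin m → Option (T.CRS n))
  com : ∀ n, T.View₂ aux coins n → (Fin N → Option (Fin m → T.Com n))
  proof : ∀ n, T.View₃ aux coins n → (Fin N → Option (T.Proof n))
  opening : ∀ n, T.View₄ aux coins n → (Fin N → Fin m → Option (Opening F n))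
  vote : ∀ n, T.View₅ aux coins n → (Fin m → Fin N → Option Bool)
  reply : ∀ n, T.View₆ aux coins n → (Fin N → Fin m → Option (Opening F n))
  input : ∀ n, T.View₆ aux coins n → (Fin m → Fin N → Option (Opening F n))
  announce : ∀ n, T.View aux coins n → (Fin m → Option (T.Out n))
  crs_poly : PolyTime crs
  com_poly : PolyTime com
  proof_poly : PolyTime proof
  opening_poly : PolyTime opening
  vote_poly : PolyTime vote
  reply_poly : PolyTime reply
  input_poly : PolyTime input
  announce_poly : PolyTime announce

/-- The outputs of the honest miners and of the honest identities. -/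
abbrev HonestOut (T : Protocol F m N) (n : ℕ) : Type :=
  (Fin m → Option (Option (T.Out n))) × (Fin N → Option (Option (T.Out n)))

/-- The execution of the protocol with corrupted miners `Km` and corrupted identities `Ki`, honest
bids `b` and auxiliary input `z`: the joint law of the honest parties' outputs and of the
adversary's view. (Sampled values that belong to corrupted parties are never used.) -/
def real [Fintype F] (T : Protocol F m N) (Km : Finset (Fin m)) (Ki : Finset (Fin N))
    {aux : ℕ → ℕ} (A : T.Adversary aux) (n : ℕ) (b : Fin N → F) (z : Bits (aux n)) :
    PMF (T.HonestOut n × T.View aux A.coins n) := do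
  let ω ← PMF.uniformOfFintype (Bits (A.coins n))
  let v₀ : T.View₀ aux A.coins n := (z, ω)
  -- the miners broadcast CRSes; a missing one is replaced by 0
  let hcrs ← indep fun _ : Fin m => T.nizk.K n
  let v₁ : T.View₁ aux A.coins n := (v₀, restrict Kmᶜ hcrs)
  let crs : Fin m → T.CRS n := fun j =>
    if j ∈ Km then (A.crs n v₁ j).getD (zeroBits _) else hcrs j
  -- the identities share their bids and broadcast commitments to the shares
  let shares ← indep fun i : Fin N => share (threshold m) T.pt (b i)
  let r ← PMF.uniformOfFintype (Fin N → Fin m → Bits n)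
  let hop : Fin N → Fin m → Opening F n := fun i j => (shares i j, r i j)
  let hcom : Fin N → Fin m → T.Com n := fun i j => T.commitTo n (hop i j)
  let v₂ : T.View₂ aux A.coins n := (v₁, restrict Kiᶜ hcom)
  let com : Fin N → Option (Fin m → T.Com n) := fun i =>
    if i ∈ Ki then A.com n v₂ i else some (hcom i)
  -- the identities broadcast proofs
  let hproof ← indep fun i : Fin N => T.nizk.P n (crs, (i, hcom i), (b i, hop i))
  let v₃ : T.View₃ aux A.coins n := (v₂, restrict Kiᶜ hproof)
  let proof : Fin N → Option (T.Proof n) := fun i =>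
    if i ∈ Ki then A.proof n v₃ i else some (hproof i)
  -- identities without commitments or without an accepted proof are excluded
  let bad₁ : Finset (Fin N) := Finset.univ.filter fun i =>
    ¬ ∃ c π, com i = some c ∧ proof i = some π ∧ T.nizk.V n (crs, (i, c), π) = true
  -- the identities send the openings to the miners
  let v₄ : T.View₄ aux A.coins n :=
    (v₃, fun i j => if i ∉ Ki ∧ j ∈ Km then some (hop i j) else none)
  let opening : Fin N → Fin m → Option (Opening F n) := fun i j =>
    if i ∈ Ki then A.opening n v₄ i j else some (hop i j)
  -- the miners broadcast votes on the identities: `some true` is a complaint, `some false` is ok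
  let hvote : Fin m → Fin N → Option Bool := fun j i =>
    if i ∈ bad₁ then none else some (decide (¬ T.Opens (com i) j (opening i j)))
  let v₅ : T.View₅ aux A.coins n := (v₄, fun j i => if j ∈ Km then none else hvote j i)
  let vote : Fin m → Fin N → Option Bool := fun j i =>
    if j ∈ Km then A.vote n v₅ j i else hvote j i
  -- the identities reply to complaints by broadcasting the openings in question
  let hreply : Fin N → Fin m → Option (Opening F n) := fun i j =>
    if vote j i = some true then some (hop i j) else none
  let v₆ : T.View₆ aux A.coins n := (v₅, fun i j => if i ∈ Ki then none else hreply i j)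
  let reply : Fin N → Fin m → Option (Opening F n) := fun i j =>
    if i ∈ Ki then A.reply n v₆ i j else hreply i j
  -- identities that did not answer a complaint correctly are excluded
  let bad₂ : Finset (Fin N) := bad₁ ∪ Finset.univ.filter fun i =>
    ∃ j, vote j i = some true ∧ ¬ T.Opens (com i) j (reply i j)
  -- the miners send the correct openings that they recorded to the hybrid functionality
  let input : Fin m → Fin N → Option (Opening F n) := fun j i =>
    if j ∈ Km then A.input n v₆ j i
    else if T.Opens (com i) j (opening i j) then opening i j
    else if T.Opens (com i) j (reply i j) then reply i j
    else none
  let out ← T.FTFM n bad₂ com input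
  -- the miners output the outcome and announce it; the identities output the majority value
  let v : T.View aux A.coins n := (v₆, out)
  let ann : Fin m → Option (T.Out n) := fun j => if j ∈ Km then A.announce n v j else some out
  return ((restrict Kmᶜ fun _ => some out, restrict Kiᶜ fun _ => majorityValue ann), v)

/-! ### The ideal world -/

/-- A non-uniform PPT ideal-world adversary: it chooses the bids of the corrupted identities, then
receives the outcome and outputs a view. -/
structure Simulator (T : Protocol F m N) (aux coins : ℕ → ℕ) where
  State : ℕ → Type
  [code : ∀ n, BitCode (State n)]
  state_poly : PolyLength State
  bids : ∀ n, Bits (aux n) → PMF ((Fin N → F) × State n)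
  view : ∀ n, State n × T.Out n → PMF (T.View aux coins n)
  bids_ppt : PPT bids
  view_ppt : PPT view

attribute [instance] Simulator.code

/-- The ideal execution: the functionality gets the bids of the honest identities and those that
the simulator chose for the corrupted ones, and sends the outcome to everyone. -/
def ideal (T : Protocol F m N) (Km : Finset (Fin m)) (Ki : Finset (Fin N))
    {aux coins : ℕ → ℕ} (S : T.Simulator aux coins) (n : ℕ) (b : Fin N → F) (z : Bits (aux n)) :
    PMF (T.HonestOut n × T.View aux coins n) := do
  let (c, st) ← S.bids n z
  let out ← T.FMPC n fun i => if i ∈ Ki then c i else b i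
  let v ← S.view n (st, out)
  return ((restrict Kmᶜ fun _ => some out, restrict Kiᶜ fun _ => some out), v)

/-- The protocol, in the hybrid model, securely realizes the ideal functionality against the static
malicious corruption of the miners `Km` and the identities `Ki`. -/
def SecurelyRealizes [Fintype F] (T : Protocol F m N) (Km : Finset (Fin m)) (Ki : Finset (Fin N)) :
    Prop :=
  ∀ aux : ℕ → ℕ, PolyBounded aux → ∀ A : T.Adversary aux, ∃ S : T.Simulator aux A.coins,
    ∀ (b : ℕ → Fin N → F) (z : ∀ n, Bits (aux n)),
      CompIndist (α := fun n => T.HonestOut n × T.View aux A.coins n)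
        (fun n => T.real Km Ki A n (b n) (z n)) (fun n => T.ideal Km Ki S n (b n) (z n))

end Protocol

end MPCAuction

end

/-! The proof is a chain of hybrids from the real to the ideal execution. Its premise is that fewer
than half of the miners are corrupted, so the honest ones number at least `m / 2 + 1`. This is at
least `threshold m`, and it is also the majority that the NIZK properties demand. The corrupted
miners number fewer than `threshold m`.

Everything before the outcome is a deterministic polynomial-time function of a `Seed`: auxiliary
input, adversary coins, CRSes, commitments, the openings meant for corrupted miners, and proofs. The
openings meant for honest miners are not part of it. Completeness gets honest proofs accepted,
honest miners never complain about honest identities, and by perfect binding the openings of the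
honest miners determine every honest bid. Hence (`execution_eq_finalize`, `Protocol.real_eq`) the
real execution equals an experiment returning the corrupted bids and the view before the outcome,
followed by `finalize`, the last step of the ideal execution. As `finalize` is PPT, it is enough to
compare the experiments, and this is done in the following steps.

(a) The sharing coefficients are fixed. They range over a finite set independent of the security
parameter, so a mixture argument restores them, and meanwhile shares, bids and auxiliary inputs are
non-uniform advice. Real CRSes become simulated ones, and then proofs become simulated one identity
at a time, by zero knowledge (`crsExperiment_compIndist_proofExperiment`).

(b) The bids of corrupted identities, so far reconstructed from openings, are replaced by bids
extracted from their proofs (`simulation_compIndist_extracted`). By binding the two agree unless an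
accepted proof of a corrupted identity defeats the extractor. Such a proof is fresh, because
statements carry the name of the identity and only honest names were ever simulated.

(c) Commitments to shares of honest miners, whose openings are no longer used anywhere, become
commitments to 0 by hiding (`commitments_compIndist`).

(d) Only the shares of corrupted miners remain, and their distribution does not depend on the
secret, so the bids behind them may be set to 0 (`uniform_bind_commitments_sharesOf`).

(e) Uniform coefficients are replaced by the output of truncated rejection sampling, since a PPT
algorithm has only random bits and the size of `F` need not be a power of two. The error decays
geometrically.

The last experiment does not mention the honest bids; it is the first phase of the simulator. The
circuit calculus at the start serves to show that each reduction and the simulator are PPT. -/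

noncomputable section

namespace MPCAuction

open scoped Classical

/-! ## Circuit size of Boolean functions -/

/-- Rename the available wires of a circuit. -/
def Circuit.mapIn {W : Type} : {V V' : Type} → (V → V') → Circuit W V → Circuit W V'
  | _, _, f, .out o => .out (f ∘ o)
  | _, _, f, .const b rest => .const b (rest.mapIn (Option.map f))
  | _, _, f, .nand u v rest => .nand (f u) (f v) (rest.mapIn (Option.map f))

theorem Circuit.size_mapIn {W V : Type} (C : Circuit W V) :
    ∀ {V' : Type} (f : V → V'), (C.mapIn f).size = C.size := by
  induction C with
  | out o => intros; rfl
  | const b rest ih => intro V' f; simp [mapIn, size, ih]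
  | nand u v rest ih => intro V' f; simp [mapIn, size, ih]

theorem Circuit.eval_mapIn {W V : Type} (C : Circuit W V) :
    ∀ {V' : Type} (f : V → V') (x : V' → Bool), (C.mapIn f).eval x = C.eval (x ∘ f) := by
  induction C with
  | out o => intros; rfl
  | const b rest ih =>
    intro V' f x
    simp only [mapIn, eval, ih]
    congr 1
    funext v
    cases v <;> rfl
  | nand u v rest ih =>
    intro V' f x
    simp only [mapIn, eval, ih]
    congr 1
    funext v
    cases v <;> rfl

/-- The Boolean function `g` is computed by a circuit with at most `s` gates. -/
def HasSize {V W : Type} (g : (V → Bool) → W → Bool) (s : ℕ) : Prop :=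
  ∃ C : Circuit W V, C.size ≤ s ∧ C.eval = g

namespace HasSize

variable {V W W' U : Type}

theorem mono {g : (V → Bool) → W → Bool} {s t : ℕ} (h : HasSize g s) (hst : s ≤ t) :
    HasSize g t := by
  obtain ⟨C, hC, e⟩ := h
  exact ⟨C, hC.trans hst, e⟩

theorem wires (o : W → V) : HasSize (fun x w => x (o w)) 0 :=
  ⟨.out o, le_rfl, rfl⟩

/-- The second circuit is grafted onto the final `out` of the first, with its inputs renamed; gate
counts add up. -/
theorem comp {g : (W → Bool) → U → Bool} {f : (V → Bool) → W → Bool} {s t : ℕ}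
    (hg : HasSize g t) (hf : HasSize f s) : HasSize (fun x => g (f x)) (s + t) := by
  obtain ⟨C, hC, rfl⟩ := hf
  obtain ⟨D, hD, rfl⟩ := hg
  refine HasSize.mono (s := C.size + D.size) ?_ (by omega)
  clear hC hD
  induction C with
  | out o =>
    refine ⟨D.mapIn o, by simp [Circuit.size_mapIn, Circuit.size], ?_⟩
    funext x
    rw [Circuit.eval_mapIn]
    rfl
  | const b rest ih =>
    obtain ⟨E, hE, e⟩ := ih
    refine ⟨.const b E, by simp only [Circuit.size]; omega, ?_⟩
    funext x
    simp only [Circuit.eval, e]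
  | nand u v rest ih =>
    obtain ⟨E, hE, e⟩ := ih
    refine ⟨.nand u v E, by simp only [Circuit.size]; omega, ?_⟩
    funext x
    simp only [Circuit.eval, e]

/-- In a straight-line program no wire is ever lost, so the inputs can be output again at no cost.
This allows `pair` to run two circuits in sequence on the same input. -/
theorem keep {g : (V → Bool) → W → Bool} {s : ℕ} (hg : HasSize g s) :
    HasSize (fun x => Sum.elim (g x) x) s := by
  obtain ⟨C, hC, rfl⟩ := hg
  refine HasSize.mono (s := C.size) ?_ hC
  clear hC
  induction C with
  | out o =>
    refine ⟨.out (Sum.elim o id), le_rfl, ?_⟩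
    funext x w
    cases w <;> rfl
  | const b rest ih =>
    have := (wires (V := _ ⊕ Option _) (Sum.map (id : W → W) some)).comp ih
    obtain ⟨E, hE, e⟩ := this
    refine ⟨.const b E, by simp only [Circuit.size]; omega, ?_⟩
    funext x w
    simp only [Circuit.eval, e]
    cases w <;> rfl
  | nand u v rest ih =>
    have := (wires (V := _ ⊕ Option _) (Sum.map (id : W → W) some)).comp ih
    obtain ⟨E, hE, e⟩ := this
    refine ⟨.nand u v E, by simp only [Circuit.size]; omega, ?_⟩
    funext x w
    simp only [Circuit.eval, e]
    cases w <;> rfl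

theorem mapOut {g : (V → Bool) → W → Bool} {s : ℕ} (hg : HasSize g s) (o : U → W) :
    HasSize (fun x u => g x (o u)) s :=
  ((wires o).comp hg).mono le_rfl

theorem mapIn {g : (V → Bool) → W → Bool} {s : ℕ} (hg : HasSize g s) (o : V → U) :
    HasSize (fun x => g (x ∘ o)) s :=
  (hg.comp (wires o)).mono (by omega)

theorem pair {f : (V → Bool) → W → Bool} {g : (V → Bool) → W' → Bool} {s t : ℕ}
    (hf : HasSize f s) (hg : HasSize g t) : HasSize (fun x => Sum.elim (f x) (g x)) (s + t) := by
  have h := ((hf.mapIn Sum.inr).keep.mapOut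
    (Sum.elim Sum.inl (fun w : W' => Sum.inr (Sum.inl w)))).comp hg.keep
  refine (h.mono (by omega) : HasSize _ (s + t)) |> cast ?_
  congr 1
  funext x w
  cases w <;> rfl

/-- Output wires may share a gate: one `false` and one `true` serve all outputs, so the bound is
independent of the output length. -/
theorem const (b : W → Bool) : HasSize (fun _ : V → Bool => b) 2 := by
  refine ⟨.const false (.const true (.out fun w => if b w then none else some none)), le_rfl, ?_⟩
  funext x w
  simp only [Circuit.eval]
  cases b w <;> rfl

theorem nand {p q : (V → Bool) → Unit → Bool} {s t : ℕ} (hp : HasSize p s) (hq : HasSize q t) :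
    HasSize (fun x (_ : Unit) => !(p x () && q x ())) (s + t + 1) := by
  have h : HasSize (fun (x : Unit ⊕ Unit → Bool) (_ : Unit) =>
      !(x (Sum.inl ()) && x (Sum.inr ()))) 1 :=
    ⟨.nand (Sum.inl ()) (Sum.inr ()) (.out fun _ => none), le_rfl, rfl⟩
  exact h.comp (hp.pair hq)

theorem not {p : (V → Bool) → Unit → Bool} {s : ℕ} (hp : HasSize p s) :
    HasSize (fun x (_ : Unit) => !(p x ())) (s + 3) := by
  have h := hp.nand (HasSize.const (V := V) (W := Unit) fun _ => true)
  simpa using h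

theorem and {p q : (V → Bool) → Unit → Bool} {s t : ℕ} (hp : HasSize p s) (hq : HasSize q t) :
    HasSize (fun x (_ : Unit) => p x () && q x ()) (s + t + 4) := by
  have h := (hp.nand hq).not
  simp only [Bool.not_not] at h
  exact h.mono (by omega)

theorem mux {c p q : (V → Bool) → Unit → Bool} {r s t : ℕ} (hc : HasSize c r) (hp : HasSize p s)
    (hq : HasSize q t) :
    HasSize (fun x (_ : Unit) => if c x () then p x () else q x ()) (2 * r + s + t + 6) := by
  have h := (hc.nand hp).nand (hc.not.nand hq)
  refine (h.mono (t := 2 * r + s + t + 6) (by omega)) |> cast ?_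
  congr 1
  funext x _
  cases c x () <;> simp

theorem ofEquiv {g : (V → Bool) → W → Bool} {s : ℕ} (e : V ≃ U)
    (hg : HasSize (fun x : U → Bool => g (x ∘ e)) s) : HasSize g s := by
  have h := hg.mapIn e.symm
  refine h |> cast ?_
  congr 1
  funext x
  congr 1
  funext v
  simp

theorem family [Fintype W] {g : (V → Bool) → W → Bool} {s : ℕ}
    (h : ∀ w, HasSize (fun x (_ : Unit) => g x w) s) : HasSize g (Fintype.card W * s) := by
  suffices H : ∀ (k : ℕ) (g : (V → Bool) → Fin k → Bool),
      (∀ w, HasSize (fun x (_ : Unit) => g x w) s) → HasSize g (k * s) by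
    have := H (Fintype.card W) (fun x i => g x ((Fintype.equivFin W).symm i)) fun w => h _
    simpa using this.mapOut (Fintype.equivFin W)
  intro k
  induction k with
  | zero =>
    intro g _
    refine ⟨.out Fin.elim0, by simp [Circuit.size], ?_⟩
    funext x w
    exact w.elim0
  | succ k ih =>
    intro g hg
    have h1 := (hg 0).pair (ih (fun x i => g x i.succ) fun w => hg w.succ)
    have h2 := h1.mapOut (fun i : Fin (k + 1) =>
      Fin.cases (motive := fun _ => Unit ⊕ Fin k) (Sum.inl ()) Sum.inr i)
    refine (h2.mono (t := (k + 1) * s) (by ring_nf; omega)) |> cast ?_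
    congr 1
    funext x w
    refine Fin.cases ?_ (fun i => ?_) w <;> simp

theorem allTrue [Fintype W] {g : (V → Bool) → W → Bool} {s : ℕ} (h : HasSize g s) :
    HasSize (fun x (_ : Unit) => decide (∀ w, g x w = true)) (s + 4 * Fintype.card W + 2) := by
  suffices H : ∀ k : ℕ, HasSize (fun (x : Fin k → Bool) (_ : Unit) => decide (∀ w, x w = true))
      (4 * k + 2) by
    have h1 := (H (Fintype.card W)).comp (h.mapOut (Fintype.equivFin W).symm)
    refine (h1.mono (t := s + 4 * Fintype.card W + 2) (by omega)) |> cast ?_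
    congr 1
    funext x _
    simp only [decide_eq_decide]
    exact ⟨fun H w => by simpa using H (Fintype.equivFin W w), fun H w => H _⟩
  intro k
  induction k with
  | zero =>
    refine (HasSize.const (V := Fin 0) (W := Unit) fun _ => true) |> cast ?_
    simp
  | succ k ih =>
    have h1 := (wires (V := Fin (k + 1)) (W := Unit) (fun _ => 0)).and (ih.mapIn Fin.succ)
    refine (h1.mono (t := 4 * (k + 1) + 2) (by omega)) |> cast ?_
    congr 1
    funext x _
    simp only [Fin.forall_fin_succ, Bool.decide_and, Bool.decide_eq_true, Function.comp]

/-- Shannon expansion along the first input wire. The size is exponential in the number of wires,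
which is harmless because it is used only for input types that do not vary with the security
parameter. -/
theorem exists_unit [Finite V] (g : (V → Bool) → Unit → Bool) : ∃ s, HasSize g s := by
  obtain ⟨k, ⟨e⟩⟩ := Finite.exists_equiv_fin V
  suffices H : ∀ (k : ℕ) (g : (Fin k → Bool) → Unit → Bool), ∃ s, HasSize g s by
    obtain ⟨s, hs⟩ := H k fun x => g (x ∘ e)
    exact ⟨s, hs.ofEquiv e⟩
  intro k
  induction k with
  | zero =>
    intro g
    refine ⟨2, (HasSize.const (V := Fin 0) (W := Unit) (g Fin.elim0)) |> cast ?_⟩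
    congr 1
    funext x
    congr 1
    exact Subsingleton.elim _ _
  | succ k ih =>
    intro g
    obtain ⟨s, hs⟩ := ih fun x => g (Fin.cons true x)
    obtain ⟨t, ht⟩ := ih fun x => g (Fin.cons false x)
    have h := (wires (V := Fin (k + 1)) (W := Unit) (fun _ => 0)).mux (hs.mapIn Fin.succ)
      (ht.mapIn Fin.succ)
    refine ⟨2 * 0 + s + t + 6, h |> cast ?_⟩
    congr 1
    funext x u
    have hx : x = Fin.cons (x 0) (x ∘ Fin.succ) := by
      funext i
      refine Fin.cases rfl (fun i => rfl) i
    conv_rhs => rw [hx]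
    cases x 0 <;> rfl

theorem exists_size [Finite V] [Fintype W] (g : (V → Bool) → W → Bool) : ∃ s, HasSize g s := by
  choose s hs using fun w => exists_unit fun x (_ : Unit) => g x w
  exact ⟨_, family (s := ∑ w, s w) fun w =>
    (hs w).mono (Finset.single_le_sum (fun _ _ => Nat.zero_le _) (Finset.mem_univ w))⟩

end HasSize

theorem computableInSize_iff {α β : Type} [BitCode α] [BitCode β] {f : α → β} {s : ℕ} :
    ComputableInSize f s ↔ ∃ g : (BitCode.Wire α → Bool) → BitCode.Wire β → Bool,
      HasSize g s ∧ ∀ a, g (BitCode.bits a) = BitCode.bits (f a) := by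
  constructor
  · rintro ⟨C, hC, h⟩
    exact ⟨_, ⟨C, hC, rfl⟩, h⟩
  · rintro ⟨_, ⟨C, hC, rfl⟩, h⟩
    exact ⟨C, hC, h⟩

theorem ComputableInSize.mono {α β : Type} [BitCode α] [BitCode β] {f : α → β} {s t : ℕ}
    (h : ComputableInSize f s) (hst : s ≤ t) : ComputableInSize f t := by
  obtain ⟨C, hC, e⟩ := h
  exact ⟨C, hC.trans hst, e⟩

theorem ComputableInSize.comp {α β γ : Type} [BitCode α] [BitCode β] [BitCode γ] {f : α → β}
    {g : β → γ} {s t : ℕ} (hg : ComputableInSize g t) (hf : ComputableInSize f s) :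
    ComputableInSize (fun a => g (f a)) (s + t) := by
  obtain ⟨f', hf', ef⟩ := computableInSize_iff.1 hf
  obtain ⟨g', hg', eg⟩ := computableInSize_iff.1 hg
  exact computableInSize_iff.2 ⟨_, hg'.comp hf', fun a => by rw [ef, eg]⟩

theorem ComputableInSize.pair {α β γ : Type} [BitCode α] [BitCode β] [BitCode γ] {f : α → β}
    {g : α → γ} {s t : ℕ} (hf : ComputableInSize f s) (hg : ComputableInSize g t) :
    ComputableInSize (fun a => (f a, g a)) (s + t) := by
  obtain ⟨f', hf', ef⟩ := computableInSize_iff.1 hf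
  obtain ⟨g', hg', eg⟩ := computableInSize_iff.1 hg
  exact computableInSize_iff.2 ⟨_, hf'.pair hg', fun a => by rw [ef, eg]; rfl⟩

/-- A function between encoded types whose output bits are input bits. -/
theorem ComputableInSize.wires {α β : Type} [BitCode α] [BitCode β] {f : α → β}
    (o : BitCode.Wire β → BitCode.Wire α)
    (h : ∀ a w, BitCode.bits (f a) w = BitCode.bits a (o w)) : ComputableInSize f 0 :=
  computableInSize_iff.2 ⟨_, HasSize.wires o, fun a => by funext w; rw [h]⟩

/-- Only finitely many Boolean tables exist on a finite domain, so the sum of their circuit sizes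
bounds them all. A single bound for all `f` is what makes arbitrary, even non-computable, families
of functions between fixed finite types polynomial time. -/
theorem ComputableInSize.of_finite (α β : Type) [BitCode α] [BitCode β] [Finite α] :
    ∃ s, ∀ f : α → β, ComputableInSize f s := by
  have h : ∀ f : α → BitCode.Wire β → Bool, ∃ s, ∃ g, HasSize g s ∧
      ∀ a : α, g (BitCode.bits a) = f a := by
    intro f
    obtain ⟨s, hs⟩ := HasSize.exists_size (V := BitCode.Wire α) (W := BitCode.Wire β)
      -- Off the image of the encoding the value is arbitrary; on it, injectivity recovers the
      -- encoded element.
      fun x => if h : ∃ a, BitCode.bits a = x then f h.choose else fun _ => false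
    refine ⟨s, _, hs, fun a => ?_⟩
    have hex : ∃ a', BitCode.bits a' = BitCode.bits a := ⟨a, rfl⟩
    rw [dif_pos hex, BitCode.bits_injective hex.choose_spec]
  choose s hs using h
  have := Fintype.ofFinite α
  refine ⟨∑ f, s f, fun f => ?_⟩
  obtain ⟨g, hg, e⟩ := hs fun a => BitCode.bits (f a)
  exact computableInSize_iff.2
    ⟨g, hg.mono (Finset.single_le_sum (fun _ _ => Nat.zero_le _) (Finset.mem_univ _)), e⟩

/-! ## Polynomial bounds -/

theorem PolyBounded.const (c : ℕ) : PolyBounded fun _ => c := ⟨Polynomial.C c, fun n => by simp⟩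

theorem PolyBounded.id : PolyBounded fun n => n := ⟨Polynomial.X, fun n => by simp⟩

theorem PolyBounded.mono {f g : ℕ → ℕ} (hg : PolyBounded g) (h : ∀ n, f n ≤ g n) :
    PolyBounded f := by
  obtain ⟨p, hp⟩ := hg
  exact ⟨p, fun n => (h n).trans (hp n)⟩

theorem PolyBounded.add {f g : ℕ → ℕ} (hf : PolyBounded f) (hg : PolyBounded g) :
    PolyBounded fun n => f n + g n := by
  obtain ⟨p, hp⟩ := hf
  obtain ⟨q, hq⟩ := hg
  exact ⟨p + q, fun n => by simpa using add_le_add (hp n) (hq n)⟩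

theorem PolyBounded.mul {f g : ℕ → ℕ} (hf : PolyBounded f) (hg : PolyBounded g) :
    PolyBounded fun n => f n * g n := by
  obtain ⟨p, hp⟩ := hf
  obtain ⟨q, hq⟩ := hg
  exact ⟨p * q, fun n => by simpa using Nat.mul_le_mul (hp n) (hq n)⟩

section PolyLength

variable {α β : ℕ → Type} [∀ n, BitCode (α n)] [∀ n, BitCode (β n)]

theorem PolyLength.fixed (α : Type) [BitCode α] : PolyLength fun _ => α := PolyBounded.const _

theorem PolyLength.bits {k : ℕ → ℕ} (hk : PolyBounded k) : PolyLength fun n => Bits (k n) := by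
  refine hk.mono fun n => ?_
  have : Fintype.card (Fin (k n) × Unit) = k n := by simp
  exact this.le

theorem PolyLength.prod (hα : PolyLength α) (hβ : PolyLength β) :
    PolyLength fun n => α n × β n :=
  (PolyBounded.add hα hβ).mono fun n =>
    (Fintype.card_sum (α := BitCode.Wire (α n)) (β := BitCode.Wire (β n))).le

theorem PolyLength.pi (k : ℕ) (hα : PolyLength α) : PolyLength fun n => Fin k → α n :=
  ((PolyBounded.const k).mul hα).mono fun n => by
    have : Fintype.card (Fin k × BitCode.Wire (α n)) = k * Fintype.card (BitCode.Wire (α n)) := by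
      simp
    exact this.le

theorem PolyLength.option (hα : PolyLength α) : PolyLength fun n => Option (α n) :=
  (PolyBounded.add hα (PolyBounded.const 1)).mono fun n =>
    (Fintype.card_option (α := BitCode.Wire (α n))).le

end PolyLength

/-! ## Polynomial-time functions -/

theorem polyTime_iff {α β : ℕ → Type} [∀ n, BitCode (α n)] [∀ n, BitCode (β n)]
    {f : ∀ n, α n → β n} :
    PolyTime f ↔ ∃ s : ℕ → ℕ, PolyBounded s ∧ ∀ n, ComputableInSize (f n) (s n) := by
  constructor
  · rintro ⟨p, hp⟩
    exact ⟨fun n => p.eval n, ⟨p, fun n => le_rfl⟩, hp⟩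
  · rintro ⟨s, ⟨p, hp⟩, h⟩
    exact ⟨p, fun n => (h n).mono (hp n)⟩

namespace PolyTime

variable {α β γ δ : ℕ → Type} [∀ n, BitCode (α n)] [∀ n, BitCode (β n)] [∀ n, BitCode (γ n)]
  [∀ n, BitCode (δ n)]

theorem comp {g : ∀ n, β n → γ n} {f : ∀ n, α n → β n} (hg : PolyTime g) (hf : PolyTime f) :
    PolyTime fun n a => g n (f n a) := by
  obtain ⟨s, hs, h⟩ := polyTime_iff.1 hg
  obtain ⟨t, ht, h'⟩ := polyTime_iff.1 hf
  exact polyTime_iff.2 ⟨_, ht.add hs, fun n => (h n).comp (h' n)⟩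

theorem pair {f : ∀ n, α n → β n} {g : ∀ n, α n → γ n} (hf : PolyTime f) (hg : PolyTime g) :
    PolyTime fun n a => (f n a, g n a) := by
  obtain ⟨s, hs, h⟩ := polyTime_iff.1 hf
  obtain ⟨t, ht, h'⟩ := polyTime_iff.1 hg
  exact polyTime_iff.2 ⟨_, hs.add ht, fun n => (h n).pair (h' n)⟩

theorem of_wires {f : ∀ n, α n → β n} (o : ∀ n, BitCode.Wire (β n) → BitCode.Wire (α n))
    (h : ∀ n a w, BitCode.bits (f n a) w = BitCode.bits a (o n w)) : PolyTime f :=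
  polyTime_iff.2 ⟨_, PolyBounded.const 0, fun n => .wires (o n) (h n)⟩

theorem id : PolyTime fun n (a : α n) => a := of_wires (fun _ => _root_.id) fun _ _ _ => rfl

theorem const (b : ∀ n, β n) : PolyTime fun n (_ : α n) => b n :=
  polyTime_iff.2 ⟨_, PolyBounded.const 2, fun n =>
    computableInSize_iff.2 ⟨_, HasSize.const (BitCode.bits (b n)), fun _ => rfl⟩⟩

theorem fst {f : ∀ n, α n → β n × γ n} (hf : PolyTime f) : PolyTime fun n a => (f n a).1 :=
  comp (g := fun n (x : β n × γ n) => x.1) (of_wires (fun _ => Sum.inl) fun _ _ _ => rfl) hf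

theorem snd {f : ∀ n, α n → β n × γ n} (hf : PolyTime f) : PolyTime fun n a => (f n a).2 :=
  comp (g := fun n (x : β n × γ n) => x.2) (of_wires (fun _ => Sum.inr) fun _ _ _ => rfl) hf

theorem apply {k : ℕ} {f : ∀ n, α n → Fin k → β n} (hf : PolyTime f) (i : Fin k) :
    PolyTime fun n a => f n a i :=
  comp (g := fun n (x : Fin k → β n) => x i) (of_wires (fun _ w => (i, w)) fun _ _ _ => rfl) hf

theorem pi {k : ℕ} {f : Fin k → ∀ n, α n → β n} (hf : ∀ i, PolyTime (f i)) :
    PolyTime fun n a i => f i n a := by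
  induction k with
  | zero => exact of_wires (fun _ w => w.1.elim0) fun _ _ w => w.1.elim0
  | succ k ih =>
    have key : PolyTime (α := fun n => β n × (Fin k → β n)) (β := fun n => Fin (k + 1) → β n)
        fun n x => Fin.cons (α := fun _ => β n) x.1 x.2 := by
      refine of_wires (fun n (w : Fin (k + 1) × BitCode.Wire (β n)) => Fin.cases (motive := fun _ =>
        BitCode.Wire (β n) ⊕ (Fin k × BitCode.Wire (β n))) (Sum.inl w.2)
          (fun i => Sum.inr (i, w.2)) w.1) fun n a w => ?_
      obtain ⟨i, w⟩ := w
      refine Fin.cases ?_ (fun i => ?_) i <;> rfl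
    have h := key.comp ((hf 0).pair (ih fun i => hf i.succ))
    refine h |> cast ?_
    congr 1
    funext n a i
    refine Fin.cases ?_ (fun i => ?_) i <;> rfl

theorem of_finite (X : Type) [BitCode X] [Finite X] (Y : Type) [BitCode Y] (g : ℕ → X → Y)
    {f : ∀ n, α n → X} (hf : PolyTime f) : PolyTime (β := fun _ => Y) fun n a => g n (f n a) := by
  obtain ⟨s, hs⟩ := ComputableInSize.of_finite X Y
  exact comp (β := fun _ => X)
    (polyTime_iff.2 ⟨_, PolyBounded.const s, fun n => hs (g n)⟩) hf

theorem some {f : ∀ n, α n → β n} (hf : PolyTime f) : PolyTime fun n a => Option.some (f n a) := by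
  refine comp (g := fun n (b : β n) => Option.some b) ?_ hf
  refine polyTime_iff.2 ⟨_, PolyBounded.const 2, fun n => computableInSize_iff.2 ?_⟩
  have h := ((HasSize.const (V := BitCode.Wire (β n)) (W := Unit) fun _ => true).pair
    (HasSize.wires (V := BitCode.Wire (β n)) _root_.id)).mapOut
      (fun w : Option (BitCode.Wire (β n)) => w.elim (Sum.inl ()) Sum.inr)
  refine ⟨_, h, fun a => ?_⟩
  funext w
  cases w <;> rfl

theorem isSome {f : ∀ n, α n → Option (β n)} (hf : PolyTime f) :
    PolyTime (β := fun _ => Bool) fun n a => (f n a).isSome := by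
  refine comp (g := fun n (b : Option (β n)) => b.isSome) ?_ hf
  refine of_wires (fun n _ => none) fun n a w => ?_
  cases a <;> rfl

theorem mux {c : ∀ n, α n → Bool} {f g : ∀ n, α n → β n} (hβ : PolyLength β)
    (hc : PolyTime (β := fun _ => Bool) c) (hf : PolyTime f) (hg : PolyTime g) :
    PolyTime fun n a => if c n a = true then f n a else g n a := by
  refine comp (β := fun n => Bool × β n × β n) (g := fun n x => if x.1 = true then x.2.1 else x.2.2)
    ?_ (hc.pair (hf.pair hg))
  refine polyTime_iff.2 ⟨_, PolyBounded.mul hβ (PolyBounded.const 6), fun n =>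
    computableInSize_iff.2 ⟨_, HasSize.family (g := fun x w =>
      if x (Sum.inl ()) then x (Sum.inr (Sum.inl w)) else x (Sum.inr (Sum.inr w))) fun w => ?_,
      ?_⟩⟩
  · exact (HasSize.wires (W := Unit) fun _ => Sum.inl ()).mux
      (HasSize.wires (W := Unit) fun _ => Sum.inr (Sum.inl w))
      (HasSize.wires (W := Unit) fun _ => Sum.inr (Sum.inr w))
  · rintro ⟨c, x, y⟩
    funext w
    cases c <;> rfl

theorem decide_eq {f g : ∀ n, α n → β n} (hβ : PolyLength β) (hf : PolyTime f) (hg : PolyTime g) :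
    PolyTime (β := fun _ => Bool) fun n a => decide (f n a = g n a) := by
  refine comp (β := fun n => β n × β n) (γ := fun _ => Bool) (g := fun n x => decide (x.1 = x.2))
    ?_ (hf.pair hg)
  obtain ⟨s, hs⟩ := HasSize.exists_unit fun (x : Bool → Bool) (_ : Unit) => x false == x true
  refine polyTime_iff.2 ⟨_, ((PolyBounded.mul hβ (PolyBounded.const s)).add
    ((PolyBounded.const 4).mul hβ)).add (PolyBounded.const 2), fun n => computableInSize_iff.2 ?_⟩
  have h := (HasSize.family (W := BitCode.Wire (β n)) (g := fun x w =>
    x (Sum.inl w) == x (Sum.inr w)) fun w =>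
      hs.mapIn (fun b => cond b (Sum.inr w : BitCode.Wire (β n) ⊕ BitCode.Wire (β n))
        (Sum.inl w))).allTrue
  refine ⟨_, h, ?_⟩
  rintro ⟨x, y⟩
  funext w
  change decide (∀ w, (BitCode.bits x w == BitCode.bits y w) = true) = decide (x = y)
  rw [decide_eq_decide]
  simp only [beq_iff_eq]
  rw [← funext_iff]
  exact BitCode.bits_injective.eq_iff

theorem getD {f : ∀ n, α n → Option (β n)} {d : ∀ n, α n → β n} (hβ : PolyLength β)
    (hf : PolyTime f) (hd : PolyTime d) : PolyTime fun n a => (f n a).getD (d n a) := by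
  refine comp (β := fun n => Option (β n) × β n) (g := fun n x => x.1.getD x.2) ?_ (hf.pair hd)
  refine polyTime_iff.2 ⟨_, PolyBounded.mul hβ (PolyBounded.const 6), fun n =>
    computableInSize_iff.2 ⟨_, HasSize.family (g := fun x w =>
      if x (Sum.inl none) then x (Sum.inl (Option.some w)) else x (Sum.inr w)) fun w => ?_,
      ?_⟩⟩
  · exact (HasSize.wires (W := Unit) fun _ => Sum.inl none).mux
      (HasSize.wires (W := Unit) fun _ => Sum.inl (Option.some w))
      (HasSize.wires (W := Unit) fun _ => Sum.inr w)
  · rintro ⟨o, y⟩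
    funext w
    cases o <;> rfl

/-- A fixed finite input type, and outputs of polynomial length. -/
theorem of_finite_input (X : Type) [BitCode X] [Finite X] (hβ : PolyLength β) (g : ∀ n, X → β n)
    {f : ∀ n, α n → X} (hf : PolyTime f) : PolyTime fun n a => g n (f n a) := by
  obtain ⟨c, hc⟩ := ComputableInSize.of_finite X Bool
  refine comp (β := fun _ => X) (g := g) (polyTime_iff.2
    ⟨_, PolyBounded.mul hβ (PolyBounded.const c), fun n => computableInSize_iff.2 ?_⟩) hf
  choose G hG e using fun w => computableInSize_iff.1 (hc fun x => BitCode.bits (g n x) w)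
  exact ⟨_, HasSize.family (g := fun x w => G w x ()) hG, fun a => funext fun w => by rw [e]; rfl⟩

end PolyTime

/-! ### Polynomial-time predicates -/

/-- Predicates that are decided in polynomial time. -/
def PolyPred {α : ℕ → Type} [∀ n, BitCode (α n)] (p : ∀ n, α n → Prop) : Prop :=
  PolyTime (β := fun _ => Bool) fun n a => @decide (p n a) (Classical.propDecidable _)

section PolyPred

variable {α β : ℕ → Type} [∀ n, BitCode (α n)] [∀ n, BitCode (β n)] {p q : ∀ n, α n → Prop}

theorem PolyPred.decide [inst : ∀ n a, Decidable (p n a)] (hp : PolyPred p) :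
    PolyTime (β := fun _ => Bool) fun n a => decide (p n a) := by
  unfold PolyPred at hp
  convert hp

theorem PolyPred.of_polyTime {f : ∀ n, α n → Bool} (hf : PolyTime (β := fun _ => Bool) f) :
    PolyPred fun n a => f n a = true := by
  unfold PolyPred
  convert hf with n a
  simp

theorem PolyPred.const (P : Prop) : PolyPred fun n (_ : α n) => P :=
  PolyTime.const (β := fun _ => Bool) _

theorem PolyPred.not (hp : PolyPred p) : PolyPred fun n a => ¬ p n a := by
  have := PolyTime.of_finite Bool Bool (fun _ b => !b) hp
  unfold PolyPred
  simpa using this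

theorem PolyPred.and (hp : PolyPred p) (hq : PolyPred q) : PolyPred fun n a => p n a ∧ q n a := by
  have := PolyTime.of_finite (Bool × Bool) Bool (fun _ b => b.1 && b.2) (hp.pair hq)
  unfold PolyPred
  simpa using this

theorem PolyPred.or (hp : PolyPred p) (hq : PolyPred q) : PolyPred fun n a => p n a ∨ q n a := by
  have := PolyTime.of_finite (Bool × Bool) Bool (fun _ b => b.1 || b.2) (hp.pair hq)
  unfold PolyPred
  simpa using this

theorem PolyPred.exists_fin {k : ℕ} {p : Fin k → ∀ n, α n → Prop} (hp : ∀ i, PolyPred (p i)) :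
    PolyPred fun n a => ∃ i, p i n a := by
  have := PolyTime.of_finite (Fin k → Bool) Bool (fun _ b => Decidable.decide (∃ i, b i = true))
    (PolyTime.pi hp)
  simp only [decide_eq_true_eq] at this
  unfold PolyPred
  convert this

theorem PolyPred.eq {f g : ∀ n, α n → β n} (hβ : PolyLength β) (hf : PolyTime f)
    (hg : PolyTime g) : PolyPred fun n a => f n a = g n a :=
  PolyTime.decide_eq hβ hf hg

theorem PolyTime.ite [∀ n a, Decidable (p n a)] {f g : ∀ n, α n → β n} (hβ : PolyLength β)
    (hp : PolyPred p) (hf : PolyTime f) (hg : PolyTime g) :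
    PolyTime fun n a => if p n a then f n a else g n a := by
  have := PolyTime.mux hβ hp.decide hf hg
  simpa only [decide_eq_true_eq] using this

theorem PolyTime.restrict {k : ℕ} {f : Fin k → ∀ n, α n → β n} (S : Finset (Fin k))
    (hf : ∀ i, PolyTime (f i)) :
    PolyTime (β := fun n => Fin k → Option (β n)) fun n a => restrict S fun i => f i n a := by
  refine PolyTime.pi (β := fun n => Option (β n))
    (f := fun i n a => MPCAuction.restrict S (fun i => f i n a) i) fun i => ?_
  unfold MPCAuction.restrict
  by_cases h : i ∈ S
  · simpa only [if_pos h] using (hf i).some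
  · simpa only [if_neg h] using PolyTime.const (β := fun n => Option (β n)) fun _ => none

end PolyPred

/-! ## Finite probability -/

section PMFLemmas

variable {α β γ : Type}

theorem PMF.bind_congr_support {p : PMF α} {f g : α → PMF β} (h : ∀ a ∈ p.support, f a = g a) :
    p.bind f = p.bind g := by
  ext b
  simp only [PMF.bind_apply]
  refine tsum_congr fun a => ?_
  by_cases ha : a ∈ p.support
  · rw [h a ha]
  · rw [PMF.mem_support_iff, not_not] at ha
    simp [ha]

theorem PMF.map_uniform_equiv [Fintype α] [Nonempty α] [Fintype β] [Nonempty β] (e : α ≃ β) :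
    (PMF.uniformOfFintype α).map e = PMF.uniformOfFintype β := by
  ext b
  rw [PMF.map_apply, tsum_eq_single (e.symm b)]
  · simp [Fintype.card_congr e]
  · intro a ha
    rw [if_neg]
    rintro rfl
    simp at ha

theorem PMF.uniform_prod [Fintype α] [Nonempty α] [Fintype β] [Nonempty β] :
    PMF.uniformOfFintype (α × β) =
      (PMF.uniformOfFintype α).bind fun a => (PMF.uniformOfFintype β).map fun b => (a, b) := by
  ext ⟨x, y⟩
  rw [PMF.bind_apply, tsum_eq_single x, PMF.map_apply, tsum_eq_single y]
  · simp only [PMF.uniformOfFintype_apply, if_true, Fintype.card_prod, Nat.cast_mul]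
    rw [ENNReal.mul_inv] <;> simp
  · intro b hb
    rw [if_neg]
    simpa using hb.symm
  · intro a ha
    rw [PMF.map_apply, ENNReal.tsum_eq_zero.2, mul_zero]
    intro b
    rw [if_neg]
    intro h
    exact ha (congrArg Prod.fst h).symm

theorem PMF.uniform_fin_succ {k : ℕ} [Fintype α] [Nonempty α] :
    PMF.uniformOfFintype (Fin (k + 1) → α) = (PMF.uniformOfFintype α).bind fun a =>
      (PMF.uniformOfFintype (Fin k → α)).map fun f => Fin.cons (α := fun _ => α) a f := by
  rw [← PMF.map_uniform_equiv (Fin.consEquiv fun _ : Fin (k + 1) => α), PMF.uniform_prod,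
    PMF.map_bind]
  refine congrArg _ (funext fun a => ?_)
  rw [PMF.map_comp]
  rfl

theorem PMF.uniform_bits_add (r s : ℕ) :
    (PMF.uniformOfFintype (Bits (r + s))).map
        (fun ω => ((fun i => ω (Fin.castAdd s i) : Bits r), (fun i => ω (Fin.natAdd r i) : Bits s)))
      = (PMF.uniformOfFintype (Bits r)).bind fun a =>
        (PMF.uniformOfFintype (Bits s)).map fun b => (a, b) := by
  rw [← PMF.uniform_prod, ← PMF.map_uniform_equiv (Fin.appendEquiv r s), PMF.map_comp]
  convert PMF.map_id _
  funext ⟨a, b⟩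
  simp [Fin.appendEquiv]

theorem uniform_eq_indep {k : ℕ} [Fintype α] [Nonempty α] :
    PMF.uniformOfFintype (Fin k → α) = indep fun _ => PMF.uniformOfFintype α := by
  induction k with
  | zero =>
    ext f
    have : f = Fin.elim0 := Subsingleton.elim _ _
    simp [indep, this, PMF.pure_apply]
  | succ k ih =>
    rw [PMF.uniform_fin_succ, ih]
    rfl

theorem indep_map {k : ℕ} (p : Fin k → PMF α) (f : Fin k → α → β) :
    indep (fun i => (p i).map (f i)) = (indep p).map fun x i => f i (x i) := by
  induction k with
  | zero =>
    simp only [indep, PMF.pure_map]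
    exact congrArg _ (Subsingleton.elim _ _)
  | succ k ih =>
    simp only [indep, PMF.map_bind, PMF.bind_map, PMF.map_comp]
    refine congrArg _ (funext fun a => ?_)
    simp only [Function.comp_apply, ih (fun i => p i.succ) fun i => f i.succ, PMF.map_comp]
    congr 1
    funext x i
    refine Fin.cases ?_ (fun i => ?_) i <;> rfl

theorem mem_support_indep {k : ℕ} {p : Fin k → PMF α} {x : Fin k → α}
    (hx : x ∈ (indep p).support) (i : Fin k) : x i ∈ (p i).support := by
  induction k with
  | zero => exact i.elim0
  | succ k ih =>
    simp only [indep, PMF.mem_support_bind_iff, PMF.mem_support_map_iff] at hx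
    obtain ⟨a, ha, f, hf, rfl⟩ := hx
    refine Fin.cases ?_ (fun i => ?_) i
    · simpa using ha
    · simpa using ih hf i

/-- Resampling one coordinate of an independent family. -/
theorem indep_update {k : ℕ} (p : Fin k → PMF α) (i : Fin k) (q : PMF α) :
    indep (Function.update p i q) =
      q.bind fun a => (indep p).map fun f => Function.update f i a := by
  induction k with
  | zero => exact i.elim0
  | succ k ih =>
    refine Fin.cases ?_ (fun j => ?_) i
    · simp only [indep, Function.update_self, PMF.map_bind, PMF.map_comp]
      refine congrArg _ (funext fun a => ?_)
      have h : ∀ b : α, (fun f : Fin (k + 1) → α => Function.update f 0 a) ∘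
          (fun f : Fin k → α => (Fin.cons b f : Fin (k + 1) → α)) =
            fun f : Fin k → α => (Fin.cons a f : Fin (k + 1) → α) := by
        intro b
        funext f
        simp [Fin.update_cons_zero]
      simp only [h, PMF.bind_const]
      congr 2
    · have h0 : Function.update p j.succ q 0 = p 0 :=
        Function.update_of_ne (Fin.succ_ne_zero j).symm _ _
      have h1 : (fun i : Fin k => Function.update p j.succ q i.succ) =
          Function.update (fun i : Fin k => p i.succ) j q := by
        funext l
        by_cases h : l = j
        · subst h; simp
        · rw [Function.update_of_ne h, Function.update_of_ne fun h' => h (Fin.succ_injective _ h')]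
      simp only [indep, h0, h1, ih, PMF.map_bind, PMF.map_comp]
      rw [PMF.bind_comm]
      refine congrArg _ (funext fun a => congrArg _ (funext fun b => ?_))
      congr 1
      funext f
      simp [Fin.cons_update]

theorem indep_eq_bind {k : ℕ} (p : Fin k → PMF α) (i : Fin k) :
    indep p = (p i).bind fun a => (indep p).map fun f => Function.update f i a := by
  conv_lhs => rw [← Function.update_eq_self i p]
  exact indep_update p i (p i)

theorem indep_map_apply {k : ℕ} (p : Fin k → PMF α) (i : Fin k) :
    (indep p).map (fun f => f i) = p i := by
  rw [indep_eq_bind p i, PMF.map_bind]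
  simp only [PMF.map_comp]
  have h : ∀ a : α, (fun f : Fin k → α => f i) ∘ (fun f => Function.update f i a) =
      Function.const _ a := by
    intro a
    funext f
    simp
  simp only [h, PMF.map_const, PMF.bind_pure]

end PMFLemmas

/-! ## Acceptance probabilities -/

section PrTrue

variable {α β : Type}

theorem prTrue_nonneg (p : PMF Bool) : 0 ≤ prTrue p := ENNReal.toReal_nonneg

theorem prTrue_le_one (p : PMF Bool) : prTrue p ≤ 1 :=
  ENNReal.toReal_le_of_le_ofReal zero_le_one (by simpa using p.coe_le_one true)

theorem abs_prTrue_sub_le_one (p q : PMF Bool) : |prTrue p - prTrue q| ≤ 1 := by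
  rw [abs_le]
  constructor <;>
    linarith [prTrue_nonneg p, prTrue_nonneg q, prTrue_le_one p, prTrue_le_one q]

theorem prTrue_pure (b : Bool) : prTrue (PMF.pure b) = if b = true then 1 else 0 := by
  cases b <;> simp [prTrue, PMF.pure_apply]

theorem summable_toReal (p : PMF α) : Summable fun a => (p a).toReal :=
  ENNReal.summable_toReal (by rw [p.tsum_coe]; simp)

theorem summable_mul_prTrue (p : PMF α) (f : α → PMF Bool) :
    Summable fun a => (p a).toReal * prTrue (f a) :=
  (summable_toReal p).of_nonneg_of_le
    (fun a => mul_nonneg ENNReal.toReal_nonneg (prTrue_nonneg _))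
    fun a => mul_le_of_le_one_right ENNReal.toReal_nonneg (prTrue_le_one _)

theorem prTrue_bind (p : PMF α) (f : α → PMF Bool) :
    prTrue (p.bind f) = ∑' a, (p a).toReal * prTrue (f a) := by
  rw [prTrue, PMF.bind_apply, ENNReal.tsum_toReal_eq]
  · simp only [ENNReal.toReal_mul, prTrue]
  · intro a
    exact ENNReal.mul_ne_top (p.apply_ne_top a) ((f a).apply_ne_top true)

/-- Experiments that start alike and then differ by at most the sum of the acceptance probabilities
of others. -/
theorem abs_prTrue_bind_sub_le_sum {ι : Type} (S : Finset ι) (p : PMF α) {f g : α → PMF Bool}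
    {h : ι → α → PMF Bool}
    (H : ∀ a, |prTrue (f a) - prTrue (g a)| ≤ ∑ i ∈ S, prTrue (h i a)) :
    |prTrue (p.bind f) - prTrue (p.bind g)| ≤ ∑ i ∈ S, prTrue (p.bind (h i)) := by
  have key : ∀ f g : α → PMF Bool,
      (∀ a, prTrue (f a) - prTrue (g a) ≤ ∑ i ∈ S, prTrue (h i a)) →
      prTrue (p.bind f) - prTrue (p.bind g) ≤ ∑ i ∈ S, prTrue (p.bind (h i)) := by
    intro f g H
    have hs := summable_sum (s := S) fun i _ => summable_mul_prTrue p (h i)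
    simp only [prTrue_bind]
    rw [sub_le_iff_le_add, ← Summable.tsum_finsetSum fun i _ => summable_mul_prTrue p (h i),
      ← hs.tsum_add (summable_mul_prTrue p g)]
    refine (summable_mul_prTrue p f).tsum_le_tsum (fun a => ?_)
      (hs.add (summable_mul_prTrue p g))
    rw [← Finset.mul_sum, ← mul_add]
    exact mul_le_mul_of_nonneg_left (by linarith [H a]) ENNReal.toReal_nonneg
  rw [abs_sub_le_iff]
  exact ⟨key f g fun a => (abs_sub_le_iff.1 (H a)).1, key g f fun a => (abs_sub_le_iff.1 (H a)).2⟩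

end PrTrue

/-! ## Negligible functions -/

namespace Negligible

theorem add {f g : ℕ → ℝ} (hf : Negligible f) (hg : Negligible g) :
    Negligible fun n => f n + g n :=
  Asymptotics.SuperpolynomialDecay.add hf hg

theorem of_le {f g : ℕ → ℝ} (hg : Negligible g) (h : ∀ n, |f n| ≤ g n) : Negligible f :=
  Asymptotics.SuperpolynomialDecay.trans_abs_le hg fun n => (h n).trans (le_abs_self _)

theorem zero : Negligible fun _ => 0 := Asymptotics.superpolynomialDecay_zero _ _

theorem sum {ι : Type} (s : Finset ι) {f : ι → ℕ → ℝ} (h : ∀ i ∈ s, Negligible (f i)) :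
    Negligible fun n => ∑ i ∈ s, f i n := by
  induction s using Finset.induction_on with
  | empty => simpa using zero
  | insert a s ha ih =>
    simp only [Finset.sum_insert ha]
    exact (h a (Finset.mem_insert_self _ _)).add
      (ih fun i hi => h i (Finset.mem_insert_of_mem hi))

theorem geometric {r : ℝ} (h0 : 0 ≤ r) (h1 : r < 1) : Negligible fun n => r ^ n := fun k =>
  tendsto_pow_const_mul_const_pow_of_abs_lt_one k (by rwa [abs_of_nonneg h0])

end Negligible

/-! ## Probabilistic polynomial time -/

/-- `f` is sampled, on encodings, by a circuit with at most `s` gates and `r` random bits. -/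
def SamplableInSize {α β : Type} [BitCode α] [BitCode β] (f : α → PMF β) (r s : ℕ) : Prop :=
  ∃ g : α × Bits r → β, ComputableInSize g s ∧
    ∀ a, f a = (PMF.uniformOfFintype (Bits r)).map fun ω => g (a, ω)

/-- The random string is split: the first `r` bits drive `f`, the remaining `r'` drive `h`. -/
theorem SamplableInSize.bind {α β γ : Type} [BitCode α] [BitCode β] [BitCode γ] {f : α → PMF β}
    {h : α × β → PMF γ} {r r' s s' : ℕ} (hf : SamplableInSize f r s)
    (hh : SamplableInSize h r' s') :
    SamplableInSize (fun a => (f a).bind fun b => h (a, b)) (r + r') (s + s') := by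
  obtain ⟨g, hg, ef⟩ := hf
  obtain ⟨g', hg', eh⟩ := hh
  refine ⟨fun x => g' ((x.1, g (x.1, fun i => x.2 (Fin.castAdd r' i))),
    fun i => x.2 (Fin.natAdd r i)), ?_, fun a => ?_⟩
  · have w1 : ComputableInSize (fun x : α × Bits (r + r') =>
        (x.1, (fun i => x.2 (Fin.castAdd r' i) : Bits r))) 0 :=
      .wires (Sum.map id fun w : Fin r × Unit => (Fin.castAdd r' w.1, w.2)) fun a w => by
        cases w <;> rfl
    have w2 : ComputableInSize (fun x : α × Bits (r + r') => x.1) 0 :=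
      .wires Sum.inl fun _ _ => rfl
    have w3 : ComputableInSize (fun x : α × Bits (r + r') =>
        (fun i => x.2 (Fin.natAdd r i) : Bits r')) 0 :=
      .wires (fun w : Fin r' × Unit => Sum.inr (Fin.natAdd r w.1, w.2)) fun _ _ => rfl
    exact (hg'.comp ((w2.pair (hg.comp w1)).pair w3)).mono (by omega)
  · have key := congrArg (fun p => PMF.map
      (fun x : Bits r × Bits r' => g' ((a, g (a, x.1)), x.2)) p) (PMF.uniform_bits_add r r')
    simp only [PMF.map_comp, PMF.map_bind] at key
    simp only [ef, eh, PMF.bind_map]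
    exact key.symm

theorem SamplableInSize.mono {α β : Type} [BitCode α] [BitCode β] {f : α → PMF β} {r s t : ℕ}
    (h : SamplableInSize f r s) (hst : s ≤ t) : SamplableInSize f r t := by
  obtain ⟨g, hg, e⟩ := h
  exact ⟨g, hg.mono hst, e⟩

theorem ppt_iff {α β : ℕ → Type} [∀ n, BitCode (α n)] [∀ n, BitCode (β n)]
    {f : ∀ n, α n → PMF (β n)} :
    PPT f ↔ ∃ r s : ℕ → ℕ, PolyBounded r ∧ PolyBounded s ∧
      ∀ n, SamplableInSize (f n) (r n) (s n) := by
  constructor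
  · rintro ⟨p, hp⟩
    choose r g hr hg e using hp
    exact ⟨r, fun n => p.eval n, ⟨p, hr⟩, ⟨p, fun _ => le_rfl⟩, fun n => ⟨g n, hg n, e n⟩⟩
  · rintro ⟨r, s, ⟨p, hp⟩, ⟨q, hq⟩, h⟩
    refine ⟨p + q, fun n => ?_⟩
    obtain ⟨g, hg, e⟩ := h n
    refine ⟨r n, g, (hp n).trans (by simp), hg.mono ((hq n).trans (by simp)), e⟩

namespace PPT

variable {α β γ δ : ℕ → Type} [∀ n, BitCode (α n)] [∀ n, BitCode (β n)] [∀ n, BitCode (γ n)]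
  [∀ n, BitCode (δ n)]

theorem pure {f : ∀ n, α n → β n} (hf : PolyTime f) : PPT fun n a => PMF.pure (f n a) := by
  obtain ⟨s, hs, h⟩ := polyTime_iff.1 hf
  refine ppt_iff.2 ⟨fun _ => 0, s, PolyBounded.const 0, hs, fun n =>
    ⟨fun x => f n x.1, ?_, fun a => ?_⟩⟩
  · exact ((h n).comp (.wires (f := fun x : α n × Bits 0 => x.1) Sum.inl fun _ _ => rfl)).mono
      (by omega)
  · exact (PMF.map_const _ _).symm

theorem comp {f : ∀ n, β n → PMF (γ n)} {g : ∀ n, α n → β n} (hf : PPT f) (hg : PolyTime g) :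
    PPT fun n a => f n (g n a) := by
  obtain ⟨r, s, hr, hs, h⟩ := ppt_iff.1 hf
  obtain ⟨t, ht, h'⟩ := polyTime_iff.1 hg
  refine ppt_iff.2 ⟨r, _, hr, ht.add hs, fun n => ?_⟩
  obtain ⟨G, hG, e⟩ := h n
  refine ⟨fun x => G (g n x.1, x.2), ?_, fun a => e _⟩
  have w1 : ComputableInSize (fun x : α n × Bits (r n) => x.1) 0 :=
    .wires Sum.inl fun _ _ => rfl
  have w2 : ComputableInSize (fun x : α n × Bits (r n) => x.2) 0 :=
    .wires Sum.inr fun _ _ => rfl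
  exact (hG.comp (((h' n).comp w1).pair w2)).mono (by omega)

theorem bind {f : ∀ n, α n → PMF (β n)} {h : ∀ n, α n → β n → PMF (γ n)} (hf : PPT f)
    (hh : PPT fun n (x : α n × β n) => h n x.1 x.2) :
    PPT fun n a => (f n a).bind fun b => h n a b := by
  obtain ⟨r, s, hr, hs, H⟩ := ppt_iff.1 hf
  obtain ⟨r', s', hr', hs', H'⟩ := ppt_iff.1 hh
  exact ppt_iff.2 ⟨_, _, hr.add hr', hs.add hs', fun n => (H n).bind (H' n)⟩

theorem map {f : ∀ n, α n → PMF (β n)} {g : ∀ n, α n → β n → γ n} (hf : PPT f)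
    (hg : PolyTime fun n (x : α n × β n) => g n x.1 x.2) :
    PPT fun n a => (f n a).map fun b => g n a b :=
  hf.bind (PPT.pure hg)

theorem indep {k : ℕ} {f : Fin k → ∀ n, α n → PMF (β n)} (hf : ∀ i, PPT (f i)) :
    PPT fun n a => indep fun i => f i n a := by
  induction k with
  | zero => exact PPT.pure (PolyTime.const (β := fun n => Fin 0 → β n) fun _ => Fin.elim0)
  | succ k ih =>
    have key : PolyTime (α := fun n => (α n × β n) × (Fin k → β n))
        (β := fun n => Fin (k + 1) → β n)
        fun n x => Fin.cons (α := fun _ => β n) x.1.2 x.2 := by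
      refine (PolyTime.pi (f := fun i n (x : (α n × β n) × (Fin k → β n)) => Fin.cons (α := fun _ => β n) x.1.2 x.2 i)
        fun i => ?_)
      refine Fin.cases ?_ (fun i => ?_) i
      · exact PolyTime.id.fst.snd
      · exact PolyTime.id.snd.apply i
    exact (hf 0).bind (((ih fun i => hf i.succ).comp PolyTime.id.fst).map key)

theorem uniform_bits {k : ℕ → ℕ} (hk : PolyBounded k) :
    PPT fun n (_ : α n) => PMF.uniformOfFintype (Bits (k n)) :=
  ppt_iff.2 ⟨k, _, hk, PolyBounded.const 0, fun n =>
    ⟨Prod.snd, .wires Sum.inr fun _ _ => rfl, fun a => (PMF.map_id _).symm⟩⟩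

theorem of_sampler {f : ∀ n, PMF (β n)} (hf : PPTSampler f) : PPT fun n (_ : α n) => f n :=
  PPT.comp (β := fun _ => Fin 0 → Bool) (f := fun n _ => f n) hf
    (PolyTime.const (β := fun _ => Fin 0 → Bool) fun _ => Fin.elim0)

end PPT

/-! ## Computational indistinguishability -/

namespace CompIndist

variable {α β : ℕ → Type} [∀ n, BitCode (α n)] [∀ n, BitCode (β n)] {p q r : ∀ n, PMF (α n)}

theorem refl (p : ∀ n, PMF (α n)) : CompIndist p p := fun D _ => by
  simpa using Negligible.zero

theorem symm (h : CompIndist p q) : CompIndist q p := fun D hD =>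
  (h D hD).of_le fun n => by rw [abs_abs, abs_sub_comm]

theorem trans (h : CompIndist p q) (h' : CompIndist q r) : CompIndist p r := fun D hD =>
  ((h D hD).add (h' D hD)).of_le fun n => by
    rw [abs_abs]
    exact abs_sub_le _ _ _

theorem bind (h : CompIndist p q) {f : ∀ n, α n → PMF (β n)} (hf : PPT f) :
    CompIndist (fun n => (p n).bind (f n)) (fun n => (q n).bind (f n)) := fun D hD => by
  have := h (fun n a => (f n a).bind (D n))
    (hf.bind (hD.comp PolyTime.id.snd))
  simpa only [PMF.bind_bind] using this

theorem iterate {k : ℕ} {H : ℕ → ∀ n, PMF (α n)} (h : ∀ i < k, CompIndist (H i) (H (i + 1))) :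
    CompIndist (H 0) (H k) := by
  induction k with
  | zero => exact refl _
  | succ k ih => exact (ih fun i hi => h i (by omega)).trans (h k (by omega))

/-- A mixture, over a fixed finite set, of pairs of indistinguishable ensembles. -/
theorem mixture {κ : Type} [Finite κ] (μ : ℕ → PMF κ) {p q : κ → ∀ n, PMF (α n)}
    (h : ∀ a, CompIndist (p a) (q a)) :
    CompIndist (fun n => (μ n).bind fun a => p a n) (fun n => (μ n).bind fun a => q a n) := by
  intro D hD
  have := Fintype.ofFinite κ
  refine (Negligible.sum Finset.univ fun a _ => h a D hD).of_le fun n => ?_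
  rw [abs_abs]
  simp only [PMF.bind_bind]
  rw [prTrue_bind, prTrue_bind, tsum_fintype, tsum_fintype, ← Finset.sum_sub_distrib]
  refine (Finset.abs_sum_le_sum_abs _ _).trans (Finset.sum_le_sum fun a _ => ?_)
  rw [← mul_sub, abs_mul, abs_of_nonneg ENNReal.toReal_nonneg]
  refine mul_le_of_le_one_left (abs_nonneg _) ?_
  exact ENNReal.toReal_le_of_le_ofReal zero_le_one (by simpa using (μ n).coe_le_one a)

/-- Hybrid argument over the coordinates: the first one is exchanged while the others are sampled
from `p`, then the others by induction while the first is sampled from `q`. The distinguisher does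
this sampling, whence the assumption of samplability; `k` is fixed, so finitely many advantages are
added. -/
theorem indep {k : ℕ} {p q : Fin k → ∀ n, PMF (α n)} (hp : ∀ i, PPTSampler (p i))
    (hq : ∀ i, PPTSampler (q i)) (h : ∀ i, CompIndist (p i) (q i)) :
    CompIndist (fun n => indep fun i => p i n) (fun n => MPCAuction.indep fun i => q i n) := by
  induction k with
  | zero => exact refl _
  | succ k ih =>
    have key : PolyTime (α := fun n => α n × (Fin k → α n)) (β := fun n => Fin (k + 1) → α n)
        fun n x => Fin.cons (α := fun _ => α n) x.1 x.2 := by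
      refine PolyTime.pi (f := fun i n (x : α n × (Fin k → α n)) =>
        Fin.cons (α := fun _ => α n) x.1 x.2 i) fun i => ?_
      refine Fin.cases ?_ (fun i => ?_) i
      · exact PolyTime.id.fst
      · exact PolyTime.id.snd.apply i
    have h1 := (h 0).bind ((PPT.indep (α := α) fun i : Fin k => PPT.of_sampler (hp i.succ)).map key)
    have h2 := (ih (fun i => hp i.succ) (fun i => hq i.succ) fun i => h i.succ).bind
      ((PPT.of_sampler (α := fun n => Fin k → α n) (hq 0)).map
        (g := fun n f a => Fin.cons (α := fun _ => α n) a f) (key.comp (PolyTime.id.snd.pair PolyTime.id.fst)))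
    refine CompIndist.trans h1 ?_
    convert h2 using 2 with n n
    · exact PMF.bind_comm _ _ _
    · exact PMF.bind_comm _ _ _

end CompIndist

/-! ## Almost uniform sampling from a fixed finite type -/

section AlmostUniform

variable (κ : Type) [Fintype κ]

/-- The element of `κ` that is written as an indicator vector, if there is one. -/
def decodeIndicator (x : Bits (Fintype.card κ)) : Option κ :=
  if h : ∃ a : κ, (fun i => decide (i = Fintype.equivFin κ a)) = x then some h.choose else none

/-- Rejection sampling with at most `l` trials. -/
def almostUniform [Nonempty κ] : ℕ → PMF κ
  | 0 => PMF.pure (Classical.arbitrary κ)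
  | l + 1 => (PMF.uniformOfFintype (Bits (Fintype.card κ))).bind fun x =>
    (decodeIndicator κ x).elim (almostUniform l) PMF.pure

variable {κ}

theorem decodeIndicator_eq_some {a : κ} {x : Bits (Fintype.card κ)} :
    decodeIndicator κ x = some a ↔ (fun i => decide (i = Fintype.equivFin κ a)) = x := by
  unfold decodeIndicator
  constructor
  · intro h
    split_ifs at h with hx
    rw [Option.some_inj] at h
    rw [← h]
    exact hx.choose_spec
  · intro h
    have hx : ∃ a : κ, (fun i => decide (i = Fintype.equivFin κ a)) = x := ⟨a, h⟩
    rw [dif_pos hx, Option.some_inj]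
    have := congrFun (hx.choose_spec.trans h.symm) (Fintype.equivFin κ a)
    simp only [decide_true, decide_eq_true_eq, EmbeddingLike.apply_eq_iff_eq] at this
    exact this.symm

/-- Each element of `κ` is written by exactly one string, and the other `2 ^ card κ - card κ`
strings are rejected. -/
theorem sum_decodeIndicator (c : ℝ) (f : κ → ℝ) :
    ∑ x, (decodeIndicator κ x).elim c f =
      ∑ a, f a + (2 ^ Fintype.card κ - Fintype.card κ) * c := by
  have h1 : ∀ x : Bits (Fintype.card κ), (decodeIndicator κ x).elim c f =
      c + ∑ a, if decodeIndicator κ x = some a then f a - c else 0 := by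
    intro x
    cases decodeIndicator κ x with
    | none => simp
    | some a => simp
  simp only [h1, Finset.sum_add_distrib]
  rw [Finset.sum_comm]
  simp only [decodeIndicator_eq_some, Finset.sum_ite_eq, Finset.mem_univ, if_true,
    Finset.sum_sub_distrib, Finset.sum_const, Finset.card_univ, Fintype.card_fun,
    Fintype.card_bool, Fintype.card_fin, nsmul_eq_mul]
  push_cast
  ring

/-- An accepted trial is exactly uniform, so the gap comes from rejection alone: each further trial
multiplies it by the rejection probability. -/
theorem prTrue_almostUniform_sub [Nonempty κ] (D : κ → PMF Bool) (l : ℕ) :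
    |prTrue ((almostUniform κ l).bind D) - prTrue ((PMF.uniformOfFintype κ).bind D)| ≤
      (1 - Fintype.card κ / 2 ^ Fintype.card κ) ^ l := by
  have hq : (Fintype.card κ : ℝ) ≤ 2 ^ Fintype.card κ := by
    exact_mod_cast (Nat.lt_two_pow_self).le
  have hp : (0 : ℝ) < 2 ^ Fintype.card κ := by positivity
  have hr : (0 : ℝ) ≤ 1 - Fintype.card κ / 2 ^ Fintype.card κ := by
    rw [sub_nonneg, div_le_one hp]
    exact hq
  induction l with
  | zero => simpa using abs_prTrue_sub_le_one _ _
  | succ l ih =>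
    have hc : (Fintype.card κ : ℝ) ≠ 0 := by simp
    have hU : prTrue ((PMF.uniformOfFintype κ).bind D) =
        (Fintype.card κ : ℝ)⁻¹ * ∑ a, prTrue (D a) := by
      rw [prTrue_bind, tsum_fintype, Finset.mul_sum]
      simp
    have hA : prTrue ((almostUniform κ (l + 1)).bind D) = (2 ^ Fintype.card κ : ℝ)⁻¹ *
        (∑ a, prTrue (D a) + (2 ^ Fintype.card κ - Fintype.card κ) *
          prTrue ((almostUniform κ l).bind D)) := by
      rw [← sum_decodeIndicator, almostUniform, PMF.bind_bind, prTrue_bind, tsum_fintype,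
        Finset.mul_sum]
      refine Finset.sum_congr rfl fun x _ => ?_
      congr 1
      · simp
      · cases decodeIndicator κ x with
        | none => rfl
        | some a => simp [PMF.pure_bind]
    have : prTrue ((almostUniform κ (l + 1)).bind D) - prTrue ((PMF.uniformOfFintype κ).bind D) =
        (1 - Fintype.card κ / 2 ^ Fintype.card κ) *
          (prTrue ((almostUniform κ l).bind D) - prTrue ((PMF.uniformOfFintype κ).bind D)) := by
      rw [hA, hU]
      field_simp
      ring
    rw [this, abs_mul, abs_of_nonneg hr, pow_succ']
    exact mul_le_mul_of_nonneg_left ih hr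

theorem almostUniform_compIndist [Nonempty κ] [BitCode κ] :
    CompIndist (α := fun _ => κ) (fun n => almostUniform κ n)
      (fun _ => PMF.uniformOfFintype κ) := by
  intro D _
  have hp : (0 : ℝ) < 2 ^ Fintype.card κ := by positivity
  refine (Negligible.geometric (r := 1 - Fintype.card κ / 2 ^ Fintype.card κ) ?_ ?_).of_le
    fun n => ?_
  · rw [sub_nonneg, div_le_one hp]
    exact_mod_cast (Nat.lt_two_pow_self).le
  · have : (0 : ℝ) < Fintype.card κ / 2 ^ Fintype.card κ :=
      div_pos (by exact_mod_cast Fintype.card_pos) hp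
    linarith
  · rw [abs_abs]
    exact prTrue_almostUniform_sub (D n) n

theorem almostUniform_ppt [Nonempty κ] [BitCode κ] {α : ℕ → Type} [∀ n, BitCode (α n)] :
    PPT fun n (_ : α n) => almostUniform κ n := by
  refine PPT.of_sampler (f := fun n => almostUniform κ n) (ppt_iff.2 ?_)
  obtain ⟨c, hc⟩ := ComputableInSize.of_finite (Bits (Fintype.card κ) × κ) κ
  refine ⟨fun n => n * Fintype.card κ, fun n => n * c + 2,
    PolyBounded.id.mul (PolyBounded.const _),
    (PolyBounded.id.mul (PolyBounded.const _)).add (PolyBounded.const _), fun n => ?_⟩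
  beta_reduce
  induction n with
  | zero =>
    refine ⟨fun _ => Classical.arbitrary κ, ?_, fun a => (PMF.map_const _ _).symm⟩
    exact (computableInSize_iff.2 ⟨_, HasSize.const (BitCode.bits (Classical.arbitrary κ)),
      fun _ => rfl⟩).mono (by omega)
  | succ l ih =>
    obtain ⟨g, hg, e⟩ := ih
    have h1 : SamplableInSize (fun _ : Fin 0 → Bool =>
        PMF.uniformOfFintype (Bits (Fintype.card κ))) (Fintype.card κ) 0 :=
      ⟨Prod.snd, .wires Sum.inr fun _ _ => rfl, fun a => (PMF.map_id _).symm⟩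
    have h2 : SamplableInSize (fun x : (Fin 0 → Bool) × Bits (Fintype.card κ) =>
        (decodeIndicator κ x.2).elim (almostUniform κ l) PMF.pure) (l * Fintype.card κ)
        ((l * c + 2) + c) := by
      -- The circuit for the remaining trials always runs, and its result is overridden when the
      -- present trial succeeds. Each trial thus adds a block of constant size `c`.
      refine ⟨fun x => (decodeIndicator κ x.1.2).elim (g (x.1.1, x.2)) id, ?_, ?_⟩
      · have w1 : ComputableInSize
            (fun x : ((Fin 0 → Bool) × Bits (Fintype.card κ)) × Bits (l * Fintype.card κ) =>
              (x.1.1, x.2)) 0 :=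
          .wires (Sum.map Sum.inl id) fun _ w => by cases w <;> rfl
        have w2 : ComputableInSize
            (fun x : ((Fin 0 → Bool) × Bits (Fintype.card κ)) × Bits (l * Fintype.card κ) =>
              x.1.2) 0 :=
          .wires (fun w => Sum.inl (Sum.inr w)) fun _ _ => rfl
        exact ((hc fun y => (decodeIndicator κ y.1).elim y.2 id).comp
          (w2.pair (hg.comp w1))).mono (by omega)
      · rintro ⟨a, x⟩
        cases h : decodeIndicator κ x with
        | none => simpa [h] using e a
        | some y =>
          simp only [h, Option.elim]
          exact (PMF.map_const _ _).symm
    have h3 := (h1.bind h2).mono (t := (l + 1) * c + 2) (by ring_nf; omega)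
    have h4 : (l + 1) * Fintype.card κ = Fintype.card κ + l * Fintype.card κ := by ring
    rw [h4]
    exact h3

end AlmostUniform

/-! ## Shamir secret sharing -/

section ShamirLemmas

variable {F : Type} [Field F] {m t : ℕ}

/-- The shares of `s` for given coefficients. -/
def shareOf (pt : Fin m → F) (s : F) (a : Fin (t - 1) → F) (j : Fin m) : F :=
  s + ∑ k : Fin (t - 1), a k * pt j ^ (k.val + 1)

theorem isSharing_shareOf (ht : 1 ≤ t) (pt : Fin m → F) (s : F) (a : Fin (t - 1) → F) :
    IsSharing t pt s (shareOf pt s a) := by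
  refine ⟨Polynomial.C s + ∑ k : Fin (t - 1), Polynomial.C (a k) * Polynomial.X ^ (k.val + 1),
    ?_, ?_, fun j => ?_⟩
  · refine lt_of_le_of_lt (Polynomial.degree_add_le _ _) (max_lt ?_ ?_)
    · exact lt_of_le_of_lt Polynomial.degree_C_le (by exact_mod_cast ht)
    · refine (Polynomial.degree_sum_le _ _).trans_lt ?_
      rw [Finset.sup_lt_iff (by exact WithBot.bot_lt_coe t)]
      intro k _
      refine (Polynomial.degree_C_mul_X_pow_le _ _).trans_lt ?_
      have := k.isLt
      exact_mod_cast (by omega : k.val + 1 < t)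
  · simp [Polynomial.eval_finsetSum]
  · simp [Polynomial.eval_finsetSum, shareOf]

/-- The sharing polynomial has degree less than `t ≤ I.card` and takes the values of `Y` on `I`, so
it is the interpolating polynomial. Values outside `I` are irrelevant, so the openings discarded
there can be anything. -/
theorem reconstruct_eq_some {pt : Fin m → F} (hpt : Function.Injective pt) {s : F}
    {X Y : Fin m → F} (h : IsSharing t pt s X) {I : Finset (Fin m)} (hI : t ≤ I.card)
    (hY : ∀ j ∈ I, Y j = X j) : reconstruct t pt I Y = some s := by
  obtain ⟨p, hp, h0, hX⟩ := h
  have hlt : p.degree < I.card := hp.trans_le (by exact_mod_cast hI)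
  have e : p = Lagrange.interpolate I pt Y :=
    Lagrange.eq_interpolate_of_eval_eq _ hpt.injOn hlt fun j hj => by rw [hX, hY j hj]
  unfold reconstruct
  rw [← e, if_pos ⟨hI, hp⟩, h0]

/-- Fewer than `t` shares of `0` can be shifted to shares of `s`. -/
theorem exists_coefficient_shift {pt : Fin m → F} (hpt : ∀ j, pt j ≠ 0) {K : Finset (Fin m)}
    (hK : K.card < t) (s : F) :
    ∃ d : Fin (t - 1) → F, ∀ j ∈ K, ∑ k : Fin (t - 1), d k * pt j ^ (k.val + 1) = s := by
  -- The polynomial `s * (1 - ∏ (1 - x / x_j))` vanishes at 0 and equals `s` at every point of `K`.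
  -- Its degree is at most `K.card < t`, so its coefficients beyond the constant one are the desired
  -- shift.
  let q : Polynomial F :=
    Polynomial.C s * (1 - ∏ j ∈ K, (1 - Polynomial.C (pt j)⁻¹ * Polynomial.X))
  have hlin : ∀ j, (1 - Polynomial.C (pt j)⁻¹ * Polynomial.X : Polynomial F).natDegree ≤ 1 := by
    intro j
    refine (Polynomial.natDegree_sub_le _ _).trans (max_le (by simp) ?_)
    exact (Polynomial.natDegree_C_mul_le _ _).trans Polynomial.natDegree_X_le
  have hdeg : q.natDegree < t := by
    refine lt_of_le_of_lt (Polynomial.natDegree_C_mul_le _ _) (lt_of_le_of_lt ?_ hK)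
    refine (Polynomial.natDegree_sub_le _ _).trans (max_le (by simp) ?_)
    refine (Polynomial.natDegree_prod_le _ _).trans ?_
    refine (Finset.sum_le_sum fun j _ => hlin j).trans ?_
    simp
  refine ⟨fun k => q.coeff (k.val + 1), fun j hj => ?_⟩
  have h0 : q.coeff 0 = 0 := by
    rw [Polynomial.coeff_zero_eq_eval_zero]
    simp [q, Polynomial.eval_prod]
  have hs : q.eval (pt j) = s := by
    have : ∏ i ∈ K, (1 - (pt i)⁻¹ * pt j) = 0 :=
      Finset.prod_eq_zero hj (by rw [inv_mul_cancel₀ (hpt j), sub_self])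
    simp [q, Polynomial.eval_prod, this]
  obtain ⟨u, rfl⟩ : ∃ u, t = u + 1 := ⟨t - 1, by omega⟩
  rw [Polynomial.eval_eq_sum_range' hdeg, Finset.sum_range_succ', h0, zero_mul, add_zero] at hs
  rw [← hs, Finset.sum_range]
  rfl

/-- Fewer than `t` shares have a distribution that does not depend on the secret. -/
theorem uniform_map_shareOf_masked [Fintype F] {N : ℕ} {pt : Fin m → F} (hpt : ∀ j, pt j ≠ 0)
    {K : Finset (Fin m)} (hK : K.card < t) (b : Fin N → F) :
    (PMF.uniformOfFintype (Fin N → Fin (t - 1) → F)).map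
        (fun a i j => if j ∈ K then shareOf pt (b i) (a i) j else 0) =
      (PMF.uniformOfFintype (Fin N → Fin (t - 1) → F)).map
        (fun a i j => if j ∈ K then shareOf pt 0 (a i) j else 0) := by
  choose d hd using exists_coefficient_shift hpt hK
  -- Translation by the shifts `d (b i)` permutes the coefficient vectors, so it preserves
  -- uniformity; on `K` it turns sharings of 0 into sharings of `b i`.
  conv_rhs => rw [← PMF.map_uniform_equiv
    (Equiv.addRight (fun i => d (b i) : Fin N → Fin (t - 1) → F)), PMF.map_comp]
  congr 1
  funext a i j
  simp only [Function.comp_apply, Equiv.coe_addRight]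
  split_ifs with hj
  · simp only [shareOf, Pi.add_apply, add_mul, Finset.sum_add_distrib, hd _ j hj]
    ring
  · rfl

theorem indep_share [Fintype F] {N : ℕ} (pt : Fin m → F) (b : Fin N → F) :
    indep (fun i => share t pt (b i)) =
      (PMF.uniformOfFintype (Fin N → Fin (t - 1) → F)).map fun a i => shareOf pt (b i) (a i) := by
  rw [uniform_eq_indep]
  exact indep_map _ fun i a => shareOf pt (b i) a

end ShamirLemmas

/-! ### Polynomial-time checking of openings and reconstruction of bids -/

namespace Protocol

section OpeningLemmas

variable {F : Type} [Field F] [BitCode F] {m N : ℕ} (T : Protocol F m N)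

/-- This form is directly computable: presence bits guard an equality between total expressions, so
the default values never influence the truth value. -/
theorem opens_iff {n : ℕ} (c : Option (Fin m → T.Com n)) (j : Fin m)
    (o : Option (Opening F n)) : T.Opens c j o ↔ c.isSome = true ∧ o.isSome = true ∧
      T.commitTo n (o.getD (0, zeroBits _)) = c.getD (fun _ => zeroBits _) j := by
  unfold Opens
  cases c <;> cases o <;> simp

theorem polyLength_opening : PolyLength fun n => Opening F n :=
  (PolyLength.fixed F).prod (PolyLength.bits PolyBounded.id)

theorem polyLength_com : PolyLength T.Com := PolyLength.bits T.cs.comLen_poly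

theorem polyLength_crs : PolyLength T.CRS := PolyLength.bits T.nizk.crsLen_poly

theorem polyLength_proof : PolyLength T.Proof := PolyLength.bits T.nizk.proofLen_poly

variable [Finite F] {α : ℕ → Type} [∀ n, BitCode (α n)]

theorem polyTime_commitTo {f : ∀ n, α n → Opening F n} (hf : PolyTime f) :
    PolyTime fun n a => T.commitTo n (f n a) :=
  T.cs.commit_poly.comp ((PolyTime.of_finite_input F (PolyLength.bits T.cs.msgLen_poly) T.enc
    hf.fst).pair hf.snd)

theorem polyPred_opens {c : ∀ n, α n → Option (Fin m → T.Com n)}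
    {o : ∀ n, α n → Option (Opening F n)} (j : Fin m) (hc : PolyTime c) (ho : PolyTime o) :
    PolyPred fun n a => T.Opens (c n a) j (o n a) := by
  simp only [opens_iff]
  refine (PolyPred.of_polyTime hc.isSome).and ((PolyPred.of_polyTime ho.isSome).and
    (PolyPred.eq T.polyLength_com (T.polyTime_commitTo (ho.getD polyLength_opening
      (PolyTime.const fun _ => _))) ?_))
  exact (hc.getD (T.polyLength_com.pi m) (PolyTime.const (β := fun n => Fin m → T.Com n)
    fun _ => _)).apply j

theorem polyTime_reconstructBid {c : ∀ n, α n → Option (Fin m → T.Com n)}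
    {o : Fin m → ∀ n, α n → Option (Opening F n)} (hc : PolyTime c) (ho : ∀ j, PolyTime (o j)) :
    PolyTime (β := fun _ => F) fun n a => T.reconstructBid n (c n a) fun j => o j n a := by
  have h1 := PolyTime.pi fun j => T.polyPred_opens j hc (ho j)
  have h2 : PolyTime (β := fun _ => Fin m → F) fun n a j =>
      ((o j n a).getD (0, zeroBits _)).1 :=
    PolyTime.pi (β := fun _ => F) fun j =>
      ((ho j).getD polyLength_opening (PolyTime.const fun _ => _)).fst
  -- Once the correct openings are identified, interpolation acts on a fixed finite type of flags
  -- and shares, so no circuit for field arithmetic has to be built.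
  have h := PolyTime.of_finite ((Fin m → Bool) × (Fin m → F)) F (fun _ x =>
    (reconstruct (threshold m) T.pt (Finset.univ.filter fun j => x.1 j = true) x.2).getD 0)
    (h1.pair h2)
  convert h using 4 with n a
  simp only [reconstructBid, decide_eq_true_eq]
  congr 2
  funext j
  cases o j n a <;> rfl

end OpeningLemmas

/-! ### Executions as polynomial-time functions of a seed -/

namespace Adversary

variable {F : Type} [Field F] [BitCode F] {m N : ℕ} {T : Protocol F m N} {aux : ℕ → ℕ}
  (A : T.Adversary aux) (Km : Finset (Fin m)) (Ki : Finset (Fin N)) {n : ℕ}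

/-- Auxiliary input, coins of the adversary, and CRSes. -/
abbrev Base (n : ℕ) : Type := Bits (aux n) × Bits (A.coins n) × (Fin m → T.CRS n)

/-- What determines an execution up to the outcome: for every identity and every miner a
commitment and the opening that may be shown to the miner, and for every identity a proof. -/
abbrev Seed (n : ℕ) : Type :=
  A.Base n × (Fin N → Fin m → T.Com n × Opening F n) × (Fin N → T.Proof n)

def view₁ (x : A.Base n) : T.View₁ aux A.coins n := ((x.1, x.2.1), restrict Kmᶜ x.2.2)

def crsVector (x : A.Base n) : Fin m → T.CRS n := fun j =>
  if j ∈ Km then (A.crs n (A.view₁ Km x) j).getD (zeroBits _) else x.2.2 j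

def view₂ (e : A.Seed n) : T.View₂ aux A.coins n :=
  (A.view₁ Km e.1, restrict Kiᶜ fun i j => (e.2.1 i j).1)

def coms (e : A.Seed n) (i : Fin N) : Option (Fin m → T.Com n) :=
  if i ∈ Ki then A.com n (A.view₂ Km Ki e) i else some fun j => (e.2.1 i j).1

def view₃ (e : A.Seed n) : T.View₃ aux A.coins n := (A.view₂ Km Ki e, restrict Kiᶜ e.2.2)

def proofs (e : A.Seed n) (i : Fin N) : Option (T.Proof n) :=
  if i ∈ Ki then A.proof n (A.view₃ Km Ki e) i else some (e.2.2 i)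

/-- The statement of identity `i`; a missing commitment is replaced by 0. -/
def stmt (e : A.Seed n) (i : Fin N) : ShareStmt N m T.cs n :=
  (i, (A.coms Km Ki e i).getD fun _ => zeroBits _)

/-- The proof of identity `i`; a missing one is replaced by 0. -/
def proofD (e : A.Seed n) (i : Fin N) : T.Proof n := (A.proofs Km Ki e i).getD (zeroBits _)

/-- Membership in `Ki` is built in: honest identities always pass this check, by completeness. -/
def unproved (e : A.Seed n) (i : Fin N) : Prop :=
  i ∈ Ki ∧ ¬ ((A.coms Km Ki e i).isSome = true ∧ (A.proofs Km Ki e i).isSome = true ∧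
    T.nizk.V n (A.crsVector Km e.1, A.stmt Km Ki e i, A.proofD Km Ki e i) = true)

def view₄ (e : A.Seed n) : T.View₄ aux A.coins n :=
  (A.view₃ Km Ki e, fun i j => if i ∉ Ki ∧ j ∈ Km then some (e.2.1 i j).2 else none)

/-- An honest identity gets "ok" from every honest miner without inspecting any opening, so the
openings for honest miners need not be in the seed. -/
def honestVote (e : A.Seed n) (j : Fin m) (i : Fin N) : Option Bool :=
  if A.unproved Km Ki e i then none
  else some (decide (i ∈ Ki ∧
    ¬ T.Opens (A.coms Km Ki e i) j (A.opening n (A.view₄ Km Ki e) i j)))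

def view₅ (e : A.Seed n) : T.View₅ aux A.coins n :=
  (A.view₄ Km Ki e, fun j i => if j ∈ Km then none else A.honestVote Km Ki e j i)

def votes (e : A.Seed n) (j : Fin m) (i : Fin N) : Option Bool :=
  if j ∈ Km then A.vote n (A.view₅ Km Ki e) j i else A.honestVote Km Ki e j i

/-- Replies of honest identities are restricted to `j ∈ Km`. Nothing is lost, as honest miners do
not complain about them; and the openings revealed here are ones that the corrupted miners hold
already. -/
def view₆ (e : A.Seed n) : T.View₆ aux A.coins n :=
  (A.view₅ Km Ki e, fun i j => if i ∈ Ki then none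
    else if j ∈ Km ∧ A.votes Km Ki e j i = some true then some (e.2.1 i j).2 else none)

/-- This is meaningful for corrupted identities only: the replies are always taken from the
adversary. -/
def excluded (e : A.Seed n) (i : Fin N) : Prop :=
  A.unproved Km Ki e i ∨ ∃ j, A.votes Km Ki e j i = some true ∧
    ¬ T.Opens (A.coms Km Ki e i) j (A.reply n (A.view₆ Km Ki e) i j)

/-- The opening for the corrupted identity `i` that miner `j` sends to the hybrid functionality. -/
def inputs (e : A.Seed n) (j : Fin m) (i : Fin N) : Option (Opening F n) :=
  if j ∈ Km then A.input n (A.view₆ Km Ki e) j i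
  else if T.Opens (A.coms Km Ki e i) j (A.opening n (A.view₄ Km Ki e) i j) then
    A.opening n (A.view₄ Km Ki e) i j
  else if T.Opens (A.coms Km Ki e i) j (A.reply n (A.view₆ Km Ki e) i j) then
    A.reply n (A.view₆ Km Ki e) i j
  else none

/-- The bids of the corrupted identities, `f i` for the ones that are not excluded. -/
def corruptBids (e : A.Seed n) (f : Fin N → F) (i : Fin N) : F :=
  if i ∈ Ki then if A.excluded Km Ki e i then 0 else f i else 0

/-- The bids of the corrupted identities, as the hybrid functionality reconstructs them. -/
def reconstructedBids (e : A.Seed n) : Fin N → F :=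
  A.corruptBids Km Ki e fun i =>
    T.reconstructBid n (A.coms Km Ki e i) fun j => A.inputs Km Ki e j i

section PolyTime

theorem polyLength_base (haux : PolyBounded aux) : PolyLength A.Base :=
  (PolyLength.bits haux).prod ((PolyLength.bits A.coins_poly).prod (T.polyLength_crs.pi m))

theorem polyLength_seed (haux : PolyBounded aux) : PolyLength A.Seed :=
  (A.polyLength_base haux).prod ((((T.polyLength_com.prod polyLength_opening).pi m).pi N).prod
    (T.polyLength_proof.pi N))

theorem polyTime_view₁ : PolyTime fun n (x : A.Base n) => A.view₁ Km x :=
  (PolyTime.id.fst.pair PolyTime.id.snd.fst).pair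
    (PolyTime.restrict _ fun j => PolyTime.id.snd.snd.apply j)

theorem polyTime_crsVector : PolyTime (β := fun n => Fin m → T.CRS n)
    fun n (x : A.Base n) => A.crsVector Km x := by
  refine PolyTime.pi (f := fun j n (x : A.Base n) => A.crsVector Km x j) fun j => ?_
  unfold crsVector
  by_cases h : j ∈ Km
  · simpa only [if_pos h] using ((A.crs_poly.comp (A.polyTime_view₁ Km)).apply j).getD
      T.polyLength_crs (PolyTime.const fun _ => _)
  · simpa only [if_neg h] using PolyTime.id.snd.snd.apply j

theorem polyTime_view₂ : PolyTime fun n (e : A.Seed n) => A.view₂ Km Ki e :=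
  ((A.polyTime_view₁ Km).comp PolyTime.id.fst).pair
    (PolyTime.restrict (β := fun n => Fin m → T.Com n) _ fun i =>
      PolyTime.pi fun j => ((PolyTime.id.snd.fst.apply i).apply j).fst)

theorem polyTime_coms (i : Fin N) : PolyTime (β := fun n => Option (Fin m → T.Com n))
    fun n (e : A.Seed n) => A.coms Km Ki e i := by
  unfold coms
  by_cases h : i ∈ Ki
  · simpa only [if_pos h] using (A.com_poly.comp (A.polyTime_view₂ Km Ki)).apply i
  · simpa only [if_neg h] using PolyTime.some (β := fun n => Fin m → T.Com n)
      (PolyTime.pi fun j => ((PolyTime.id.snd.fst.apply i).apply j).fst)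

theorem polyTime_view₃ : PolyTime fun n (e : A.Seed n) => A.view₃ Km Ki e :=
  (A.polyTime_view₂ Km Ki).pair (PolyTime.restrict _ fun i => PolyTime.id.snd.snd.apply i)

theorem polyTime_proofs (i : Fin N) : PolyTime (β := fun n => Option (T.Proof n))
    fun n (e : A.Seed n) => A.proofs Km Ki e i := by
  unfold proofs
  by_cases h : i ∈ Ki
  · simpa only [if_pos h] using (A.proof_poly.comp (A.polyTime_view₃ Km Ki)).apply i
  · simpa only [if_neg h] using (PolyTime.id.snd.snd.apply i).some

theorem polyTime_stmt (i : Fin N) : PolyTime fun n (e : A.Seed n) => A.stmt Km Ki e i :=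
  (PolyTime.const (β := fun _ => Fin N) fun _ => i).pair
    ((A.polyTime_coms Km Ki i).getD (T.polyLength_com.pi m) (PolyTime.const fun _ => _))

theorem polyTime_proofD (i : Fin N) : PolyTime fun n (e : A.Seed n) => A.proofD Km Ki e i :=
  (A.polyTime_proofs Km Ki i).getD T.polyLength_proof (PolyTime.const fun _ => _)

theorem polyPred_unproved (i : Fin N) :
    PolyPred fun n (e : A.Seed n) => A.unproved Km Ki e i :=
  (PolyPred.const _).and ((PolyPred.of_polyTime (A.polyTime_coms Km Ki i).isSome).and
    ((PolyPred.of_polyTime (A.polyTime_proofs Km Ki i).isSome).and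
      (PolyPred.of_polyTime (T.nizk.V_poly.comp (((A.polyTime_crsVector Km).comp
        PolyTime.id.fst).pair ((A.polyTime_stmt Km Ki i).pair (A.polyTime_proofD Km Ki i))))))).not

theorem polyTime_view₄ : PolyTime fun n (e : A.Seed n) => A.view₄ Km Ki e := by
  refine (A.polyTime_view₃ Km Ki).pair (PolyTime.pi (β := fun n => Fin m → Option (Opening F n))
    fun i => PolyTime.pi (β := fun n => Option (Opening F n)) fun j => ?_)
  by_cases h : i ∉ Ki ∧ j ∈ Km
  · simpa only [if_pos h] using ((PolyTime.id.snd.fst.apply i).apply j).snd.some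
  · simpa only [if_neg h] using PolyTime.const fun _ => none

variable [Finite F]

theorem polyTime_honestVote (j : Fin m) (i : Fin N) : PolyTime (β := fun _ => Option Bool)
    fun n (e : A.Seed n) => A.honestVote Km Ki e j i :=
  PolyTime.ite (PolyLength.fixed _) (A.polyPred_unproved Km Ki i) (PolyTime.const fun _ => none)
    (PolyTime.some (((PolyPred.const _).and (T.polyPred_opens j (A.polyTime_coms Km Ki i)
      (((A.opening_poly.comp (A.polyTime_view₄ Km Ki)).apply i).apply j)).not).decide))

theorem polyTime_view₅ : PolyTime fun n (e : A.Seed n) => A.view₅ Km Ki e := by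
  refine (A.polyTime_view₄ Km Ki).pair (PolyTime.pi (β := fun _ => Fin N → Option Bool)
    fun j => PolyTime.pi (β := fun _ => Option Bool) fun i => ?_)
  by_cases h : j ∈ Km
  · simpa only [if_pos h] using PolyTime.const fun _ => none
  · simpa only [if_neg h] using A.polyTime_honestVote Km Ki j i

theorem polyTime_votes (j : Fin m) (i : Fin N) : PolyTime (β := fun _ => Option Bool)
    fun n (e : A.Seed n) => A.votes Km Ki e j i := by
  unfold votes
  by_cases h : j ∈ Km
  · simpa only [if_pos h] using
      ((A.vote_poly.comp (A.polyTime_view₅ Km Ki)).apply j).apply i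
  · simpa only [if_neg h] using A.polyTime_honestVote Km Ki j i

theorem polyPred_vote (j : Fin m) (i : Fin N) :
    PolyPred fun n (e : A.Seed n) => A.votes Km Ki e j i = some true :=
  PolyPred.eq (β := fun _ => Option Bool) (PolyLength.fixed _) (A.polyTime_votes Km Ki j i)
    (PolyTime.const fun _ => some true)

theorem polyTime_view₆ : PolyTime fun n (e : A.Seed n) => A.view₆ Km Ki e := by
  refine (A.polyTime_view₅ Km Ki).pair (PolyTime.pi (β := fun n => Fin m → Option (Opening F n))
    fun i => PolyTime.pi (β := fun n => Option (Opening F n)) fun j => ?_)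
  by_cases h : i ∈ Ki
  · simpa only [if_pos h] using PolyTime.const fun _ => none
  · simp only [if_neg h]
    exact PolyTime.ite polyLength_opening.option ((PolyPred.const _).and
      (A.polyPred_vote Km Ki j i)) ((PolyTime.id.snd.fst.apply i).apply j).snd.some
      (PolyTime.const fun _ => none)

theorem polyPred_opens_reply (i : Fin N) (j : Fin m) : PolyPred fun n (e : A.Seed n) =>
    T.Opens (A.coms Km Ki e i) j (A.reply n (A.view₆ Km Ki e) i j) :=
  T.polyPred_opens j (A.polyTime_coms Km Ki i)
    (((A.reply_poly.comp (A.polyTime_view₆ Km Ki)).apply i).apply j)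

theorem polyPred_excluded (i : Fin N) :
    PolyPred fun n (e : A.Seed n) => A.excluded Km Ki e i :=
  (A.polyPred_unproved Km Ki i).or (PolyPred.exists_fin fun j =>
    (A.polyPred_vote Km Ki j i).and (A.polyPred_opens_reply Km Ki i j).not)

theorem polyTime_inputs (j : Fin m) (i : Fin N) : PolyTime (β := fun n => Option (Opening F n))
    fun n (e : A.Seed n) => A.inputs Km Ki e j i := by
  unfold inputs
  by_cases h : j ∈ Km
  · simpa only [if_pos h] using
      ((A.input_poly.comp (A.polyTime_view₆ Km Ki)).apply j).apply i
  · simp only [if_neg h]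
    have ho : PolyTime fun n (e : A.Seed n) => A.opening n (A.view₄ Km Ki e) i j :=
      ((A.opening_poly.comp (A.polyTime_view₄ Km Ki)).apply i).apply j
    exact PolyTime.ite polyLength_opening.option
      (T.polyPred_opens j (A.polyTime_coms Km Ki i) ho) ho
      (PolyTime.ite polyLength_opening.option (A.polyPred_opens_reply Km Ki i j)
        (((A.reply_poly.comp (A.polyTime_view₆ Km Ki)).apply i).apply j)
        (PolyTime.const fun _ => none))

theorem polyTime_corruptBids {α : ℕ → Type} [∀ n, BitCode (α n)] {e : ∀ n, α n → A.Seed n}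
    {f : Fin N → ∀ n, α n → F} (he : PolyTime e) (hf : ∀ i, PolyTime (β := fun _ => F) (f i)) :
    PolyTime (β := fun _ => Fin N → F)
      fun n a => A.corruptBids Km Ki (e n a) fun i => f i n a := by
  refine PolyTime.pi (β := fun _ => F)
    (f := fun i n a => A.corruptBids Km Ki (e n a) (fun i => f i n a) i) fun i => ?_
  unfold corruptBids
  by_cases h : i ∈ Ki
  · simp only [if_pos h]
    exact PolyTime.ite (PolyLength.fixed F) (PolyTime.comp (A.polyPred_excluded Km Ki i) he)
      (PolyTime.const fun _ => 0) (hf i)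
  · simpa only [if_neg h] using PolyTime.const (β := fun _ => F) fun _ => 0

theorem polyTime_reconstructedBids : PolyTime (β := fun _ => Fin N → F)
    fun n (e : A.Seed n) => A.reconstructedBids Km Ki e :=
  A.polyTime_corruptBids Km Ki PolyTime.id fun i =>
    T.polyTime_reconstructBid (A.polyTime_coms Km Ki i) fun j => A.polyTime_inputs Km Ki j i

end PolyTime

end Adversary

end Protocol

/-! ### The honest majority and the outcome of a real execution -/

/-- `majorityValue` picks some strict majority value by choice; two different ones would need
disjoint sets of more than `m / 2` miners each. -/
theorem majorityValue_eq_some {m : ℕ} {α : Type} {a : Fin m → Option α} {v : α}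
    (h : m < 2 * (Finset.univ.filter fun j => a j = some v).card) : majorityValue a = some v := by
  have hex : ∃ v, m < 2 * (Finset.univ.filter fun j => a j = some v).card := ⟨v, h⟩
  unfold majorityValue
  rw [dif_pos hex, Option.some_inj]
  by_contra hne
  have hd : Disjoint (Finset.univ.filter fun j => a j = some hex.choose)
      (Finset.univ.filter fun j => a j = some v) := by
    rw [Finset.disjoint_left]
    intro j h1 h2
    simp only [Finset.mem_filter, Finset.mem_univ, true_and] at h1 h2
    exact hne (Option.some_inj.1 (h1.symm.trans h2))
  have h1 := Finset.card_union_of_disjoint hd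
  have h2 := Finset.card_le_univ ((Finset.univ.filter fun j => a j = some hex.choose) ∪
    (Finset.univ.filter fun j => a j = some v))
  have h3 := hex.choose_spec
  rw [Fintype.card_fin] at h2
  omega

/-- This count of honest miners is used three times: it reaches the reconstruction threshold, it is
the majority required of CRS vectors, and it is a strict majority of the announcements. -/
theorem majority_compl {m : ℕ} {Km : Finset (Fin m)} (hKm : 2 * Km.card < m) :
    m / 2 + 1 ≤ Kmᶜ.card := by
  rw [Finset.card_compl, Fintype.card_fin]
  omega

namespace Protocol

variable {F : Type} [Field F] [BitCode F] {m N : ℕ} (T : Protocol F m N)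

/-- Correct openings from all honest miners determine the shared bid, whatever else is sent. -/
theorem reconstructBid_eq (hbinding : T.cs.PerfectlyBinding) {Km : Finset (Fin m)}
    (hKm : 2 * Km.card < m) {n : ℕ} {x : ShareStmt N m T.cs n} {w : ShareWit F m n}
    (hR : T.Rel n x w) {o : Fin m → Option (Opening F n)}
    (ho : ∀ j ∉ Km, T.Opens (some x.2) j (o j)) : T.reconstructBid n (some x.2) o = w.1 := by
  obtain ⟨hw, hs⟩ := hR
  unfold reconstructBid
  rw [reconstruct_eq_some T.pt_injective hs, Option.getD_some]
  · have hsub : Kmᶜ ⊆ Finset.univ.filter fun j => T.Opens (some x.2) j (o j) := by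
      intro j hj
      simpa using ho j (Finset.mem_compl.1 hj)
    have := Finset.card_le_card hsub
    have := majority_compl hKm
    unfold threshold
    omega
  · intro j hj
    simp only [Finset.mem_filter, Finset.mem_univ, true_and] at hj
    obtain ⟨c, o', hc, ho', e⟩ := hj
    rw [Option.some_inj] at hc
    subst hc
    rw [ho', Option.elim_some]
    -- A correct opening, even one sent by a corrupted miner, opens the same commitment as the
    -- witness does; binding forces equal encodings, hence equal shares.
    refine T.enc_injective n ?_
    by_contra hne
    exact hbinding n _ _ o'.2 (w.2 j).2 hne (e.trans (hw j).symm)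

namespace Adversary

variable {T} {aux : ℕ → ℕ} (A : T.Adversary aux) (Km : Finset (Fin m)) (Ki : Finset (Fin N))
  {n : ℕ}

/-- For a corrupted identity that is not excluded, every honest miner holds a correct opening,
obtained privately or in reply to its complaint. These openings alone fix the polynomial in the
witness, whatever the corrupted miners contribute. -/
theorem reconstructedBids_eq_corruptBids (hbinding : T.cs.PerfectlyBinding)
    (hKm : 2 * Km.card < m) (e : A.Seed n) (w : Fin N → ShareWit F m n)
    (h : ∀ i ∈ Ki, T.nizk.V n (A.crsVector Km e.1, A.stmt Km Ki e i, A.proofD Km Ki e i) = true →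
      T.Rel n (A.stmt Km Ki e i) (w i)) :
    A.reconstructedBids Km Ki e = A.corruptBids Km Ki e fun i => (w i).1 := by
  funext i
  unfold reconstructedBids corruptBids
  split_ifs with hi hex
  · rfl
  · simp only [excluded, not_or, not_exists, not_and, not_not] at hex
    obtain ⟨hun, hvote⟩ := hex
    have hun' := hun
    simp only [unproved, hi, true_and, not_not] at hun
    obtain ⟨hc, -, hV⟩ := hun
    have hR := h i hi hV
    have hcom : A.coms Km Ki e i = some (A.stmt Km Ki e i).2 := by
      obtain ⟨c, hc⟩ := Option.isSome_iff_exists.1 hc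
      simp [stmt, hc]
    beta_reduce
    rw [hcom]
    refine T.reconstructBid_eq hbinding hKm hR fun j hj => ?_
    rw [← hcom]
    simp only [inputs, if_neg hj]
    by_cases h1 : T.Opens (A.coms Km Ki e i) j (A.opening n (A.view₄ Km Ki e) i j)
    · rwa [if_pos h1]
    -- A miner without a correct private opening has complained, and an identity that is not
    -- excluded has answered every complaint correctly.
    · have h2 : T.Opens (A.coms Km Ki e i) j (A.reply n (A.view₆ Km Ki e) i j) := by
        refine hvote j ?_
        simp only [votes, if_neg hj, honestVote, if_neg hun', hi, h1, not_false_eq_true, and_self,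
          decide_true]
      rwa [if_neg h1, if_pos h2]
  · rfl

/-- The execution after all sampling, except for that of the outcome. -/
def execution (x : A.Base n) (hop : Fin N → Fin m → Opening F n) (hproof : Fin N → T.Proof n) :
    PMF (T.HonestOut n × T.View aux A.coins n) := do
  let v₁ : T.View₁ aux A.coins n := ((x.1, x.2.1), restrict Kmᶜ x.2.2)
  let crs : Fin m → T.CRS n := fun j =>
    if j ∈ Km then (A.crs n v₁ j).getD (zeroBits _) else x.2.2 j
  let hcom : Fin N → Fin m → T.Com n := fun i j => T.commitTo n (hop i j)
  let v₂ : T.View₂ aux A.coins n := (v₁, restrict Kiᶜ hcom)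
  let com : Fin N → Option (Fin m → T.Com n) := fun i =>
    if i ∈ Ki then A.com n v₂ i else some (hcom i)
  let v₃ : T.View₃ aux A.coins n := (v₂, restrict Kiᶜ hproof)
  let proof : Fin N → Option (T.Proof n) := fun i =>
    if i ∈ Ki then A.proof n v₃ i else some (hproof i)
  let bad₁ : Finset (Fin N) := Finset.univ.filter fun i =>
    ¬ ∃ c π, com i = some c ∧ proof i = some π ∧ T.nizk.V n (crs, (i, c), π) = true
  let v₄ : T.View₄ aux A.coins n :=
    (v₃, fun i j => if i ∉ Ki ∧ j ∈ Km then some (hop i j) else none)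
  let opening : Fin N → Fin m → Option (Opening F n) := fun i j =>
    if i ∈ Ki then A.opening n v₄ i j else some (hop i j)
  let hvote : Fin m → Fin N → Option Bool := fun j i =>
    if i ∈ bad₁ then none else some (decide (¬ T.Opens (com i) j (opening i j)))
  let v₅ : T.View₅ aux A.coins n := (v₄, fun j i => if j ∈ Km then none else hvote j i)
  let vote : Fin m → Fin N → Option Bool := fun j i =>
    if j ∈ Km then A.vote n v₅ j i else hvote j i
  let hreply : Fin N → Fin m → Option (Opening F n) := fun i j =>
    if vote j i = some true then some (hop i j) else none
  let v₆ : T.View₆ aux A.coins n := (v₅, fun i j => if i ∈ Ki then none else hreply i j)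
  let reply : Fin N → Fin m → Option (Opening F n) := fun i j =>
    if i ∈ Ki then A.reply n v₆ i j else hreply i j
  let bad₂ : Finset (Fin N) := bad₁ ∪ Finset.univ.filter fun i =>
    ∃ j, vote j i = some true ∧ ¬ T.Opens (com i) j (reply i j)
  let input : Fin m → Fin N → Option (Opening F n) := fun j i =>
    if j ∈ Km then A.input n v₆ j i
    else if T.Opens (com i) j (opening i j) then opening i j
    else if T.Opens (com i) j (reply i j) then reply i j
    else none
  let out ← T.FTFM n bad₂ com input
  let v : T.View aux A.coins n := (v₆, out)
  let ann : Fin m → Option (T.Out n) := fun j => if j ∈ Km then A.announce n v j else some out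
  return ((restrict Kmᶜ fun _ => some out, restrict Kiᶜ fun _ => majorityValue ann), v)

theorem _root_.MPCAuction.Protocol.real_eq_execution [Fintype F] (b : Fin N → F)
    (z : Bits (aux n)) : T.real Km Ki A n b z =
      (PMF.uniformOfFintype (Bits (A.coins n))).bind fun ω =>
      (indep fun _ : Fin m => T.nizk.K n).bind fun h =>
      (indep fun i : Fin N => share (threshold m) T.pt (b i)).bind fun s =>
      (PMF.uniformOfFintype (Fin N → Fin m → Bits n)).bind fun r =>
      (indep fun i : Fin N => T.nizk.P n (A.crsVector Km (z, ω, h),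
        (i, fun j => T.commitTo n (s i j, r i j)), (b i, fun j => (s i j, r i j)))).bind fun π =>
      A.execution Km Ki (z, ω, h) (fun i j => (s i j, r i j)) π := rfl

/-- Commitments, and the openings that are shown to corrupted miners. -/
def shown (hop : Fin N → Fin m → Opening F n) :
    Fin N → Fin m → T.Com n × Opening F n :=
  fun i j => (T.commitTo n (hop i j), if j ∈ Km then hop i j else (0, zeroBits n))

/-- The bids of the corrupted identities, and the view before the outcome. -/
def result (e : A.Seed n) : (Fin N → F) × T.View₆ aux A.coins n :=
  (A.reconstructedBids Km Ki e, A.view₆ Km Ki e)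

/-- The last step of the ideal execution. -/
def finalize {n : ℕ} (b : Fin N → F) (x : (Fin N → F) × T.View₆ aux A.coins n) :
    PMF (T.HonestOut n × T.View aux A.coins n) :=
  (T.FMPC n fun i => if i ∈ Ki then x.1 i else b i).bind fun out =>
    PMF.pure ((restrict Kmᶜ fun _ => some out, restrict Kiᶜ fun _ => some out), (x.2, out))

/-- Honest identities are never excluded: their proofs are accepted by `hV`, and any complaint is
answered by a correct opening. Their bids are reconstructed as `b i`. What concerns the corrupted
identities depends on the seed alone, so the outcome is that of the ideal functionality on the
reconstructed corrupted bids. -/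
theorem execution_eq_finalize (hbinding : T.cs.PerfectlyBinding) (hKm : 2 * Km.card < m)
    (b : Fin N → F) (x : A.Base n) (hop : Fin N → Fin m → Opening F n)
    (hproof : Fin N → T.Proof n)
    (hshare : ∀ i, IsSharing (threshold m) T.pt (b i) fun j => (hop i j).1)
    (hV : ∀ i, T.nizk.V n (A.crsVector Km x, (i, fun j => T.commitTo n (hop i j)), hproof i)
      = true) :
    A.execution Km Ki x hop hproof =
      A.finalize Km Ki b (A.result Km Ki (x, shown Km hop, hproof)) := by
  unfold execution
  extract_lets v₁ crs hcom v₂ com v₃ proof bad₁ v₄ opening hvote v₅ vote hreply v₆ reply bad₂ input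
  set e : A.Seed n := (x, shown Km hop, hproof) with he
  have h3 : v₃ = A.view₃ Km Ki e := rfl
  have hcom_eq : ∀ i, com i = A.coms Km Ki e i := fun i => rfl
  have hcomD : ∀ i c, com i = some c → A.stmt Km Ki e i = (i, c) := by
    intro i c h
    rw [hcom_eq] at h
    simp [stmt, h]
  have hproof_eq : ∀ i, proof i = A.proofs Km Ki e i := fun i => rfl
  have hbad₁ : ∀ i, i ∈ bad₁ ↔ A.unproved Km Ki e i := by
    intro i
    simp only [bad₁, Finset.mem_filter, Finset.mem_univ, true_and, unproved]
    by_cases hi : i ∈ Ki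
    · simp only [hi, true_and, not_iff_not]
      constructor
      · rintro ⟨c, π, hc, hπ, hv⟩
        rw [← hcom_eq, ← hproof_eq, hcomD i c hc, hc, hπ]
        refine ⟨rfl, rfl, ?_⟩
        have : A.proofD Km Ki e i = π := by rw [proofD, ← hproof_eq, hπ]; rfl
        rw [this]
        exact hv
      · rintro ⟨hc, hπ, hv⟩
        rw [← hcom_eq] at hc
        rw [← hproof_eq] at hπ
        obtain ⟨c, hc⟩ := Option.isSome_iff_exists.1 hc
        obtain ⟨π, hπ⟩ := Option.isSome_iff_exists.1 hπ
        have : A.proofD Km Ki e i = π := by rw [proofD, ← hproof_eq, hπ]; rfl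
        rw [hcomD i c hc, this] at hv
        exact ⟨c, π, hc, hπ, hv⟩
    · simp only [hi, false_and, iff_false, not_not]
      exact ⟨hcom i, hproof i, if_neg hi, if_neg hi, hV i⟩
  -- The masking in `shown` keeps exactly the openings for corrupted miners, which are the only ones
  -- that enter the view.
  have h4 : v₄ = A.view₄ Km Ki e := by
    refine Prod.ext h3 ?_
    funext i j
    simp only [v₄, view₄, e, shown]
    by_cases hj : j ∈ Km
    · simp [hj]
    · simp [hj]
  have hopens : ∀ i ∉ Ki, ∀ j, T.Opens (com i) j (some (hop i j)) := fun i hi j =>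
    ⟨hcom i, hop i j, if_neg hi, rfl, rfl⟩
  have hopening : ∀ i ∈ Ki, opening i = A.opening n (A.view₄ Km Ki e) i := by
    intro i hi
    funext j
    simp only [opening, if_pos hi, h4]
  have hopening' : ∀ i ∉ Ki, ∀ j, opening i j = some (hop i j) := fun i hi j => if_neg hi
  have hvote_eq : ∀ j i, hvote j i = A.honestVote Km Ki e j i := by
    intro j i
    simp only [hvote, honestVote, hbad₁]
    by_cases hi : i ∈ Ki
    · simp only [hi, true_and, hopening i hi]
      rfl
    · simp only [hi, false_and, hopening' i hi, hopens i hi j, not_true_eq_false]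
  have h5 : v₅ = A.view₅ Km Ki e := by
    refine Prod.ext h4 ?_
    funext j i
    simp only [v₅, view₅, hvote_eq]
  have hvotes : ∀ j i, vote j i = A.votes Km Ki e j i := by
    intro j i
    simp only [vote, votes, hvote_eq, h5]
  -- For this reason replies of honest identities reveal no opening beyond those kept by `shown`.
  have hhonest : ∀ i ∉ Ki, ∀ j ∉ Km, A.votes Km Ki e j i ≠ some true := by
    intro i hi j hj
    simp [votes, hj, honestVote, hi]
  have h6 : v₆ = A.view₆ Km Ki e := by
    refine Prod.ext h5 ?_
    funext i j
    simp only [v₆, view₆, hreply, hvotes]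
    by_cases hi : i ∈ Ki
    · simp only [if_pos hi]
    · simp only [if_neg hi]
      by_cases hj : j ∈ Km
      · simp [hj, e, shown]
      · simp [hj, hhonest i hi j hj]
  have hreply_eq : ∀ i ∈ Ki, reply i = A.reply n (A.view₆ Km Ki e) i := by
    intro i hi
    funext j
    simp only [reply, if_pos hi, h6]
  have hbad₂ : ∀ i, i ∈ bad₂ ↔ i ∈ Ki ∧ A.excluded Km Ki e i := by
    intro i
    simp only [bad₂, Finset.mem_union, hbad₁, Finset.mem_filter, Finset.mem_univ, true_and,
      excluded, hvotes, hcom_eq]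
    by_cases hi : i ∈ Ki
    · simp only [hi, true_and, hreply_eq i hi]
    · simp only [hi, false_and, iff_false, not_or, not_exists, not_and, not_not]
      refine ⟨fun h => hi h.1, fun j hj => ?_⟩
      have : reply i j = some (hop i j) := by
        simp only [reply, if_neg hi, hreply, hvotes, if_pos hj]
      rw [this]
      exact hopens i hi j
  have hinput : ∀ i ∈ Ki, (fun j => input j i) = fun j => A.inputs Km Ki e j i := by
    intro i hi
    funext j
    simp only [input, inputs, h6, hopening i hi, hreply_eq i hi, hcom_eq]
  have hbids : (fun i => if i ∈ bad₂ then 0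
      else T.reconstructBid n (com i) fun j => input j i) =
      fun i => if i ∈ Ki then (A.result Km Ki e).1 i else b i := by
    funext i
    by_cases hi : i ∈ Ki
    · simp only [hbad₂, hi, true_and, if_true, result, reconstructedBids, corruptBids,
        hinput i hi, hcom_eq]
    · simp only [hbad₂, hi, false_and, if_false]
      have hc : com i = some (hcom i) := if_neg hi
      rw [hc]
      refine T.reconstructBid_eq hbinding hKm (x := (i, hcom i)) (w := (b i, hop i))
        ⟨fun j => rfl, hshare i⟩ fun j hj => ?_
      have ho := hopens i hi j
      have : input j i = some (hop i j) := by
        simp only [input, if_neg hj, hopening' i hi, if_pos ho]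
      rw [this, ← hc]
      exact ho
  unfold finalize FTFM FMPC
  rw [hbids]
  refine congrArg _ (funext fun out => ?_)
  refine congrArg PMF.pure (Prod.ext (Prod.ext rfl ?_) (Prod.ext h6 rfl))
  refine congrArg (restrict Kiᶜ) (funext fun _ => ?_)
  -- All honest miners announce `out`, and they are more than half of the miners.
  have hmaj := majority_compl hKm
  refine majorityValue_eq_some (lt_of_lt_of_le (b := 2 * Kmᶜ.card) (by omega)
    (Nat.mul_le_mul_left 2 (Finset.card_le_card fun j hj => ?_)))
  simp [Finset.mem_compl.1 hj]

end Adversary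

end Protocol

/-! ### Executions with fixed shares, and exchanging the distribution of the CRSes -/

theorem uniform_coins_eq_indep (k l n : ℕ) :
    PMF.uniformOfFintype (Fin k → Fin l → Bits n) =
      indep fun _ => indep fun _ => PMF.uniformOfFintype (Bits n) := by
  rw [uniform_eq_indep (α := Fin l → Bits n), uniform_eq_indep (α := Bits n)]

theorem PPT.uniform_coins {α : ℕ → Type} [∀ n, BitCode (α n)] (k l : ℕ) :
    PPT fun n (_ : α n) => PMF.uniformOfFintype (Fin k → Fin l → Bits n) := by
  simp only [uniform_coins_eq_indep]
  exact PPT.indep fun _ => PPT.indep fun _ => PPT.uniform_bits PolyBounded.id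

namespace Protocol

namespace Adversary

variable {F : Type} [Field F] [BitCode F] {m N : ℕ} {T : Protocol F m N} {aux : ℕ → ℕ}
  (A : T.Adversary aux) (Km : Finset (Fin m)) (Ki : Finset (Fin N)) {n : ℕ}

/-- The openings for given shares and coins. -/
def openings (s : Fin N → Fin m → F) (r : Fin N → Fin m → Bits n) :
    Fin N → Fin m → Opening F n :=
  fun i j => (s i j, r i j)

/-- The honest proof of identity `i`. -/
def honestProof (b : Fin N → F) (hop : Fin N → Fin m → Opening F n) (x : A.Base n) (i : Fin N) :
    PMF (T.Proof n) :=
  T.nizk.P n (A.crsVector Km x, (i, fun j => T.commitTo n (hop i j)), (b i, hop i))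

/-- The execution with fixed shares and a given distribution of the CRSes, up to the outcome. -/
def crsExperiment (G : PMF (Fin m → T.CRS n)) (z : Bits (aux n)) (b : Fin N → F)
    (s : Fin N → Fin m → F) : PMF ((Fin N → F) × T.View₆ aux A.coins n) :=
  G.bind fun h => (PMF.uniformOfFintype (Bits (A.coins n))).bind fun ω =>
    (PMF.uniformOfFintype (Fin N → Fin m → Bits n)).bind fun r =>
    (indep (A.honestProof Km b (openings s r) (z, ω, h))).bind fun π =>
    PMF.pure (A.result Km Ki ((z, ω, h), shown Km (openings s r), π))

variable [Fintype F]

/-- The shares of the bids `b` for given coefficients. -/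
def sharesOf (T : Protocol F m N) (b : Fin N → F) (a : Fin N → Fin (threshold m - 1) → F) :
    Fin N → Fin m → F :=
  fun i => shareOf T.pt (b i) (a i)

/-- Independent draws commute, so the sharing coefficients can be drawn first. The later hybrids are
then compared for each value of the coefficients separately. -/
theorem _root_.MPCAuction.Protocol.real_eq (hbinding : T.cs.PerfectlyBinding)
    (hcomplete : T.nizk.Complete T.Rel) (hKm : 2 * Km.card < m) (b : Fin N → F)
    (z : Bits (aux n)) : T.real Km Ki A n b z =
      ((PMF.uniformOfFintype (Fin N → Fin (threshold m - 1) → F)).bind fun a =>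
        A.crsExperiment Km Ki (indep fun _ => T.nizk.K n) z b (sharesOf T b a)).bind
        (A.finalize Km Ki b) := by
  rw [real_eq_execution]
  simp only [indep_share, PMF.bind_map, crsExperiment, PMF.bind_bind, PMF.pure_bind]
  rw [PMF.bind_comm]
  conv_rhs => rw [PMF.bind_comm]
  refine PMF.bind_congr_support fun h hh => ?_
  rw [PMF.bind_comm]
  refine PMF.bind_congr_support fun a _ => PMF.bind_congr_support fun ω _ =>
    PMF.bind_congr_support fun r _ => PMF.bind_congr_support fun π hπ => ?_
  have ht : 1 ≤ threshold m := by unfold threshold; omega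
  have hshare : ∀ i, IsSharing (threshold m) T.pt (b i) (sharesOf T b a i) := fun i =>
    isSharing_shareOf ht T.pt (b i) (a i)
  refine A.execution_eq_finalize Km Ki hbinding hKm b _ (openings (sharesOf T b a) r) π hshare
    fun i => ?_
  refine hcomplete n _ ?_ _ (b i, openings (sharesOf T b a) r i) ⟨fun j => rfl, hshare i⟩ _
    (mem_support_indep hπ i)
  refine (majority_compl hKm).trans (Finset.card_le_card fun j hj => ?_)
  have : A.crsVector Km (z, ω, h) j = h j := if_neg (Finset.mem_compl.1 hj)
  simp only [Finset.mem_filter, Finset.mem_univ, true_and, this]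
  exact mem_support_indep hh j

theorem polyTime_openings {α : ℕ → Type} [∀ n, BitCode (α n)] (s : ℕ → Fin N → Fin m → F)
    {r : ∀ n, α n → Fin N → Fin m → Bits n} (hr : PolyTime r) :
    PolyTime (β := fun n => Fin N → Fin m → Opening F n) fun n a => openings (s n) (r n a) :=
  PolyTime.pi (β := fun n => Fin m → Opening F n) fun i => PolyTime.pi fun j =>
    (PolyTime.const (β := fun _ => F) fun n => s n i j).pair ((hr.apply i).apply j)

theorem polyTime_commitments {α : ℕ → Type} [∀ n, BitCode (α n)]
    {o : ∀ n, α n → Fin N → Fin m → Opening F n} (ho : PolyTime o) (i : Fin N) :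
    PolyTime (β := fun n => Fin m → T.Com n) fun n a j => T.commitTo n (o n a i j) :=
  PolyTime.pi (β := T.Com) fun j => T.polyTime_commitTo ((ho.apply i).apply j)

theorem polyTime_shown {α : ℕ → Type} [∀ n, BitCode (α n)]
    {o : ∀ n, α n → Fin N → Fin m → Opening F n} (ho : PolyTime o) :
    PolyTime (β := fun n => Fin N → Fin m → T.Com n × Opening F n)
      fun n a => shown (T := T) Km (o n a) := by
  refine PolyTime.pi (β := fun n => Fin m → T.Com n × Opening F n) fun i => PolyTime.pi fun j =>
    (T.polyTime_commitTo ((ho.apply i).apply j)).pair ?_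
  by_cases hj : j ∈ Km
  · simpa only [if_pos hj] using (ho.apply i).apply j
  · simpa only [if_neg hj] using PolyTime.const fun _ => _

theorem ppt_honestProof {α : ℕ → Type} [∀ n, BitCode (α n)] (b : ℕ → Fin N → F)
    {o : ∀ n, α n → Fin N → Fin m → Opening F n} {x : ∀ n, α n → A.Base n} (ho : PolyTime o)
    (hx : PolyTime x) (i : Fin N) :
    PPT fun n a => A.honestProof Km (b n) (o n a) (x n a) i :=
  T.nizk.P_ppt.comp (((A.polyTime_crsVector Km).comp hx).pair
    (((PolyTime.const (β := fun _ => Fin N) fun _ => i).pair (polyTime_commitments ho i)).pair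
      ((PolyTime.const (β := fun _ => F) fun n => b n i).pair (ho.apply i))))

theorem polyTime_result : PolyTime fun n (e : A.Seed n) => A.result Km Ki e :=
  (A.polyTime_reconstructedBids Km Ki).pair (A.polyTime_view₆ Km Ki)

/-- All that follows the draw of the CRSes is PPT, with bids, shares and auxiliary input hardwired
as advice. -/
theorem crsExperiment_compIndist {G G' : ∀ n, PMF (Fin m → T.CRS n)} (h : CompIndist G G')
    (z : ∀ n, Bits (aux n)) (b : ℕ → Fin N → F) (s : ℕ → Fin N → Fin m → F) :
    CompIndist (fun n => A.crsExperiment Km Ki (G n) (z n) (b n) (s n))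
      (fun n => A.crsExperiment Km Ki (G' n) (z n) (b n) (s n)) := by
  refine h.bind (PPT.bind (PPT.uniform_bits A.coins_poly) (PPT.bind (PPT.uniform_coins N m)
    (PPT.bind (PPT.indep (A.ppt_honestProof Km b (polyTime_openings s PolyTime.id.snd) ?_))
      (PPT.pure ((A.polyTime_result Km Ki).comp ?_)))))
  · exact (PolyTime.const z).pair (PolyTime.id.fst.snd.pair PolyTime.id.fst.fst)
  · exact ((PolyTime.const z).pair (PolyTime.id.fst.fst.snd.pair PolyTime.id.fst.fst.fst)).pair
      ((polyTime_shown Km (polyTime_openings s PolyTime.id.fst.snd)).pair PolyTime.id.snd)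

/-- With the honest bids as advice, the last step can be absorbed into a distinguisher. It is thus
enough to compare the joint laws of the corrupted bids and the view before the outcome. -/
theorem ppt_finalize (b : ℕ → Fin N → F) :
    PPT fun n (x : (Fin N → F) × T.View₆ aux A.coins n) => A.finalize Km Ki (b n) x := by
  have h1 : PolyTime (β := fun _ => Fin N → F)
      fun n (x : (Fin N → F) × T.View₆ aux A.coins n) i => if i ∈ Ki then x.1 i else b n i := by
    refine PolyTime.pi (β := fun _ => F)
      (f := fun i n (x : (Fin N → F) × T.View₆ aux A.coins n) => if i ∈ Ki then x.1 i else b n i)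
      fun i => ?_
    by_cases hi : i ∈ Ki
    · simpa only [if_pos hi] using PolyTime.id.fst.apply i
    · simpa only [if_neg hi] using PolyTime.const (β := fun _ => F) fun n => b n i
  have h2 : PolyTime fun n (x : ((Fin N → F) × T.View₆ aux A.coins n) × T.Out n) => some x.2 :=
    PolyTime.id.snd.some
  exact PPT.bind (PPT.comp (β := fun _ => Fin N → F) T.mech.rule_ppt h1)
    (PPT.pure (((PolyTime.restrict _ fun _ => h2).pair (PolyTime.restrict _ fun _ => h2)).pair
      (PolyTime.id.fst.snd.pair PolyTime.id.snd)))

end Adversary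

end Protocol

/-! ### Simulated proofs by zero knowledge -/

theorem polyTime_keysOf {α C K : ℕ → Type} [∀ n, BitCode (α n)] [∀ n, BitCode (C n)]
    [∀ n, BitCode (K n)] {m q : ℕ} (hC : PolyLength C) (hK : PolyLength K)
    {gen : ∀ n, α n → Fin q → C n × K n} {crs : ∀ n, α n → Fin m → C n} (hgen : PolyTime gen)
    (hcrs : PolyTime crs) :
    PolyTime (β := fun n => Fin m → Option (K n)) fun n a => keysOf (gen n a) (crs n a) := by
  refine PolyTime.pi (β := fun n => Option (K n)) (f := fun j n a => keysOf (gen n a) (crs n a) j)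
    fun j => ?_
  have hc := hcrs.apply j
  unfold keysOf
  clear hcrs
  induction q with
  | zero => simpa using PolyTime.const (β := fun n => Option (K n)) fun _ => none
  | succ q ih =>
    have htail : PolyTime (β := fun n => Fin q → C n × K n) fun n a i => gen n a i.succ :=
      PolyTime.pi (β := fun n => C n × K n) fun i => hgen.apply i.succ
    have h0 := hgen.apply 0
    have := PolyTime.ite hK.option (PolyPred.eq hC h0.fst hc) h0.snd.some (ih htail)
    convert this using 3 with n a
    rw [List.ofFn_succ, List.find?_cons]
    by_cases h : (gen n a 0).1 = crs n a j <;> simp [h]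

theorem NIZK.zkGame_eq_bind {m : ℕ} {Stmt Wit : ℕ → Type} [∀ n, BitCode (Stmt n)]
    [∀ n, BitCode (Wit n)] (Z : NIZK m Stmt Wit) (R : ∀ n, Stmt n → Wit n → Prop)
    (A : Z.ZKAdversary) (simulated : Bool) (n : ℕ) : Z.zkGame R A simulated n =
      (indep fun _ : Fin (A.queries n) => Z.simK n).bind fun g => (A.choose n g).bind fun o =>
      (if simulated = true then Z.simP n (o.1, keysOf g o.1, o.2.1)
        else Z.P n (o.1, o.2.1, o.2.2.1)).bind fun π =>
      (A.guess n (o.2.2.2, π)).bind fun g => PMF.pure (g && decide (R n o.2.1 o.2.2.1)) := by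
  cases simulated <;> rfl

namespace Protocol

namespace Adversary

variable {F : Type} [Field F] [BitCode F] {m N : ℕ} {T : Protocol F m N} {aux : ℕ → ℕ}
  (A : T.Adversary aux) (Km : Finset (Fin m)) (Ki : Finset (Fin N)) {n : ℕ}

/-- The simulated proof of identity `i`. -/
def simulatedProof (keys : Fin m → Option (T.nizk.Trap n))
    (c : Fin N → Fin m → T.Com n × Opening F n) (x : A.Base n) (i : Fin N) : PMF (T.Proof n) :=
  T.nizk.simP n (A.crsVector Km x, keys, (i, fun j => (c i j).1))

/-- Simulated proofs of the identities before `k`, honest proofs of the others. -/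
def hybridProof (k : ℕ) (b : Fin N → F) (hop : Fin N → Fin m → Opening F n)
    (keys : Fin m → Option (T.nizk.Trap n)) (x : A.Base n) (i : Fin N) : PMF (T.Proof n) :=
  if i.val < k then A.simulatedProof Km keys (shown Km hop) x i else A.honestProof Km b hop x i

/-- The execution with fixed shares, simulated CRSes, and simulated proofs of the identities
before `k`. -/
def proofExperiment (k : ℕ) (z : Bits (aux n)) (b : Fin N → F) (s : Fin N → Fin m → F) :
    PMF ((Fin N → F) × T.View₆ aux A.coins n) :=
  (indep fun _ : Fin m => T.nizk.simK n).bind fun g =>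
    (PMF.uniformOfFintype (Bits (A.coins n))).bind fun ω =>
    (PMF.uniformOfFintype (Fin N → Fin m → Bits n)).bind fun r =>
    (indep (A.hybridProof Km k b (openings s r)
      (keysOf g (A.crsVector Km (z, ω, fun j => (g j).1))) (z, ω, fun j => (g j).1))).bind fun π =>
    PMF.pure (A.result Km Ki ((z, ω, fun j => (g j).1), shown Km (openings s r), π))

/-- For `k = 0` the trapdoors are drawn, but no proof uses them. -/
theorem crsExperiment_simulated (z : Bits (aux n)) (b : Fin N → F) (s : Fin N → Fin m → F) :
    A.crsExperiment Km Ki (indep fun _ => (T.nizk.simK n).map Prod.fst) z b s =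
      A.proofExperiment Km Ki 0 z b s := by
  rw [indep_map, crsExperiment, PMF.bind_map]
  rfl

theorem majorityGenerated_crsVector (hKm : 2 * Km.card < m) (z : Bits (aux n))
    (ω : Bits (A.coins n)) (g : Fin m → T.CRS n) :
    MajorityGenerated g (A.crsVector Km (z, ω, g)) := by
  refine (majority_compl hKm).trans (Finset.card_le_card fun j hj => ?_)
  simp only [Finset.mem_filter, Finset.mem_univ, true_and]
  exact ⟨j, (if_neg (Finset.mem_compl.1 hj)).symm⟩

theorem polyLength_trap : PolyLength T.nizk.Trap := PolyLength.bits T.nizk.trapLen_poly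

variable [Fintype F]

theorem ppt_simulatedProof {α : ℕ → Type} [∀ n, BitCode (α n)]
    {keys : ∀ n, α n → Fin m → Option (T.nizk.Trap n)}
    {c : ∀ n, α n → Fin N → Fin m → T.Com n × Opening F n} {x : ∀ n, α n → A.Base n}
    (hkeys : PolyTime keys) (hc : PolyTime c) (hx : PolyTime x) (i : Fin N) :
    PPT fun n a => A.simulatedProof Km (keys n a) (c n a) (x n a) i :=
  T.nizk.simP_ppt.comp (((A.polyTime_crsVector Km).comp hx).pair (hkeys.pair
    ((PolyTime.const (β := fun _ => Fin N) fun _ => i).pair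
      (PolyTime.pi (β := T.Com) fun j => ((hc.apply i).apply j).fst))))

theorem ppt_hybridProof {α : ℕ → Type} [∀ n, BitCode (α n)] (k : ℕ) (b : ℕ → Fin N → F)
    {o : ∀ n, α n → Fin N → Fin m → Opening F n}
    {keys : ∀ n, α n → Fin m → Option (T.nizk.Trap n)} {x : ∀ n, α n → A.Base n}
    (ho : PolyTime o) (hkeys : PolyTime keys) (hx : PolyTime x) (i : Fin N) :
    PPT fun n a => A.hybridProof Km k (b n) (o n a) (keys n a) (x n a) i := by
  unfold hybridProof
  by_cases h : i.val < k
  · simpa only [if_pos h] using A.ppt_simulatedProof Km hkeys (polyTime_shown Km ho) hx i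
  · simpa only [if_neg h] using A.ppt_honestProof Km b ho hx i

/-- The adversary against zero knowledge that has the proof of identity `i` as its challenge. -/
def zkAdversary (haux : PolyBounded aux) (z : ∀ n, Bits (aux n)) (b : ℕ → Fin N → F)
    (s : ℕ → Fin N → Fin m → F) (i : Fin N)
    {D : ∀ n, (Fin N → F) × T.View₆ aux A.coins n → PMF Bool} (hD : PPT D) :
    T.nizk.ZKAdversary where
  State := A.Seed
  state_poly := A.polyLength_seed haux
  queries _ := m
  queries_poly := PolyBounded.const m
  choose n g := (PMF.uniformOfFintype (Bits (A.coins n))).bind fun ω =>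
    (PMF.uniformOfFintype (Fin N → Fin m → Bits n)).bind fun r =>
    (indep (A.hybridProof Km i (b n) (openings (s n) r)
      (keysOf g (A.crsVector Km (z n, ω, fun j => (g j).1)))
      (z n, ω, fun j => (g j).1))).bind fun π =>
    PMF.pure (A.crsVector Km (z n, ω, fun j => (g j).1),
      (i, fun j => T.commitTo n (openings (s n) r i j)), (b n i, openings (s n) r i),
      ((z n, ω, fun j => (g j).1), shown Km (openings (s n) r), π))
  guess n x := D n (A.result Km Ki (x.1.1, x.1.2.1, Function.update x.1.2.2 i x.2))
  choose_ppt := by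
    have hg : PolyTime (α := fun n => (((Fin m → T.nizk.CRS n × T.nizk.Trap n) ×
        Bits (A.coins n)) × (Fin N → Fin m → Bits n))) (β := A.Base)
        fun n x => (z n, x.1.2, fun j => (x.1.1 j).1) :=
      (PolyTime.const z).pair (PolyTime.id.fst.snd.pair
        (PolyTime.pi (β := T.CRS) fun j => (PolyTime.id.fst.fst.apply j).fst))
    have hx := (A.polyTime_crsVector Km).comp hg
    have ho : PolyTime (α := fun n => (((Fin m → T.nizk.CRS n × T.nizk.Trap n) ×
        Bits (A.coins n)) × (Fin N → Fin m → Bits n)))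
        (β := fun n => Fin N → Fin m → Opening F n) fun n x => openings (s n) x.2 :=
      polyTime_openings s PolyTime.id.snd
    refine PPT.bind (PPT.uniform_bits A.coins_poly) (PPT.bind (PPT.uniform_coins N m)
      (PPT.bind (PPT.indep (A.ppt_hybridProof Km i b ho (polyTime_keysOf T.polyLength_crs
        polyLength_trap PolyTime.id.fst.fst hx) hg)) (PPT.pure ?_)))
    have h1 := hx.comp (PolyTime.fst (PolyTime.id (α := fun n =>
      (((Fin m → T.nizk.CRS n × T.nizk.Trap n) × Bits (A.coins n)) ×
        (Fin N → Fin m → Bits n)) × (Fin N → T.Proof n))))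
    have h2 := ho.comp (PolyTime.fst (PolyTime.id (α := fun n =>
      (((Fin m → T.nizk.CRS n × T.nizk.Trap n) × Bits (A.coins n)) ×
        (Fin N → Fin m → Bits n)) × (Fin N → T.Proof n))))
    exact h1.pair (((PolyTime.const (β := fun _ => Fin N) fun _ => i).pair
      (polyTime_commitments h2 i)).pair (((PolyTime.const (β := fun _ => F) fun n => b n i).pair
        (h2.apply i)).pair ((hg.comp PolyTime.id.fst).pair
          ((polyTime_shown Km h2).pair PolyTime.id.snd))))
  guess_ppt := by
    refine hD.comp ((A.polyTime_result Km Ki).comp (PolyTime.id.fst.fst.pair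
      (PolyTime.id.fst.snd.fst.pair ?_)))
    refine PolyTime.pi (β := T.Proof)
      (f := fun j n (x : A.Seed n × T.Proof n) => Function.update x.1.2.2 i x.2 j) fun j => ?_
    by_cases h : j = i
    · subst h
      simpa only [Function.update_self] using PolyTime.id.snd
    · simpa only [Function.update_of_ne h] using PolyTime.id.fst.snd.snd.apply j

theorem zkAdversary_minorityConstrained (hKm : 2 * Km.card < m) (haux : PolyBounded aux)
    (z : ∀ n, Bits (aux n)) (b : ℕ → Fin N → F) (s : ℕ → Fin N → Fin m → F) (i : Fin N)
    {D : ∀ n, (Fin N → F) × T.View₆ aux A.coins n → PMF Bool} (hD : PPT D) :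
    (A.zkAdversary Km Ki haux z b s i hD).MinorityConstrained := by
  intro n gen o ho
  obtain ⟨ω, -, ho⟩ := (PMF.mem_support_bind_iff _ _ _).1 ho
  obtain ⟨r, -, ho⟩ := (PMF.mem_support_bind_iff _ _ _).1 ho
  obtain ⟨π, -, ho⟩ := (PMF.mem_support_bind_iff _ _ _).1 ho
  rw [(PMF.mem_support_pure_iff _ _).1 ho]
  exact A.majorityGenerated_crsVector Km hKm (z n) ω fun j => (gen j).1

/-- The challenge is the only proof in which hybrids `i` and `i + 1` differ, and overwriting one
coordinate of an independent family is resampling it (`indep_update`). The relation holds for the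
chosen statement by `hs`, so the validity test in the game is vacuous. -/
theorem zkGame_zkAdversary (haux : PolyBounded aux) (z : ∀ n, Bits (aux n)) (b : ℕ → Fin N → F)
    (s : ℕ → Fin N → Fin m → F) (hs : ∀ n i, IsSharing (threshold m) T.pt (b n i) (s n i))
    (i : Fin N) {D : ∀ n, (Fin N → F) × T.View₆ aux A.coins n → PMF Bool} (hD : PPT D)
    (simulated : Bool) (n : ℕ) :
    T.nizk.zkGame T.Rel (A.zkAdversary Km Ki haux z b s i hD) simulated n =
      (A.proofExperiment Km Ki (if simulated = true then i + 1 else i) (z n) (b n) (s n)).bind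
        (D n) := by
  have hR : ∀ r : Fin N → Fin m → Bits n,
      T.Rel n (i, fun j => T.commitTo n (openings (s n) r i j)) (b n i, openings (s n) r i) :=
    fun r => ⟨fun j => rfl, hs n i⟩
  rw [NIZK.zkGame_eq_bind]
  simp only [zkAdversary, proofExperiment, PMF.bind_bind, PMF.pure_bind, hR, decide_true,
    Bool.and_true, PMF.bind_pure]
  refine congrArg _ (funext fun g => congrArg _ (funext fun ω => congrArg _ (funext fun r => ?_)))
  set x : A.Base n := (z n, ω, fun j => (g j).1)
  set q := if simulated = true then A.simulatedProof Km (keysOf g (A.crsVector Km x))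
    (shown Km (openings (s n) r)) x i else A.honestProof Km (b n) (openings (s n) r) x i with hq
  -- Both hybrids agree off coordinate `i`, where the law is replaced by that of the challenge `q`.
  have hp : A.hybridProof Km (if simulated = true then i + 1 else i) (b n) (openings (s n) r)
      (keysOf g (A.crsVector Km x)) x = Function.update (A.hybridProof Km i (b n)
        (openings (s n) r) (keysOf g (A.crsVector Km x)) x) i q := by
    funext j
    by_cases hj : j = i
    · subst hj
      rw [Function.update_self, hybridProof]
      cases simulated <;> simp [hq]
    · have hj' : j.val ≠ i.val := fun h => hj (Fin.ext h)
      rw [Function.update_of_ne hj, hybridProof, hybridProof]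
      cases simulated
      · rfl
      · have : (j.val < i.val + 1) ↔ j.val < i.val := by omega
        simp only [if_true, this]
  rw [hp, indep_update, PMF.bind_bind]
  simp only [PMF.bind_map]
  rw [PMF.bind_comm]
  have hq' : q = if simulated = true then T.nizk.simP n (A.crsVector Km x,
      keysOf g (A.crsVector Km x), (i, fun j => T.commitTo n (openings (s n) r i j)))
      else T.nizk.P n (A.crsVector Km x, (i, fun j => T.commitTo n (openings (s n) r i j)),
        (b n i, openings (s n) r i)) := rfl
  rw [hq']
  rfl

/-- One zero-knowledge reduction per identity; `N` is fixed, so the sum of the advantages stays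
negligible. -/
theorem proofExperiment_compIndist (hzk : T.nizk.ZeroKnowledge T.Rel) (hKm : 2 * Km.card < m)
    (haux : PolyBounded aux) (z : ∀ n, Bits (aux n)) (b : ℕ → Fin N → F)
    (s : ℕ → Fin N → Fin m → F) (hs : ∀ n i, IsSharing (threshold m) T.pt (b n i) (s n i)) :
    CompIndist (fun n => A.proofExperiment Km Ki 0 (z n) (b n) (s n))
      (fun n => A.proofExperiment Km Ki N (z n) (b n) (s n)) := by
  refine CompIndist.iterate (H := fun k n => A.proofExperiment Km Ki k (z n) (b n) (s n))
    fun k hk D hD => ?_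
  have h := hzk.2 (A.zkAdversary Km Ki haux z b s ⟨k, hk⟩ hD)
    (A.zkAdversary_minorityConstrained Km Ki hKm haux z b s ⟨k, hk⟩ hD)
  simpa only [A.zkGame_zkAdversary Km Ki haux z b s hs ⟨k, hk⟩ hD, if_true, Bool.false_eq_true,
    if_false] using h

/-- Real CRSes and proofs can be replaced by simulated ones. -/
theorem crsExperiment_compIndist_proofExperiment (hzk : T.nizk.ZeroKnowledge T.Rel)
    (hKm : 2 * Km.card < m) (haux : PolyBounded aux) (z : ∀ n, Bits (aux n))
    (b : ℕ → Fin N → F) (s : ℕ → Fin N → Fin m → F)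
    (hs : ∀ n i, IsSharing (threshold m) T.pt (b n i) (s n i)) :
    CompIndist (fun n => A.crsExperiment Km Ki (indep fun _ => T.nizk.K n) (z n) (b n) (s n))
      (fun n => A.proofExperiment Km Ki N (z n) (b n) (s n)) := by
  have hsim : PPTSampler fun n => (T.nizk.simK n).map Prod.fst :=
    PPT.map (α := fun _ => Fin 0 → Bool) (f := fun n _ => T.nizk.simK n)
      (g := fun _ _ x => x.1) T.nizk.simK_ppt PolyTime.id.snd.fst
  have h := A.crsExperiment_compIndist Km Ki (CompIndist.indep (fun _ : Fin m => T.nizk.K_ppt)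
    (fun _ => hsim) fun _ => hzk.1) z b s
  simp only [crsExperiment_simulated] at h
  exact h.trans (A.proofExperiment_compIndist Km Ki hzk hKm haux z b s hs)

end Adversary

end Protocol

/-! ### Extraction of corrupted bids by simulation soundness -/

/-- Selecting an entry of a tuple of fixed length. -/
theorem PolyTime.select {α β : ℕ → Type} [∀ n, BitCode (α n)] [∀ n, BitCode (β n)] {k : ℕ}
    {i : ∀ n, α n → Fin k} {f : ∀ n, α n → Fin k → β n} (hβ : PolyLength β)
    (hi : PolyTime (β := fun _ => Fin k) i) (hf : PolyTime f) :
    PolyTime fun n a => f n a (i n a) := by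
  refine comp (β := fun n => Fin k × (Fin k → β n)) (g := fun n x => x.2 x.1) ?_ (hi.pair hf)
  obtain ⟨s, hs⟩ := ComputableInSize.of_finite (Fin k × (Fin k → Bool)) Bool
  obtain ⟨G, hG, e⟩ := computableInSize_iff.1 (hs fun x => x.2 x.1)
  refine polyTime_iff.2 ⟨_, PolyBounded.mul hβ (PolyBounded.const s), fun n =>
    computableInSize_iff.2 ⟨_, HasSize.family (W := BitCode.Wire (β n))
      (g := fun x w => G (x ∘ Sum.map (_root_.id : Fin k → Fin k) fun p : Fin k × Unit => (p.1, w)) ())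
      fun w => (hG.mapIn (Sum.map (_root_.id : Fin k → Fin k)
        fun p : Fin k × Unit => (p.1, w))).mapOut fun _ => (), ?_⟩⟩
  rintro ⟨i, y⟩
  funext w
  have h := congrFun (e (i, fun j => BitCode.bits (y j) w)) ()
  refine Eq.trans (congrFun (congrArg G ?_) ()) h
  funext v
  rcases v with v | v <;> rfl

namespace NIZK

variable {m : ℕ} {Stmt Wit : ℕ → Type} [∀ n, BitCode (Stmt n)] [∀ n, BitCode (Wit n)]
  (Z : NIZK m Stmt Wit)

theorem proveLoop_succ {ekLen : ℕ → ℕ} (A : Z.SSEAdversary ekLen) (n : ℕ)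
    (crs : Fin m → Z.CRS n) (trap : Fin m → Option (Z.Trap n)) (k : ℕ) (st : A.State n)
    (log : List (Stmt n × Z.Proof n)) : Z.proveLoop A n crs trap (k + 1) st log =
      (A.ask n st).bind fun o => (Z.simP n (crs, trap, o.1)).bind fun π =>
      (A.receive n (o.2, π)).bind fun st => Z.proveLoop A n crs trap k st ((o.1, π) :: log) := rfl

theorem sseGame_eq_bind (R : ∀ n, Stmt n → Wit n → Prop) {ekLen : ℕ → ℕ}
    (K₀ : ∀ n, PMF (Z.CRS n × Z.Trap n × Bits (ekLen n)))
    (E : ∀ n, (Fin m → Z.CRS n) × (Fin m → Option (Bits (ekLen n))) × Stmt n × Z.Proof n →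
      PMF (Wit n)) (A : Z.SSEAdversary ekLen) (n : ℕ) : Z.sseGame R K₀ E A n =
      (indep fun _ : Fin (A.queries n) => K₀ n).bind fun g =>
      (A.choose n fun k => ((g k).1, (g k).2.2)).bind fun c =>
      (Z.proveLoop A n c.1 (keysOf (fun k => ((g k).1, (g k).2.1)) c.1) (A.proofs n) c.2 []).bind
      fun o => (A.finish n o.1).bind fun y =>
      (E n (c.1, keysOf (fun k => ((g k).1, (g k).2.2)) c.1, y.1, y.2)).bind fun w =>
      PMF.pure (decide ((y.1, y.2) ∉ o.2 ∧ ¬ R n y.1 w ∧ Z.V n (c.1, y.1, y.2) = true)) := rfl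

end NIZK

namespace Protocol

namespace Adversary

variable {F : Type} [Field F] [BitCode F] {m N : ℕ} {T : Protocol F m N} {aux : ℕ → ℕ}
  (A : T.Adversary aux) (Km : Finset (Fin m)) (Ki : Finset (Fin N)) {n : ℕ}

/-- The type of knowledge extractors. -/
abbrev Extractor (T : Protocol F m N) (ekLen : ℕ → ℕ) : Type :=
  ∀ n, (Fin m → T.CRS n) × (Fin m → Option (Bits (ekLen n))) × ShareStmt N m T.cs n × T.Proof n →
    PMF (ShareWit F m n)

/-- Simulated executions: the commitments and openings come from `C`, the CRSes from `K₀`, proofs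
are simulated, and witnesses are extracted from the proofs of all identities; `Q` maps the
seed and the witnesses to the result. -/
def simulation {α : Type} {ekLen : ℕ → ℕ} (K₀ : PMF (T.CRS n × T.nizk.Trap n × Bits (ekLen n)))
    (C : PMF (Fin N → Fin m → T.Com n × Opening F n)) (z : Bits (aux n))
    (Q : (Fin m → Option (Bits (ekLen n))) → A.Seed n → PMF α) : PMF α :=
  (indep fun _ : Fin m => K₀).bind fun g =>
    (PMF.uniformOfFintype (Bits (A.coins n))).bind fun ω => C.bind fun c =>
    (indep (A.simulatedProof Km (keysOf (fun k => ((g k).1, (g k).2.1))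
      (A.crsVector Km (z, ω, fun j => (g j).1))) c (z, ω, fun j => (g j).1))).bind fun π =>
    Q (keysOf (fun k => ((g k).1, (g k).2.2)) (A.crsVector Km (z, ω, fun j => (g j).1)))
      ((z, ω, fun j => (g j).1), c, π)

/-- The witness extracted from the proof of identity `i`. -/
def extracted {ekLen : ℕ → ℕ} (E : Extractor T ekLen) (ek : Fin m → Option (Bits (ekLen n)))
    (e : A.Seed n) (i : Fin N) : PMF (ShareWit F m n) :=
  E n (A.crsVector Km e.1, ek, A.stmt Km Ki e i, A.proofD Km Ki e i)

/-- The proof of identity `i` is accepted, but `w` is not a witness. -/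
def extractionFails (e : A.Seed n) (i : Fin N) (w : ShareWit F m n) : Prop :=
  ¬ T.Rel n (A.stmt Km Ki e i) w ∧
    T.nizk.V n (A.crsVector Km e.1, A.stmt Km Ki e i, A.proofD Km Ki e i) = true

/-- The result, with extracted bids. -/
def extractedResult {ekLen : ℕ → ℕ} (E : Extractor T ekLen)
    (ek : Fin m → Option (Bits (ekLen n))) (e : A.Seed n) :
    PMF ((Fin N → F) × T.View₆ aux A.coins n) :=
  (indep (A.extracted Km Ki E ek e)).bind fun w =>
    PMF.pure (A.corruptBids Km Ki e fun i => (w i).1, A.view₆ Km Ki e)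

theorem proofExperiment_eq_simulation {ekLen : ℕ → ℕ}
    {K₀ : PMF (T.CRS n × T.nizk.Trap n × Bits (ekLen n))}
    (hK₀ : K₀.map (fun s => (s.1, s.2.1)) = T.nizk.simK n) (z : Bits (aux n)) (b : Fin N → F)
    (s : Fin N → Fin m → F) : A.proofExperiment Km Ki N z b s =
      A.simulation Km K₀ ((PMF.uniformOfFintype (Fin N → Fin m → Bits n)).map
        fun r => shown Km (openings s r)) z fun _ e => PMF.pure (A.result Km Ki e) := by
  have h : ∀ hop (keys : Fin m → Option (T.nizk.Trap n)) (x : A.Base n), A.hybridProof Km N b hop keys x =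
      A.simulatedProof Km keys (shown Km hop) x := fun hop keys x =>
    funext fun i => if_pos i.isLt
  unfold proofExperiment simulation
  simp only [← hK₀, indep_map, PMF.bind_map, h]
  rfl

/-- Union bound: with all samples coupled, the results can differ only if extraction fails for some
corrupted identity. Each summand will be recognised as the winning probability of an adversary
against extraction. -/
theorem abs_prTrue_simulation_sub_le (hbinding : T.cs.PerfectlyBinding) (hKm : 2 * Km.card < m)
    {ekLen : ℕ → ℕ} (K₀ : PMF (T.CRS n × T.nizk.Trap n × Bits (ekLen n)))
    (E : Extractor T ekLen) (C : PMF (Fin N → Fin m → T.Com n × Opening F n)) (z : Bits (aux n))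
    (D : (Fin N → F) × T.View₆ aux A.coins n → PMF Bool) :
    |prTrue ((A.simulation Km K₀ C z fun _ e => PMF.pure (A.result Km Ki e)).bind D) -
        prTrue ((A.simulation Km K₀ C z (A.extractedResult Km Ki E)).bind D)| ≤
      ∑ i ∈ Ki, prTrue (A.simulation Km K₀ C z fun ek e => (A.extracted Km Ki E ek e i).bind
        fun w => PMF.pure (decide (A.extractionFails Km Ki e i w))) := by
  unfold simulation
  simp only [PMF.bind_bind, PMF.pure_bind]
  refine abs_prTrue_bind_sub_le_sum Ki _ fun g => abs_prTrue_bind_sub_le_sum Ki _ fun ω =>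
    abs_prTrue_bind_sub_le_sum Ki _ fun c => abs_prTrue_bind_sub_le_sum Ki _ fun π => ?_
  set ek := keysOf (fun k => ((g k).1, (g k).2.2)) (A.crsVector Km (z, ω, fun j => (g j).1))
  set e : A.Seed n := ((z, ω, fun j => (g j).1), c, π)
  simp only [extractedResult, PMF.bind_bind, PMF.pure_bind]
  have h1 : ∀ i, (A.extracted Km Ki E ek e i).bind (fun w =>
      PMF.pure (decide (A.extractionFails Km Ki e i w))) =
      (indep (A.extracted Km Ki E ek e)).bind fun w =>
        PMF.pure (decide (A.extractionFails Km Ki e i (w i))) := by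
    intro i
    rw [← indep_map_apply (A.extracted Km Ki E ek e) i, PMF.bind_map]
    rfl
  simp only [h1]
  -- A dummy draw of the witnesses is added on the side that does not use them, so that the two
  -- sides can be compared witness by witness.
  rw [← PMF.bind_const (indep (A.extracted Km Ki E ek e)) (D (A.result Km Ki e))]
  refine abs_prTrue_bind_sub_le_sum Ki _ fun w => ?_
  have hnn : ∀ i ∈ Ki, 0 ≤ prTrue (PMF.pure (decide (A.extractionFails Km Ki e i (w i)))) :=
    fun i _ => prTrue_nonneg _
  by_cases h : ∃ i ∈ Ki, A.extractionFails Km Ki e i (w i)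
  · obtain ⟨i, hi, hf⟩ := h
    refine (abs_prTrue_sub_le_one _ _).trans (le_trans ?_ (Finset.single_le_sum hnn hi))
    simp [prTrue_pure, hf]
  · push Not at h
    have : A.result Km Ki e = (A.corruptBids Km Ki e fun i => (w i).1, A.view₆ Km Ki e) := by
      refine Prod.ext (A.reconstructedBids_eq_corruptBids Km Ki hbinding hKm e w
        fun i hi hV => ?_) rfl
      by_contra hR
      exact h i hi ⟨hR, hV⟩
    rw [this, sub_self, abs_zero]
    exact Finset.sum_nonneg hnn

/-- The state of the adversary against extraction: base, commitments, proofs so far. -/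
abbrev ProofState (n : ℕ) : Type :=
  A.Base n × (Fin N → Fin m → T.Com n × Opening F n) × (Fin N → Option (T.Proof n))

/-- An honest identity whose proof is still missing. -/
def nextIdentity (i₀ : Fin N) (present : Fin N → Bool) : Fin N :=
  if h : ∃ i, i ∉ Ki ∧ present i = false then h.choose else i₀

/-- The proof loop carries no counter: progress is read off the proofs present in the state, so
`ask` and `receive` agree on the identity in question. The fallback `i₀` only makes the function
total. -/
def next (i₀ : Fin N) (st : A.ProofState n) : Fin N :=
  nextIdentity Ki i₀ fun i => (st.2.2 i).isSome

theorem next_spec (i₀ : Fin N) {st : A.ProofState n} (h : ∃ i, i ∉ Ki ∧ st.2.2 i = none) :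
    A.next Ki i₀ st ∉ Ki ∧ st.2.2 (A.next Ki i₀ st) = none := by
  have h' : ∃ i, i ∉ Ki ∧ (st.2.2 i).isSome = false := by simpa using h
  have := h'.choose_spec
  unfold next nextIdentity
  rw [dif_pos h']
  simpa using this

theorem polyTime_next (i₀ : Fin N) : PolyTime (β := fun _ => Fin N)
    fun n (st : A.ProofState n) => A.next Ki i₀ st :=
  PolyTime.of_finite (Fin N → Bool) (Fin N) (fun _ p => nextIdentity Ki i₀ p)
    (PolyTime.pi (β := fun _ => Bool) fun i => (PolyTime.id.snd.snd.apply i).isSome)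

/-- The seed with the proofs of a state. -/
def seedOf (st : A.ProofState n) : A.Seed n :=
  (st.1, st.2.1, fun i => (st.2.2 i).getD (zeroBits _))

theorem polyTime_seedOf : PolyTime fun n (st : A.ProofState n) => A.seedOf st :=
  PolyTime.id.fst.pair (PolyTime.id.snd.fst.pair (PolyTime.pi (β := T.Proof) fun i =>
    (PolyTime.id.snd.snd.apply i).getD T.polyLength_proof (PolyTime.const fun _ => _)))

/-- The view of the adversary contains only proofs of honest identities. Hence a reduction that has
asked for these alone computes the same corrupted proof as the full simulation, which draws one for
every identity. -/
theorem proofD_congr {i : Fin N} (hi : i ∈ Ki) (x : A.Base n)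
    (c : Fin N → Fin m → T.Com n × Opening F n) {π π' : Fin N → T.Proof n}
    (h : ∀ i ∉ Ki, π i = π' i) : A.proofD Km Ki (x, c, π) i = A.proofD Km Ki (x, c, π') i := by
  have h3 : A.view₃ Km Ki (x, c, π) = A.view₃ Km Ki (x, c, π') := by
    refine Prod.ext rfl (funext fun j => ?_)
    simp only [view₃, restrict, Finset.mem_compl]
    split_ifs with hj
    · rfl
    · exact congrArg some (h j hj)
  simp only [proofD, proofs, if_pos hi, h3]

variable [Fintype F]

/-- The adversary against extraction that outputs the statement and the proof of the corrupted
identity `i₀`, after having asked for the proofs of all honest identities. -/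
def sseAdversary (haux : PolyBounded aux) (ekLen : ℕ → ℕ)
    {C : ∀ n, PMF (Fin N → Fin m → T.Com n × Opening F n)} (hC : PPTSampler C)
    (z : ∀ n, Bits (aux n)) (i₀ : Fin N) : T.nizk.SSEAdversary ekLen where
  State := A.ProofState
  state_poly := (A.polyLength_base haux).prod
    ((((T.polyLength_com.prod polyLength_opening).pi m).pi N).prod (T.polyLength_proof.option.pi N))
  queries _ := m
  queries_poly := PolyBounded.const m
  proofs _ := Kiᶜ.card
  proofs_poly := PolyBounded.const _
  choose n g := (PMF.uniformOfFintype (Bits (A.coins n))).bind fun ω => (C n).bind fun c =>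
    PMF.pure (A.crsVector Km (z n, ω, fun j => (g j).1),
      ((z n, ω, fun j => (g j).1), c, fun _ => none))
  ask n st := PMF.pure ((A.next Ki i₀ st, fun j => (st.2.1 (A.next Ki i₀ st) j).1), st)
  receive n x := PMF.pure (x.1.1, x.1.2.1,
    Function.update x.1.2.2 (A.next Ki i₀ x.1) (some x.2))
  finish n st := PMF.pure (A.stmt Km Ki (A.seedOf st) i₀, A.proofD Km Ki (A.seedOf st) i₀)
  choose_ppt := by
    refine PPT.bind (PPT.uniform_bits A.coins_poly) (PPT.bind (PPT.of_sampler hC) (PPT.pure ?_))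
    have hg : PolyTime (α := fun n => ((Fin m → T.CRS n × Bits (ekLen n)) × Bits (A.coins n)) ×
        (Fin N → Fin m → T.Com n × Opening F n)) (β := A.Base)
        fun n x => (z n, x.1.2, fun j => (x.1.1 j).1) :=
      (PolyTime.const z).pair (PolyTime.id.fst.snd.pair
        (PolyTime.pi (β := T.CRS) fun j => (PolyTime.id.fst.fst.apply j).fst))
    exact ((A.polyTime_crsVector Km).comp hg).pair (hg.pair (PolyTime.id.snd.pair
      (PolyTime.const (β := fun n => Fin N → Option (T.Proof n)) fun _ _ => none)))
  ask_ppt := by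
    refine PPT.pure (((A.polyTime_next Ki i₀).pair (PolyTime.pi (β := T.Com) fun j => ?_)).pair
      PolyTime.id)
    exact PolyTime.fst (PolyTime.apply (PolyTime.select ((T.polyLength_com.prod
      polyLength_opening).pi m) (A.polyTime_next Ki i₀) PolyTime.id.snd.fst) j)
  receive_ppt := by
    refine PPT.pure (PolyTime.id.fst.fst.pair (PolyTime.id.fst.snd.fst.pair
      (PolyTime.pi (β := fun n => Option (T.Proof n)) (f := fun i n
        (x : A.ProofState n × T.Proof n) =>
          Function.update x.1.2.2 (A.next Ki i₀ x.1) (some x.2) i) fun i => ?_)))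
    have h := PolyTime.ite T.polyLength_proof.option (PolyPred.eq (β := fun _ => Fin N)
      (PolyLength.fixed _) (PolyTime.const fun _ => i)
      ((A.polyTime_next Ki i₀).comp (PolyTime.fst (PolyTime.id
        (α := fun n => A.ProofState n × T.Proof n)))))
      PolyTime.id.snd.some (PolyTime.id.fst.snd.snd.apply i)
    convert h using 3 with n x
    rw [Function.update_apply]
  finish_ppt := PPT.pure (((A.polyTime_stmt Km Ki i₀).comp A.polyTime_seedOf).pair
    ((A.polyTime_proofD Km Ki i₀).comp A.polyTime_seedOf))

section ProveLoop

variable {Km Ki} {haux : PolyBounded aux} {ekLen : ℕ → ℕ}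
  {C : ∀ n, PMF (Fin N → Fin m → T.Com n × Opening F n)} {hC : PPTSampler C}
  {z : ∀ n, Bits (aux n)} {i₀ : Fin N}

theorem card_missing_update {p : Fin N → Option (T.Proof n)} {i : Fin N} (hi : i ∉ Ki)
    (hp : p i = none) (π : T.Proof n) {k : ℕ}
    (h : (Finset.univ.filter fun i => i ∉ Ki ∧ p i = none).card = k + 1) :
    (Finset.univ.filter fun j => j ∉ Ki ∧ Function.update p i (some π) j = none).card = k := by
  have : (Finset.univ.filter fun j => j ∉ Ki ∧ Function.update p i (some π) j = none) =
      (Finset.univ.filter fun i => i ∉ Ki ∧ p i = none).erase i := by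
    ext j
    by_cases hj : j = i
    · subst hj
      simp
    · simp [hj]
  rw [this, Finset.card_erase_of_mem (by simp [hi, hp]), h]
  rfl

theorem exists_missing {p : Fin N → Option (T.Proof n)} {k : ℕ}
    (h : (Finset.univ.filter fun i => i ∉ Ki ∧ p i = none).card = k + 1) :
    ∃ i, i ∉ Ki ∧ p i = none := by
  obtain ⟨i, hi⟩ := Finset.card_pos.1 (by omega :
    0 < (Finset.univ.filter fun i => i ∉ Ki ∧ p i = none).card)
  exact ⟨i, by simpa using hi⟩

theorem proveLoop_sseAdversary_succ (crs : Fin m → T.CRS n)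
    (trap : Fin m → Option (T.nizk.Trap n)) (x : A.Base n)
    (c : Fin N → Fin m → T.Com n × Opening F n) (k : ℕ) (p : Fin N → Option (T.Proof n))
    (log : List (ShareStmt N m T.cs n × T.Proof n)) :
    T.nizk.proveLoop (A.sseAdversary Km Ki haux ekLen hC z i₀) n crs trap (k + 1) (x, c, p) log =
      (T.nizk.simP n (crs, trap, (A.next Ki i₀ (x, c, p),
        fun j => (c (A.next Ki i₀ (x, c, p)) j).1))).bind fun π =>
      T.nizk.proveLoop (A.sseAdversary Km Ki haux ekLen hC z i₀) n crs trap k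
        (x, c, Function.update p (A.next Ki i₀ (x, c, p)) (some π))
        (((A.next Ki i₀ (x, c, p), fun j => (c (A.next Ki i₀ (x, c, p)) j).1), π) :: log) := by
  refine (NIZK.proveLoop_succ T.nizk (A.sseAdversary Km Ki haux ekLen hC z i₀) n crs trap k
    (x, c, p) log).trans ((PMF.pure_bind _ _).trans (congrArg _ (funext fun π => ?_)))
  exact PMF.pure_bind _ _

/-- Simulated proofs are drawn independently, so the order of the questions does not matter: each
round splits off one coordinate of the independent family (`indep_eq_bind`). The induction is on the
number of missing honest proofs. -/
theorem proveLoop_sseAdversary (crs : Fin m → T.CRS n) (trap : Fin m → Option (T.nizk.Trap n))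
    (x : A.Base n) (c : Fin N → Fin m → T.Com n × Opening F n) (k : ℕ) :
    ∀ (p : Fin N → Option (T.Proof n)) (log : List (ShareStmt N m T.cs n × T.Proof n)),
    (Finset.univ.filter fun i => i ∉ Ki ∧ p i = none).card = k →
    (T.nizk.proveLoop (A.sseAdversary Km Ki haux ekLen hC z i₀) n crs trap k (x, c, p) log).map
        Prod.fst =
      (indep fun i => T.nizk.simP n (crs, trap, (i, fun j => (c i j).1))).map fun h =>
        ((x, c, fun i => if i ∉ Ki ∧ p i = none then some (h i) else p i) : A.ProofState n) := by
  induction k with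
  | zero =>
    intro p log h
    have hnone : ∀ i, ¬ (i ∉ Ki ∧ p i = none) := by
      simpa [Finset.filter_eq_empty_iff] using h
    simp only [hnone, if_false]
    exact (PMF.pure_map _ _).trans (PMF.map_const _ _).symm
  | succ k ih =>
    intro p log h
    obtain ⟨h1, h2⟩ := A.next_spec Ki i₀ (st := (x, c, p)) (exists_missing h)
    replace h2 : p (A.next Ki i₀ (x, c, p)) = none := h2
    set i := A.next Ki i₀ (x, c, p)
    rw [A.proveLoop_sseAdversary_succ, PMF.map_bind, indep_eq_bind _ i, PMF.map_bind]
    refine congrArg _ (funext fun π => ?_)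
    rw [ih _ _ (card_missing_update h1 h2 π h), PMF.map_comp]
    congr 1
    funext h
    refine Prod.ext rfl (Prod.ext rfl (funext fun j => ?_))
    by_cases hj : j = i
    · rw [hj]
      simp [h1, h2]
    · simp [hj]

/-- Every statement asked about bears the name of an honest identity. A statement of a corrupted
identity is therefore never in the log, so freshness holds automatically. -/
theorem log_proveLoop_sseAdversary (crs : Fin m → T.CRS n)
    (trap : Fin m → Option (T.nizk.Trap n)) (x : A.Base n)
    (c : Fin N → Fin m → T.Com n × Opening F n) (k : ℕ) :
    ∀ (p : Fin N → Option (T.Proof n)) (log : List (ShareStmt N m T.cs n × T.Proof n)),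
    (Finset.univ.filter fun i => i ∉ Ki ∧ p i = none).card = k → (∀ y ∈ log, y.1.1 ∉ Ki) →
    ∀ o ∈ (T.nizk.proveLoop (A.sseAdversary Km Ki haux ekLen hC z i₀) n crs trap k (x, c, p)
      log).support, ∀ y ∈ o.2, y.1.1 ∉ Ki := by
  induction k with
  | zero =>
    intro p log _ hlog o ho
    rw [(PMF.mem_support_pure_iff _ _).1 ho]
    exact hlog
  | succ k ih =>
    intro p log h hlog o ho
    obtain ⟨h1, h2⟩ := A.next_spec Ki i₀ (st := (x, c, p)) (exists_missing h)
    rw [A.proveLoop_sseAdversary_succ] at ho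
    obtain ⟨π, -, ho⟩ := (PMF.mem_support_bind_iff _ _ _).1 ho
    refine ih _ _ (card_missing_update h1 h2 π h) (fun y hy => ?_) o ho
    rcases List.mem_cons.1 hy with rfl | hy
    · exact h1
    · exact hlog y hy

end ProveLoop

/-- The freshness clause is void by the log invariant, and filling in the missing honest proofs
reproduces the seed of the simulation as far as identity `i₀` can notice. -/
theorem sseGame_sseAdversary {haux : PolyBounded aux} {ekLen : ℕ → ℕ}
    {C : ∀ n, PMF (Fin N → Fin m → T.Com n × Opening F n)} {hC : PPTSampler C}
    {z : ∀ n, Bits (aux n)} {i₀ : Fin N} (hi₀ : i₀ ∈ Ki)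
    (K₀ : ∀ n, PMF (T.CRS n × T.nizk.Trap n × Bits (ekLen n))) (E : Extractor T ekLen) (n : ℕ) :
    T.nizk.sseGame T.Rel K₀ E (A.sseAdversary Km Ki haux ekLen hC z i₀) n =
      A.simulation Km (K₀ n) (C n) (z n) fun ek e => (A.extracted Km Ki E ek e i₀).bind
        fun w => PMF.pure (decide (A.extractionFails Km Ki e i₀ w)) := by
  rw [NIZK.sseGame_eq_bind]
  unfold simulation
  refine congrArg _ (funext fun g => ?_)
  change PMF.bind (PMF.bind _ fun ω => PMF.bind _ fun c => PMF.pure _) _ = _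
  simp only [PMF.bind_bind]
  refine congrArg _ (funext fun ω => congrArg _ (funext fun c => ?_))
  set x : A.Base n := (z n, ω, fun j => (g j).1)
  clear_value x
  set crs := A.crsVector Km x
  have hcard : (Finset.univ.filter fun i => i ∉ Ki ∧
      (fun _ : Fin N => (none : Option (T.Proof n))) i = none).card = Kiᶜ.card := by
    congr 1
    ext i
    simp
  have hlog := A.log_proveLoop_sseAdversary (Km := Km) (haux := haux) (ekLen := ekLen) (hC := hC)
    (z := z) (i₀ := i₀) crs (keysOf (fun k => ((g k).1, (g k).2.1)) crs) x c _ _ [] hcard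
    (by simp)
  have hloop := A.proveLoop_sseAdversary (Km := Km) (haux := haux) (ekLen := ekLen) (hC := hC)
    (z := z) (i₀ := i₀) crs (keysOf (fun k => ((g k).1, (g k).2.1)) crs) x c _ _ [] hcard
  let G : A.ProofState n → PMF Bool := fun st =>
    (A.extracted Km Ki E (keysOf (fun k => ((g k).1, (g k).2.2)) crs) (A.seedOf st) i₀).bind
      fun w => PMF.pure (decide (A.extractionFails Km Ki (A.seedOf st) i₀ w))
  -- The proofs of corrupted identities may differ between `p` and `π`; by `proofD_congr` they do
  -- not matter.
  have hG : ∀ p π, (∀ i ∉ Ki, p i = some (π i)) → G (x, c, p) =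
      (A.extracted Km Ki E (keysOf (fun k => ((g k).1, (g k).2.2)) crs) (x, c, π) i₀).bind
      fun w => PMF.pure (decide (A.extractionFails Km Ki (x, c, π) i₀ w)) := by
    intro p π hp
    have hD : A.proofD Km Ki (A.seedOf (x, c, p)) i₀ = A.proofD Km Ki (x, c, π) i₀ :=
      A.proofD_congr Km Ki hi₀ x c fun i hi => by simp [hp i hi]
    have hfail : ∀ w, A.extractionFails Km Ki (A.seedOf (x, c, p)) i₀ w ↔
        A.extractionFails Km Ki (x, c, π) i₀ w := by
      intro w
      simp only [extractionFails, hD]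
      exact Iff.rfl
    simp only [G, extracted, hD, hfail]
    rfl
  refine (PMF.pure_bind _ _).trans ?_
  refine Eq.trans (b := (T.nizk.proveLoop (A.sseAdversary Km Ki haux ekLen hC z i₀) n crs
    (keysOf (fun k => ((g k).1, (g k).2.1)) crs) Kiᶜ.card (x, c, fun _ => none) []).bind
    fun o => G o.1) (PMF.bind_congr_support fun o ho => ?_) ?_
  · change PMF.bind (PMF.pure _) _ = _
    rw [PMF.pure_bind]
    -- The game verifies with the CRS vector fixed at the start, `extractionFails` with the one
    -- recomputed from the state; they agree since the loop leaves the base unchanged.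
    have hbase : o.1.1 = x := by
      have h : o.1 ∈ (PMF.map Prod.fst _).support := (PMF.mem_support_map_iff _ _ _).2 ⟨o, ho, rfl⟩
      replace h := (congrArg (fun q : PMF (A.ProofState n) => o.1 ∈ q.support) hloop).mp h
      obtain ⟨π, -, h⟩ := (PMF.mem_support_map_iff _ _ _).1 h
      rw [← h]
    obtain ⟨⟨x', c', p'⟩, log⟩ := o
    change x' = x at hbase
    subst hbase
    refine congrArg (PMF.bind (A.extracted Km Ki E (keysOf (fun k => ((g k).1, (g k).2.2)) crs)
      (A.seedOf (x', c', p')) i₀)) (funext fun w => ?_)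
    refine congrArg PMF.pure ?_
    rw [decide_eq_decide]
    exact and_iff_right fun hmem => hlog _ ho _ hmem hi₀
  · refine (PMF.bind_map _ Prod.fst G).symm.trans ?_
    refine (congrArg (fun q => PMF.bind q G) hloop).trans ((PMF.bind_map _ _ G).trans ?_)
    refine congrArg _ (funext fun π => ?_)
    exact hG _ π fun i hi => by simp [hi]

theorem sseAdversary_minorityConstrained (hKm : 2 * Km.card < m) (haux : PolyBounded aux)
    (ekLen : ℕ → ℕ) {C : ∀ n, PMF (Fin N → Fin m → T.Com n × Opening F n)} (hC : PPTSampler C)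
    (z : ∀ n, Bits (aux n)) (i₀ : Fin N) :
    (A.sseAdversary Km Ki haux ekLen hC z i₀).MinorityConstrained := by
  intro n gen o ho
  obtain ⟨ω, -, ho⟩ := (PMF.mem_support_bind_iff _ _ _).1 ho
  obtain ⟨c, -, ho⟩ := (PMF.mem_support_bind_iff _ _ _).1 ho
  rw [(PMF.mem_support_pure_iff _ _).1 ho]
  exact A.majorityGenerated_crsVector Km hKm (z n) ω fun j => (gen j).1

/-- In simulated executions, the reconstructed bids can be replaced by the extracted ones. -/
theorem simulation_compIndist_extracted (hbinding : T.cs.PerfectlyBinding)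
    (hKm : 2 * Km.card < m) (haux : PolyBounded aux) {ekLen : ℕ → ℕ}
    {K₀ : ∀ n, PMF (T.CRS n × T.nizk.Trap n × Bits (ekLen n))} {E : Extractor T ekLen}
    (hwin : ∀ B : T.nizk.SSEAdversary ekLen, B.MinorityConstrained →
      Negligible fun n => prTrue (T.nizk.sseGame T.Rel K₀ E B n))
    {C : ∀ n, PMF (Fin N → Fin m → T.Com n × Opening F n)} (hC : PPTSampler C)
    (z : ∀ n, Bits (aux n)) :
    CompIndist
      (fun n => A.simulation Km (K₀ n) (C n) (z n) fun _ e => PMF.pure (A.result Km Ki e))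
      (fun n => A.simulation Km (K₀ n) (C n) (z n) (A.extractedResult Km Ki E)) := by
  intro D _
  refine Negligible.of_le (Negligible.sum Ki fun i _ =>
    hwin (A.sseAdversary Km Ki haux ekLen hC z i)
      (A.sseAdversary_minorityConstrained Km Ki hKm haux ekLen hC z i)) fun n => ?_
  rw [abs_abs]
  refine (A.abs_prTrue_simulation_sub_le Km Ki hbinding hKm (K₀ n) E (C n) (z n) (D n)).trans
    (le_of_eq (Finset.sum_congr rfl fun i hi => ?_))
  rw [A.sseGame_sseAdversary Km Ki hi K₀ E n]

end Adversary

end Protocol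

/-! ### Hiding the honest shares, and the simulator -/

namespace Protocol

namespace Adversary

variable {F : Type} [Field F] [BitCode F] {m N : ℕ} {T : Protocol F m N} {aux : ℕ → ℕ}
  (A : T.Adversary aux) (Km : Finset (Fin m)) (Ki : Finset (Fin N)) {n : ℕ}

/-- A commitment to the share `s`; the opening is shown if `v` holds. -/
def commitment (T : Protocol F m N) (n : ℕ) (v : Prop) (s : F) : PMF (T.Com n × Opening F n) :=
  (PMF.uniformOfFintype (Bits n)).map fun r =>
    (T.commitTo n (s, r), if v then (s, r) else (0, zeroBits n))

/-- Commitments to the shares `s` of the corrupted miners and to the shares `s'` of the others. -/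
def commitments (T : Protocol F m N) (n : ℕ) (s s' : Fin N → Fin m → F) :
    PMF (Fin N → Fin m → T.Com n × Opening F n) :=
  indep fun i => indep fun j => commitment T n (j ∈ Km) (if j ∈ Km then s i j else s' i j)

/-- Each commitment has its own coins, so the table of commitments is a product distribution and can
be changed entry by entry. -/
theorem map_shown_openings (s : Fin N → Fin m → F) :
    (PMF.uniformOfFintype (Fin N → Fin m → Bits n)).map
      (fun r => shown (T := T) Km (openings s r)) = commitments Km T n s s := by
  rw [uniform_coins_eq_indep]
  have h := indep_map (fun _ : Fin N => indep fun _ : Fin m => PMF.uniformOfFintype (Bits n))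
    fun i r j => (T.commitTo n (s i j, r j), if j ∈ Km then (s i j, r j) else (0, zeroBits n))
  refine h.symm.trans (congrArg indep (funext fun i => ?_))
  have h' := indep_map (fun _ : Fin m => PMF.uniformOfFintype (Bits n))
    fun j r => (T.commitTo n (s i j, r), if j ∈ Km then (s i j, r) else (0, zeroBits n))
  refine h'.symm.trans (congrArg indep (funext fun j => ?_))
  by_cases hj : j ∈ Km <;> simp [commitment, hj]

theorem commitments_congr {s₁ s₂ : Fin N → Fin m → F} (s' : Fin N → Fin m → F)
    (h : ∀ i, ∀ j ∈ Km, s₁ i j = s₂ i j) :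
    commitments Km T n s₁ s' = commitments Km T n s₂ s' := by
  refine congrArg indep (funext fun i => congrArg indep (funext fun j => ?_))
  by_cases hj : j ∈ Km
  · rw [if_pos hj, if_pos hj, h i j hj]
  · rw [if_neg hj, if_neg hj]

theorem commitment_compIndist (hhiding : T.cs.ComputationallyHiding) (s s' : ℕ → F) :
    CompIndist (fun n => commitment T n False (s n)) (fun n => commitment T n False (s' n)) := by
  have h := CompIndist.bind (hhiding (fun n => T.enc n (s n)) fun n => T.enc n (s' n))
    (f := fun n c => PMF.pure ((c, (0, zeroBits n)) : T.Com n × Opening F n))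
    (PPT.pure (PolyTime.id.pair (PolyTime.const (β := fun n => Opening F n) fun n => (0, zeroBits n))))
  simp only [PMF.bind_map] at h
  simp only [commitment, if_false]
  exact h

/-- Moving the draw of the commitments to the front makes the remaining simulation a PPT
post-processing of them. -/
theorem simulation_eq_bind {α : Type} {ekLen : ℕ → ℕ}
    (K₀ : PMF (T.CRS n × T.nizk.Trap n × Bits (ekLen n)))
    (C : PMF (Fin N → Fin m → T.Com n × Opening F n)) (z : Bits (aux n))
    (Q : (Fin m → Option (Bits (ekLen n))) → A.Seed n → PMF α) :
    A.simulation Km K₀ C z Q = C.bind fun c => A.simulation Km K₀ (PMF.pure c) z Q := by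
  unfold simulation
  simp only [PMF.pure_bind]
  exact (congrArg _ (funext fun g => PMF.bind_comm _ _ _)).trans (PMF.bind_comm _ _ _)

variable [Fintype F]

theorem ppt_commitment {α : ℕ → Type} [∀ n, BitCode (α n)] (v : Prop) {s : ∀ n, α n → F}
    (hs : PolyTime (β := fun _ => F) s) : PPT fun n a => commitment T n v (s n a) := by
  refine PPT.map (PPT.uniform_bits PolyBounded.id) ?_
  have h : PolyTime (α := fun n => α n × Bits n) (β := fun n => Opening F n)
      fun n x => (s n x.1, x.2) :=
    (hs.comp PolyTime.id.fst).pair PolyTime.id.snd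
  refine (T.polyTime_commitTo h).pair ?_
  by_cases hv : v
  · simpa only [if_pos hv] using h
  · simpa only [if_neg hv] using PolyTime.const (β := fun n => Opening F n) fun n => (0, zeroBits n)

theorem ppt_commitments {α : ℕ → Type} [∀ n, BitCode (α n)] {s s' : ∀ n, α n → Fin N → Fin m → F}
    (hs : PolyTime (β := fun _ => Fin N → Fin m → F) s)
    (hs' : PolyTime (β := fun _ => Fin N → Fin m → F) s') :
    PPT fun n a => commitments Km T n (s n a) (s' n a) := by
  refine PPT.indep fun i => PPT.indep fun j => ?_
  by_cases hj : j ∈ Km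
  · simpa only [if_pos hj] using ppt_commitment (j ∈ Km) (PolyTime.apply (β := fun _ => F)
      (PolyTime.apply (β := fun _ => Fin m → F) hs i) j)
  · simpa only [if_neg hj] using ppt_commitment (j ∈ Km) (PolyTime.apply (β := fun _ => F)
      (PolyTime.apply (β := fun _ => Fin m → F) hs' i) j)

/-- Entries of corrupted miners, whose openings are shown, coincide on both sides. For the others no
opening is shown, so hiding applies; there are only `N * m` entries. -/
theorem commitments_compIndist (hhiding : T.cs.ComputationallyHiding)
    (s s' : ℕ → Fin N → Fin m → F) :
    CompIndist (fun n => commitments Km T n (s n) (s n))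
      (fun n => commitments Km T n (s n) (s' n)) := by
  have hc : ∀ (v : Prop) (s : ℕ → F), PPTSampler fun n => commitment T n v (s n) := fun v s =>
    ppt_commitment v (PolyTime.const (β := fun _ => F) s)
  refine CompIndist.indep (α := fun n => Fin m → T.Com n × Opening F n)
    (fun i => PPT.indep (α := fun _ => Fin 0 → Bool) fun j => hc _ fun n => _)
    (fun i => PPT.indep (α := fun _ => Fin 0 → Bool) fun j => hc _ fun n => _) fun i => ?_
  refine CompIndist.indep (fun j => hc _ fun n => _) (fun j => hc _ fun n => _) fun j => ?_
  by_cases hj : j ∈ Km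
  · simp only [hj, if_true]
    exact CompIndist.refl _
  · simp only [hj, if_false]
    exact commitment_compIndist hhiding _ _

theorem ppt_extractedResult {ekLen : ℕ → ℕ} {E : Extractor T ekLen} (hE : PPT E) :
    PPT fun n (x : (Fin m → Option (Bits (ekLen n))) × A.Seed n) =>
      A.extractedResult Km Ki E x.1 x.2 := by
  refine PPT.bind (PPT.indep fun i => hE.comp ?_) (PPT.pure ?_)
  · exact ((A.polyTime_crsVector Km).comp PolyTime.id.snd.fst).pair (PolyTime.id.fst.pair
      (((A.polyTime_stmt Km Ki i).comp PolyTime.id.snd).pair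
        ((A.polyTime_proofD Km Ki i).comp PolyTime.id.snd)))
  · have he : PolyTime (α := fun n => ((Fin m → Option (Bits (ekLen n))) × A.Seed n) ×
        (Fin N → ShareWit F m n)) fun n x => x.1.2 := PolyTime.id.fst.snd
    exact (A.polyTime_corruptBids Km Ki he fun i =>
      PolyTime.fst (β := fun _ => F) (PolyTime.apply (β := fun n => ShareWit F m n)
        PolyTime.id.snd i)).pair ((A.polyTime_view₆ Km Ki).comp he)

theorem ppt_simulation {α β : ℕ → Type} [∀ n, BitCode (α n)] [∀ n, BitCode (β n)] {ekLen : ℕ → ℕ}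
    (hek : PolyBounded ekLen) {K₀ : ∀ n, PMF (T.CRS n × T.nizk.Trap n × Bits (ekLen n))}
    (hK₀ : PPTSampler K₀) {C : ∀ n, α n → PMF (Fin N → Fin m → T.Com n × Opening F n)}
    (hC : PPT C) {z : ∀ n, α n → Bits (aux n)} (hz : PolyTime z)
    {Q : ∀ n, (Fin m → Option (Bits (ekLen n))) → A.Seed n → PMF (β n)}
    (hQ : PPT fun n (x : (Fin m → Option (Bits (ekLen n))) × A.Seed n) => Q n x.1 x.2) :
    PPT fun n a => A.simulation Km (K₀ n) (C n a) (z n a) (Q n) := by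
  let α₁ : ℕ → Type := fun n => (α n × (Fin m → T.CRS n × T.nizk.Trap n × Bits (ekLen n))) ×
    Bits (A.coins n)
  have hg : PolyTime (α := α₁) fun n x => x.1.2 := PolyTime.id.fst.snd
  have hx : PolyTime (α := α₁) (β := A.Base) fun n x => (z n x.1.1, x.2, fun j => (x.1.2 j).1) :=
    (hz.comp PolyTime.id.fst.fst).pair (PolyTime.id.snd.pair
      (PolyTime.pi (β := T.CRS) fun j => (hg.apply j).fst))
  have hcrs := (A.polyTime_crsVector Km).comp hx
  have htrap := polyTime_keysOf T.polyLength_crs (polyLength_trap (T := T)) (PolyTime.pi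
    (β := fun n => T.CRS n × T.nizk.Trap n) fun k =>
      (hg.apply k).fst.pair (hg.apply k).snd.fst) hcrs
  have hkey := polyTime_keysOf T.polyLength_crs (PolyLength.bits hek) (PolyTime.pi
    (β := fun n => T.CRS n × Bits (ekLen n)) fun k =>
      (hg.apply k).fst.pair (hg.apply k).snd.snd) hcrs
  refine PPT.bind (PPT.indep fun _ => PPT.of_sampler hK₀)
    (PPT.bind (PPT.uniform_bits A.coins_poly) (PPT.bind (hC.comp PolyTime.id.fst.fst)
      (PPT.bind (PPT.indep (A.ppt_simulatedProof Km (htrap.comp PolyTime.id.fst)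
        PolyTime.id.snd (hx.comp PolyTime.id.fst)))
        ?_)))
  exact hQ.comp ((hkey.comp PolyTime.id.fst.fst).pair ((hx.comp PolyTime.id.fst.fst).pair
    (PolyTime.id.fst.snd.pair PolyTime.id.snd)))

/-- The simulator: it commits to shares of zero bids, and extracts the bids of the corrupted
identities from their proofs. -/
def simulator (haux : PolyBounded aux) {ekLen : ℕ → ℕ} (hek : PolyBounded ekLen)
    {K₀ : ∀ n, PMF (T.CRS n × T.nizk.Trap n × Bits (ekLen n))} (hK₀ : PPTSampler K₀)
    {E : Extractor T ekLen} (hE : PPT E) : T.Simulator aux A.coins where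
  State n := T.View₆ aux A.coins n
  state_poly := by
    have hopt := ((polyLength_opening (F := F)).option.pi m).pi N
    exact ((((((((PolyLength.bits haux).prod (PolyLength.bits A.coins_poly)).prod
      (T.polyLength_crs.option.pi m)).prod ((T.polyLength_com.pi m).option.pi N)).prod
      (T.polyLength_proof.option.pi N)).prod hopt).prod
      (((PolyLength.fixed Bool).option.pi N).pi m)).prod hopt)
  bids n z := (almostUniform (Fin N → Fin (threshold m - 1) → F) n).bind fun a =>
    A.simulation Km (K₀ n) (commitments Km T n (sharesOf T 0 a) 0) z (A.extractedResult Km Ki E)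
  -- The adversary has been run in full before the bids are submitted; the outcome only has to be
  -- appended to the view kept as state.
  view n x := PMF.pure x
  bids_ppt := by
    refine PPT.bind (β := fun _ => Fin N → Fin (threshold m - 1) → F) almostUniform_ppt ?_
    exact A.ppt_simulation Km hek hK₀ (ppt_commitments Km
      (PolyTime.of_finite _ (Fin N → Fin m → F) (fun _ a => sharesOf T 0 a)
        (PolyTime.snd PolyTime.id)) (PolyTime.const (β := fun _ => Fin N → Fin m → F) fun _ => 0))
      PolyTime.id.fst (A.ppt_extractedResult Km Ki hE)
  view_ppt := PPT.pure PolyTime.id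

theorem ideal_simulator (haux : PolyBounded aux) {ekLen : ℕ → ℕ} (hek : PolyBounded ekLen)
    {K₀ : ∀ n, PMF (T.CRS n × T.nizk.Trap n × Bits (ekLen n))} (hK₀ : PPTSampler K₀)
    {E : Extractor T ekLen} (hE : PPT E) (b : Fin N → F) (z : Bits (aux n)) :
    T.ideal Km Ki (A.simulator Km Ki haux hek hK₀ hE) n b z =
      ((almostUniform (Fin N → Fin (threshold m - 1) → F) n).bind fun a =>
        A.simulation Km (K₀ n) (commitments Km T n (sharesOf T 0 a) 0) z
          (A.extractedResult Km Ki E)).bind (A.finalize Km Ki b) := by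
  refine congrArg (PMF.bind _) (funext fun x => congrArg (PMF.bind _) (funext fun out => ?_))
  exact PMF.pure_bind _ _

/-- Shares of honest miners have already been replaced by 0, so only fewer than `threshold m` shares
per identity occur, and their joint law is the same for every secret. -/
theorem uniform_bind_commitments_sharesOf {α : Type} (hKm : 2 * Km.card < m) (b : Fin N → F)
    (f : PMF (Fin N → Fin m → T.Com n × Opening F n) → PMF α) :
    ((PMF.uniformOfFintype (Fin N → Fin (threshold m - 1) → F)).bind fun a =>
      f (commitments Km T n (sharesOf T b a) 0)) =
    (PMF.uniformOfFintype (Fin N → Fin (threshold m - 1) → F)).bind fun a =>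
      f (commitments Km T n (sharesOf T 0 a) 0) := by
  have ht : Km.card < threshold m := by unfold threshold; omega
  have h := congrArg (fun p => p.bind fun s => f (commitments Km T n s 0))
    (uniform_map_shareOf_masked T.pt_ne_zero ht b)
  simp only [PMF.bind_map] at h
  have hc : ∀ (b : Fin N → F) a, commitments Km T n (sharesOf T b a) 0 =
      commitments Km T n (fun i j => if j ∈ Km then shareOf T.pt (b i) (a i) j else 0) 0 :=
    fun b a => commitments_congr Km 0 fun i j hj => (if_pos hj).symm
  simp only [hc]
  exact h

theorem real_compIndist_ideal (hbinding : T.cs.PerfectlyBinding)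
    (hhiding : T.cs.ComputationallyHiding) (hcomplete : T.nizk.Complete T.Rel)
    (hzk : T.nizk.ZeroKnowledge T.Rel) (hKm : 2 * Km.card < m) (haux : PolyBounded aux)
    {ekLen : ℕ → ℕ} (hek : PolyBounded ekLen)
    {K₀ : ∀ n, PMF (T.CRS n × T.nizk.Trap n × Bits (ekLen n))} (hK₀ : PPTSampler K₀)
    {E : Extractor T ekLen} (hE : PPT E)
    (hsim : ∀ n, (K₀ n).map (fun s => (s.1, s.2.1)) = T.nizk.simK n)
    (hwin : ∀ B : T.nizk.SSEAdversary ekLen, B.MinorityConstrained →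
      Negligible fun n => prTrue (T.nizk.sseGame T.Rel K₀ E B n))
    (b : ℕ → Fin N → F) (z : ∀ n, Bits (aux n)) :
    CompIndist (fun n => T.real Km Ki A n (b n) (z n))
      (fun n => T.ideal Km Ki (A.simulator Km Ki haux hek hK₀ hE) n (b n) (z n)) := by
  have ht : 1 ≤ threshold m := by unfold threshold; omega
  simp only [Protocol.real_eq A Km Ki hbinding hcomplete hKm, ideal_simulator]
  refine CompIndist.bind ?_ (A.ppt_finalize Km Ki b)
  have hsampler : ∀ s s' : ℕ → Fin N → Fin m → F,
      PPTSampler fun n => commitments Km T n (s n) (s' n) := fun s s' =>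
    ppt_commitments Km (PolyTime.const (β := fun _ => Fin N → Fin m → F) s)
      (PolyTime.const (β := fun _ => Fin N → Fin m → F) s')
  -- For fixed coefficients the shares are advice. They may depend on the honest bids, which the
  -- reductions are allowed to know, unlike the simulator.
  have hfixed : ∀ a : Fin N → Fin (threshold m - 1) → F,
      CompIndist (fun n => A.crsExperiment Km Ki (indep fun _ => T.nizk.K n) (z n) (b n)
          (sharesOf T (b n) a))
        (fun n => A.simulation Km (K₀ n) (commitments Km T n (sharesOf T (b n) a) 0) (z n)
          (A.extractedResult Km Ki E)) := by
    intro a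
    refine (A.crsExperiment_compIndist_proofExperiment Km Ki hzk hKm haux z b
      (fun n => sharesOf T (b n) a) fun n i => isSharing_shareOf ht T.pt (b n i) (a i)).trans ?_
    simp only [A.proofExperiment_eq_simulation Km Ki (hsim _), map_shown_openings]
    refine (A.simulation_compIndist_extracted Km Ki hbinding hKm haux hwin
      (hsampler _ _) z).trans ?_
    have h := (commitments_compIndist Km hhiding (fun n => sharesOf T (b n) a) fun _ => 0).bind
      (A.ppt_simulation Km hek hK₀ (PPT.pure PolyTime.id) (PolyTime.const z)
        (A.ppt_extractedResult Km Ki hE))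
    simpa only [← simulation_eq_bind] using h
  -- Averaging over the coefficients needs no sampler for them, because their type does not vary
  -- with the security parameter.
  refine (CompIndist.mixture (fun _ => PMF.uniformOfFintype _) hfixed).trans ?_
  have hsecret : ∀ n, _ = _ := fun n => uniform_bind_commitments_sharesOf (n := n) (T := T) Km hKm (b n) fun C =>
    A.simulation Km (K₀ n) C (z n) (A.extractedResult Km Ki E)
  simp only [hsecret]
  -- The simulator cannot in general draw exactly uniform coefficients from random bits, so its
  -- sampler is only statistically close; the rest of the simulation is post-processing.
  refine CompIndist.bind (almostUniform_compIndist (κ := Fin N → Fin (threshold m - 1) → F)).symm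
    (f := fun n a => A.simulation Km (K₀ n) (commitments Km T n (sharesOf T 0 a) 0) (z n)
      (A.extractedResult Km Ki E)) ?_
  exact A.ppt_simulation Km hek hK₀ (ppt_commitments Km
      (PolyTime.of_finite _ (Fin N → Fin m → F) (fun _ a => sharesOf T 0 a) PolyTime.id)
      (PolyTime.const (β := fun _ => Fin N → Fin m → F) fun _ => 0))
    (PolyTime.const z) (A.ppt_extractedResult Km Ki hE)

end Adversary

end Protocol

end MPCAuction

end

theorem mainTheorem9 {F : Type} [Field F] [Fintype F] [MPCAuction.BitCode F] {m N : ℕ}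
    (T : MPCAuction.Protocol F m N)
    (hbinding : T.cs.PerfectlyBinding)
    (hhiding : T.cs.ComputationallyHiding)
    (hcomplete : T.nizk.Complete T.Rel)
    (hzk : T.nizk.ZeroKnowledge T.Rel)
    (hsse : T.nizk.SimulationSoundExtractable T.Rel)
    (Km : Finset (Fin m)) (Ki : Finset (Fin N)) (hminority : 2 * Km.card < m) :
    T.SecurelyRealizes Km Ki := by
  intro aux haux A
  obtain ⟨ekLen, K₀, E, hek, hK₀, hE, hsim, hwin⟩ := hsse
  exact ⟨A.simulator Km Ki haux hek hK₀ hE, fun b z => A.real_compIndist_ideal Km Ki hbinding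
    hhiding hcomplete hzk hminority haux hek hK₀ hE hsim hwin b z⟩
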